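/- **Setting.** Let $K\ge 1$ be the number of arms and $T\ge 2$ the horizon. A preference matrix is $P\in[0,1]^{K\times K}$ with $P(a,b)=1-P(b,a)$ for all $a,b\in[K]$ (so $P(a,a)=\tfrac12$). A sequence $P_1,\dots,P_T$ of preference matrices is fixed in advance (oblivious adversary), and every $P_t$ has a Condorcet winner $a_t^*$, i.e. $P_t(a_t^*,b)>\tfrac12$ for all $b\neq a_t^*$. Put $\delta_t(a,b)=P_t(a,b)-\tfrac12$. In round $t$ the learner picks a pair $(a_t,b_t)\in[K]^2$ and observes $o_t\sim\mathrm{Ber}(P_t(a_t,b_t))$. The dynamic regret and the Condorcet Winner Variation are $$\mathrm{DR}(T)=\sum_{t=1}^T\frac{\delta_t(a_t^*,a_t)+\delta_t(a_t^*,b_t)}2,\qquad V^{\mathtt{CW}}=\sum_{t=2}^T\max_{a\in[K]}\bigl|P_t(a_t^*,a)-P_{t-1}(a_t^*,a)\bigr|.$$ **Assumptions.** Write $a\succeq_t b$ if $P_t(a,b)\ge\tfrac12$. For every $t\in[T]$ and all $a,b,c\in[K]$ with $a\succeq_t b\succeq_t c$: (SST) $\delta_t(a,c)\ge\max\{\delta_t(a,b),\delta_t(b,c)\}$;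 (STI) $\delta_t(a,c)\le\delta_t(a,b)+\delta_t(b,c)$. **Algorithm ANACONDA** (input: $K$, $T$ and a constant $C>0$). With $\mathcal A_t$ the set from which the pair of round $t$ is drawn, let $\hat\delta_t(a,b)=|\mathcal A_t|^2\,\mathbf 1\{a_t=a,b_t=b\}\,o_t-\tfrac12$. For rounds $l\le u$ let $E(l,u)$ be the set of arms $a$ for which there are rounds $l\le s_1<s_2<u$ with $$\max_{a'\in[K]}\sum_{t=s_1}^{s_2}\hat\delta_t(a',a)>C\log(T)\,K\sqrt{\max\{s_2-s_1,K^2\}}.$$ The rounds are divided into episodes; the first starts in round $1$. When an episode starts in round $t_\ell$, set $\mathcal A_{\mathrm{good}}=[K]$, draw fresh independent $B_{s,m}\sim\mathrm{Ber}\bigl(1/\sqrt{m(s-t_\ell)}\bigr)$ for $s\in\{t_\ell+1,\dots,T\}$ and $m\in\{2,4,8,\dots,2^{\lceil\log_2T\rceil}\}$, and run $\mathrm{CondaLet}(t_\ell,T+1-t_\ell)$; when this call returns and rounds are left, the next episode starts. A call $\mathrm{CondaLet}(t_0,m_0)$ starts with active set $[K]$ and repeats the following as long as $t\le T$, $t\le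 t_0+m_0$ and $\mathcal A_{\mathrm{good}}\ne\emptyset$, where $t$ is the current round: draw $a_t,b_t$ independently and uniformly from its active set (from $[K]$ if that set is empty), observe $o_t$, remove $E(t_\ell,t)$ from $\mathcal A_{\mathrm{good}}$, and increase $t$ by $1$; if $B_{t,m}=1$ for some $m$, run $\mathrm{CondaLet}(t,m)$ with the largest such $m$ and wait until it returns, with $t$ the then current round; then remove $E(t_0,t)$ from its own active set. **Corollary.** There are universal constants $C>0$, $c>0$ and $p\in\mathbb N$ such that, for all $K\ge1$, all $T\ge2$ and all sequences $P_1,\dots,P_T$ as above that satisfy SST and STI, ANACONDA with the constant $C$ satisfies $$\mathbb E[\mathrm{DR}(T)]\le c\,(\log T)^p\Bigl(K\sqrt T+(V^{\mathtt{CW}})^{1/3}(KT)^{2/3}\Bigr),$$ i.e. it has dynamic regret $\tilde O\bigl(K\sqrt T+(V^{\mathtt{CW}})^{1/3}(KT)^{2/3}\bigr)$ without knowing $V^{\mathtt{CW}}$. -/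

import Mathlib

noncomputable section

namespace DuelingBandit

/-! ### Preference matrices, Condorcet winners, transitivity -/

/-- A preference matrix on the arms `Fin K`: `p a b` is the probability that `a` beats `b`. -/
structure PrefMatrix (K : ℕ) where
  p : Fin K → Fin K → unitInterval
  symm_half : ∀ a b, (p a b : ℝ) = 1 - (p b a : ℝ)

namespace PrefMatrix

variable {K : ℕ}

/-- The gap `δ(a, b) = P(a, b) - 1/2`. -/
def gap (M : PrefMatrix K) (a b : Fin K) : ℝ := (M.p a b : ℝ) - 1 / 2

/-- `a` is the Condorcet winner: it beats every other arm with probability `> 1/2`. -/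
def IsCondorcetWinner (M : PrefMatrix K) (a : Fin K) : Prop :=
  ∀ b, b ≠ a → 1 / 2 < (M.p a b : ℝ)

/-- `a` is (weakly) preferred to `b`. -/
def Pref (M : PrefMatrix K) (a b : Fin K) : Prop := 1 / 2 ≤ (M.p a b : ℝ)

/-- Strong stochastic transitivity. -/
def SST (M : PrefMatrix K) : Prop :=
  ∀ a b c, M.Pref a b → M.Pref b c → max (M.gap a b) (M.gap b c) ≤ M.gap a c

/-- Stochastic triangle inequality. -/
def STI (M : PrefMatrix K) : Prop :=
  ∀ a b c, M.Pref a b → M.Pref b c → M.gap a c ≤ M.gap a b + M.gap b c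

end PrefMatrix

/-- Condorcet Winner Variation `∑_{t=2}^T max_a |P_t(a*_t, a) - P_{t-1}(a*_t, a)|` of the
preference sequence `P`, where `w t` is the Condorcet winner of round `t`. -/
def cwVariation {K : ℕ} [NeZero K] (T : ℕ) (P : ℕ → PrefMatrix K) (w : ℕ → Fin K) : ℝ :=
  ∑ t ∈ Finset.Icc 2 T, Finset.univ.sup' Finset.univ_nonempty
    (fun a : Fin K => |((P t).p (w t) a : ℝ) - ((P (t - 1)).p (w t) a : ℝ)|)

/-! ### What happens in one round, gap estimates, elimination rule -/

/-- Record of one round: the set of arms the pair was drawn from, the two arms of the duel, and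
the observed outcome (`true` if the first arm won). -/
structure Round (K : ℕ) where
  active : Finset (Fin K)
  fst : Fin K
  snd : Fin K
  win : Bool

instance {K : ℕ} [NeZero K] : Inhabited (Round K) := ⟨⟨∅, 0, 0, false⟩⟩

/-- Importance weighted estimate `|A_t|² 1{a_t = a, b_t = b} o_t(a, b) - 1/2` of `δ_t(a, b)`. -/
def Round.gapEst {K : ℕ} (r : Round K) (a b : Fin K) : ℝ :=
  (if r.fst = a ∧ r.snd = b then (r.active.card : ℝ) ^ 2 * (if r.win then 1 else 0) else 0) - 1 / 2

open Classical in
/-- The arms `a` for which some interval of rounds `[s₁, s₂] ⊆ [l, u)`, `s₁ < s₂`, satisfies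
`max_{a'} ∑_{t=s₁}^{s₂} δ̂_t(a', a) > C log(T) K √((s₂ - s₁) ∨ K²)`; `H t` is the record of
round `t`. -/
def elimSet {K : ℕ} (C : ℝ) (T : ℕ) (H : ℕ → Round K) (l u : ℕ) : Finset (Fin K) :=
  Finset.univ.filter fun a => ∃ s₁ s₂ : ℕ, l ≤ s₁ ∧ s₁ < s₂ ∧ s₂ < u ∧ ∃ a' : Fin K,
    C * Real.log T * K * √(max ((s₂ : ℝ) - s₁) ((K : ℝ) ^ 2))
      < ∑ t ∈ Finset.Icc s₁ s₂, (H t).gapEst a' a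

/-! ### Replay schedules -/

set_option linter.deprecated false in
/-- A Bernoulli variable with success probability `p`. -/
def coin (p : unitInterval) : PMF Bool := PMF.bernoulli ⟨(p : ℝ), p.2.1⟩ p.2.2

/-- `1 / √(m (s - l))`, the probability of scheduling a replay of duration `m` in round `s` of an
episode that started in round `l`. -/
def replayProb (l s m : ℕ) : unitInterval :=
  ⟨1 / √((m * (s - l) : ℕ) : ℝ), by
    refine ⟨by positivity, ?_⟩
    rcases Nat.eq_zero_or_pos (m * (s - l)) with h | h
    · simp [h]
    · have h1 : (1 : ℝ) ≤ √((m * (s - l) : ℕ) : ℝ) :=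
        Real.one_le_sqrt.mpr (by exact_mod_cast h)
      exact (div_le_one (by linarith)).mpr h1⟩

/-- The possible replay durations `2, 4, 8, …, 2 ^ ⌈log₂ T⌉`. -/
def durations (T : ℕ) : List ℕ := (List.range (Nat.clog 2 T)).map fun i => 2 ^ (i + 1)

/-- Independent Bernoulli variables `B_{s,m}` for the pairs `(s, m)` of the list, with success
probabilities `1 / √(m (s - l))`; the other entries are `false`. -/
def sampleList (l : ℕ) : List (ℕ × ℕ) → PMF (ℕ → ℕ → Bool)
  | [] => PMF.pure fun _ _ => false
  | (s, m) :: rest => do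
      let B ← sampleList l rest
      let x ← coin (replayProb l s m)
      return Function.update B s (Function.update (B s) m x)

/-- The replay schedule of an episode that starts in round `l`: independent `B_{s,m}` for
`s ∈ {l + 1, …, T}` and `m ∈ durations T`. -/
def sampleSchedule (T l : ℕ) : PMF (ℕ → ℕ → Bool) :=
  sampleList l ((List.range' (l + 1) (T - l)).product (durations T))

/-! ### The algorithm -/

/-- A call of CondaLet that has not returned yet: its scheduled time, its duration, and its set of
active arms (for an interrupted call, the set that it saved). -/
structure Call (K : ℕ) where
  start : ℕ
  dur : ℕ
  active : Finset (Fin K)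

/-- State of the algorithm just before a round is played: start of the current episode, good arms,
replay schedule of the episode, stack of calls of CondaLet (the running call first, below it the
calls that it interrupted, the root call last), and the records of the rounds played so far. -/
structure State (K : ℕ) where
  epStart : ℕ
  good : Finset (Fin K)
  sched : ℕ → ℕ → Bool
  calls : List (Call K)
  hist : ℕ → Round K

instance {K : ℕ} : MeasurableSpace (State K) := ⊤

/-- A new episode begins in round `l`: all arms are good, a fresh schedule is sampled, and the root
call of CondaLet, of duration `T + 1 - l`, is started. -/
def newEpisode {K : ℕ} (T l : ℕ) (H : ℕ → Round K) : PMF (State K) := do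
  let B ← sampleSchedule T l
  return ⟨l, Finset.univ, B, [⟨l, T + 1 - l, Finset.univ⟩], H⟩

/-- The arms from which the running call draws its pair. If all of its arms have been eliminated
while there are still good arms (the good arms are updated one round later), it draws from all
arms. -/
def State.playSet {K : ℕ} (S : State K) : Finset (Fin K) :=
  match S.calls with
  | [] => Finset.univ
  | c :: _ => if c.active = ∅ then Finset.univ else c.active

theorem State.playSet_nonempty {K : ℕ} [NeZero K] (S : State K) : S.playSet.Nonempty := by
  unfold State.playSet
  split
  · exact Finset.univ_nonempty
  · split_ifs with h
    · exact Finset.univ_nonempty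
    · exact Finset.nonempty_iff_ne_empty.mpr h

/-- Before round `t`: the call on top of the stack removes the eliminated arms from its active set
and continues if it has not expired and a good arm is left; otherwise it returns and the call below
it does the same. -/
def resume {K : ℕ} (C : ℝ) (T : ℕ) (H : ℕ → Round K) (t : ℕ) (good : Finset (Fin K)) :
    List (Call K) → List (Call K)
  | [] => []
  | c :: rest =>
      if t ≤ c.start + c.dur ∧ good.Nonempty then
        { c with active := c.active \ elimSet C T H c.start t } :: rest
      else resume C T H t good rest

/-- The durations `m` with `B_{s,m} = 1`. -/
def scheduled (T : ℕ) (B : ℕ → ℕ → Bool) (s : ℕ) : List ℕ := (durations T).filter fun m => B s m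

/-- The calls after the scheduled child (if any) of round `s`, with the largest of the scheduled
durations, has been put on top of the stack. -/
def pushChild {K : ℕ} (T : ℕ) (B : ℕ → ℕ → Bool) (s : ℕ) (calls : List (Call K)) :
    List (Call K) :=
  match (scheduled T B s).max? with
  | none => calls
  | some m => ⟨s, m, Finset.univ⟩ :: calls

/-- Round `t` has been played with record `r`: update the good arms, start the scheduled child of
round `t + 1`, resume the calls, and begin a new episode if no call is left. -/
def advance {K : ℕ} (C : ℝ) (T t : ℕ) (S : State K) (r : Round K) : PMF (State K) :=
  let H := Function.update S.hist t r
  let good := S.good \ elimSet C T H S.epStart t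
  let calls := resume C T H (t + 1) good (pushChild T S.sched (t + 1) S.calls)
  if calls = [] then newEpisode T (t + 1) H
  else PMF.pure ⟨S.epStart, good, S.sched, calls, H⟩

/-- Play round `t`: two independent uniform arms from the active set, a Bernoulli outcome with
success probability `P_t(a_t, b_t)`, then the update. -/
def playRound {K : ℕ} [NeZero K] (C : ℝ) (T : ℕ) (P : ℕ → PrefMatrix K) (t : ℕ) (S : State K) :
    PMF (State K) := do
  let a ← PMF.uniformOfFinset S.playSet S.playSet_nonempty
  let b ← PMF.uniformOfFinset S.playSet S.playSet_nonempty
  let o ← coin ((P t).p a b)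
  advance C T t S ⟨S.playSet, a, b, o⟩

/-- Law of the state of ANACONDA (horizon `T`, threshold constant `C`, preference sequence `P`)
after `n` rounds. -/
def anaconda {K : ℕ} [NeZero K] (C : ℝ) (T : ℕ) (P : ℕ → PrefMatrix K) : ℕ → PMF (State K)
  | 0 => newEpisode T 1 fun _ => default
  | n + 1 => do
      let S ← anaconda C T P n
      playRound C T P (n + 1) S

/-- Dynamic regret `∑_{t=1}^T (δ_t(a*_t, a_t) + δ_t(a*_t, b_t)) / 2` of the duels in `H`. -/
def dynRegret {K : ℕ} (T : ℕ) (P : ℕ → PrefMatrix K) (w : ℕ → Fin K) (H : ℕ → Round K) : ℝ :=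
  ∑ t ∈ Finset.Icc 1 T,
    ((P t).gap (w t) (H t).fst + (P t).gap (w t) (H t).snd) / 2

/-- The dynamic regret is bounded, hence integrable, so its expectation below is not a default
value. -/
theorem integrable_dynRegret {K : ℕ} [NeZero K] (C : ℝ) (T n : ℕ) (P : ℕ → PrefMatrix K)
    (w : ℕ → Fin K) :
    MeasureTheory.Integrable (fun S : State K => dynRegret T P w S.hist)
      (anaconda C T P n).toMeasure := by
  refine MeasureTheory.Integrable.of_bound (C := (T : ℝ))
    (Measurable.aestronglyMeasurable fun _ _ => trivial) (Filter.Eventually.of_forall fun S => ?_)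
  have hg : ∀ t a b, |(P t).gap a b| ≤ 1 := fun t a b => by
    have h := ((P t).p a b).2
    rw [PrefMatrix.gap, abs_le]
    constructor <;> linarith [h.1, h.2]
  calc ‖dynRegret T P w S.hist‖ ≤ ∑ t ∈ Finset.Icc 1 T, (1 : ℝ) := by
        refine norm_sum_le_of_le _ fun t _ => ?_
        have h1 := abs_le.mp (hg t (w t) (S.hist t).fst)
        have h2 := abs_le.mp (hg t (w t) (S.hist t).snd)
        rw [Real.norm_eq_abs, abs_le]
        constructor <;> linarith [h1.1, h1.2, h2.1, h2.2]
    _ = T := by simp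

/-- Expected dynamic regret of ANACONDA over the horizon `T`. -/
def expectedRegret {K : ℕ} [NeZero K] (C : ℝ) (T : ℕ) (P : ℕ → PrefMatrix K) (w : ℕ → Fin K) : ℝ :=
  ∫ S, dynRegret T P w S.hist ∂(anaconda C T P T).toMeasure

end DuelingBandit

end

/-! Everything is expressed through the regrets r_t(a) = δ_t(a*_t, a). SST and STI give r_t(b) - 2
r_t(a) ≤ δ_t(a, b) ≤ r_t(b), and r_t moves per round by at most twice the corresponding summand of
the variation V (`isEnv_gap`). From then on only `IsEnv` matters, not the identity of the winners.
An exponential supermartingale keeps all interval sums of gap estimates within half the elimination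
threshold of their conditional means (`Concentrated`). Hence an eliminated arm has accumulated
regret on some interval, and two arms that stay active without elimination are comparable.

Cut the rounds into blocks of length `len`, and let W be the variation inside a block. In an episode
of n rounds, fix an arm that survives until just before its end. A played arm and the survivor have
both been active since the running call and the block began, so the played arm has regret at most
twice that of the survivor, plus O(W), plus K log T / √age, with age counted from the later of the
two starts (`IsRun.regret_le_of_active`). Two sums remain. (1) Ages of calls: about √(n/m) replays
of duration m cost about √m each, hence √n for each of the O(log T) durations, up to logarithms
(`IsRun.sum_invSqrtGap_st_le`). (2) The survivor: if its regret ρ in a block is large compared with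
W, a replay of duration m ≈ (K log T / ρ)² inside the block would eliminate it. None was scheduled,
although each suitable round schedules one with probability at least 1/√(mn). So there are at most
about √(mn) log T such rounds, of total regret about K √n log² T (`IsRun.sum_regret_survivor_le`).

Thus an episode costs K √n up to logarithms, plus block terms. A completed episode eliminates every
arm, so it is longer than `len` or contains variation at least K/√n; either way K √n is charged to
its rounds (`sqrt_le_of_completed`). Summing gives K √T + K T/√len + len · V, and len ≈ (K
T/V)^(2/3), capped at T, balances the terms.

Randomness enters only through `Concentrated` and `GoodSchedule`. The detection rounds depend on the
environment and the episode start alone, so `GoodSchedule` is an event about the schedule and needs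
no independence from the duels. If K² ≤ T the failure probability is O(T⁻³), harmless since the
regret is at most T; if K² > T, then K √T ≥ T and the bound is trivial. -/

namespace DuelingBandit

open scoped ENNReal

/-! ### Expectations of `ℝ≥0∞`-valued functions under a `PMF` -/

/-- Expectation of an `ℝ≥0∞`-valued function. -/
noncomputable def expect {α : Type*} (p : PMF α) (f : α → ℝ≥0∞) : ℝ≥0∞ := ∑' a, p a * f a

section expect

variable {α β : Type*}

theorem expect_pure (a : α) (f : α → ℝ≥0∞) : expect (PMF.pure a) f = f a := by
  unfold expect
  rw [tsum_eq_single a]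
  · simp
  · intro b hb
    simp [PMF.pure_apply, hb]

theorem expect_bind (p : PMF α) (g : α → PMF β) (f : β → ℝ≥0∞) :
    expect (p.bind g) f = expect p fun a => expect (g a) f := by
  unfold expect
  simp only [PMF.bind_apply, ← ENNReal.tsum_mul_right, ← ENNReal.tsum_mul_left]
  rw [ENNReal.tsum_comm]
  simp only [mul_assoc]

theorem expect_mono_of_support (p : PMF α) {f g : α → ℝ≥0∞} (h : ∀ a ∈ p.support, f a ≤ g a) :
    expect p f ≤ expect p g := by
  refine ENNReal.tsum_le_tsum fun a => ?_
  by_cases ha : p a = 0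
  · simp [ha]
  · exact mul_le_mul_right (h a ((PMF.mem_support_iff _ _).2 ha)) _

theorem expect_mono (p : PMF α) {f g : α → ℝ≥0∞} (h : ∀ a, f a ≤ g a) :
    expect p f ≤ expect p g :=
  expect_mono_of_support p fun a _ => h a

theorem expect_const (p : PMF α) (c : ℝ≥0∞) : expect p (fun _ => c) = c := by
  unfold expect
  rw [ENNReal.tsum_mul_right, p.tsum_coe, one_mul]

theorem expect_const_mul (p : PMF α) (c : ℝ≥0∞) (f : α → ℝ≥0∞) :
    expect p (fun a => c * f a) = c * expect p f := by
  unfold expect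
  rw [← ENNReal.tsum_mul_left]
  exact tsum_congr fun a => by ring

theorem expect_add (p : PMF α) (f g : α → ℝ≥0∞) :
    expect p (fun a => f a + g a) = expect p f + expect p g := by
  unfold expect
  rw [← ENNReal.tsum_add]
  exact tsum_congr fun a => by ring

theorem expect_sum {ι : Type*} (p : PMF α) (s : Finset ι) (f : ι → α → ℝ≥0∞) :
    expect p (fun a => ∑ i ∈ s, f i a) = ∑ i ∈ s, expect p (f i) := by
  classical
  induction s using Finset.induction_on with
  | empty => simp [expect]
  | insert i s hi ih => simp only [Finset.sum_insert hi, expect_add, ih]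

/-- Probability of an event. -/
noncomputable def prob (p : PMF α) (A : α → Prop) : ℝ≥0∞ :=
  open Classical in expect p fun a => if A a then 1 else 0

theorem prob_mono_of_support (p : PMF α) {A B : α → Prop} (h : ∀ a ∈ p.support, A a → B a) :
    prob p A ≤ prob p B := by
  classical
  refine expect_mono_of_support p fun a ha => ?_
  by_cases hA : A a
  · simp [hA, h a ha hA]
  · simp [hA]

theorem prob_or_le (p : PMF α) (A B : α → Prop) :
    prob p (fun a => A a ∨ B a) ≤ prob p A + prob p B := by
  classical
  unfold prob
  rw [← expect_add]
  refine expect_mono p fun a => ?_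
  by_cases hA : A a <;> by_cases hB : B a <;> simp [hA, hB]

theorem prob_exists_le {ι : Type*} (p : PMF α) (s : Finset ι) (A : ι → α → Prop) (c : ℝ≥0∞)
    (h : ∀ i ∈ s, prob p (A i) ≤ c) : prob p (fun a => ∃ i ∈ s, A i a) ≤ s.card * c := by
  classical
  calc prob p (fun a => ∃ i ∈ s, A i a)
      ≤ expect p (fun a => ∑ i ∈ s, if A i a then (1 : ℝ≥0∞) else 0) := by
        refine expect_mono p fun a => ?_
        split_ifs with hA
        · obtain ⟨i, hi, hA⟩ := hA
          calc (1 : ℝ≥0∞) = if A i a then (1 : ℝ≥0∞) else 0 := by simp [hA]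
            _ ≤ _ := Finset.single_le_sum (f := fun i => if A i a then (1 : ℝ≥0∞) else 0)
                (fun _ _ => zero_le) hi
        · exact zero_le
    _ = ∑ i ∈ s, prob p (A i) := expect_sum p s _
    _ ≤ ∑ i ∈ s, c := Finset.sum_le_sum h
    _ = s.card * c := by simp

/-- Markov's inequality in exponential form. -/
theorem prob_le_of_expect_exp (p : PMF α) (X : α → ℝ) (b : ℝ) {A : α → Prop}
    (hA : ∀ a, A a → b ≤ X a) (h : expect p (fun a => ENNReal.ofReal (Real.exp (X a))) ≤ 1) :
    prob p A ≤ ENNReal.ofReal (Real.exp (-b)) := by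
  classical
  calc prob p A ≤ expect p (fun a => ENNReal.ofReal (Real.exp (-b)) *
        ENNReal.ofReal (Real.exp (X a))) := by
        refine expect_mono p fun a => ?_
        split_ifs with ha
        · rw [← ENNReal.ofReal_mul (Real.exp_pos _).le, ← Real.exp_add, ← ENNReal.ofReal_one]
          refine ENNReal.ofReal_le_ofReal ?_
          rw [← Real.exp_zero]
          exact Real.exp_le_exp.2 (by linarith [hA a ha])
        · exact zero_le
    _ ≤ ENNReal.ofReal (Real.exp (-b)) * 1 := by
        rw [expect_const_mul]
        exact mul_le_mul_right h _
    _ = _ := mul_one _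

end expect

theorem expect_coin (p : unitInterval) (f : Bool → ℝ≥0∞) :
    expect (coin p) f
      = ENNReal.ofReal p * f true + ENNReal.ofReal (1 - p) * f false := by
  have h1 : coin p true = ENNReal.ofReal p := by
    rw [ENNReal.ofReal, Real.toNNReal_of_nonneg p.2.1]
    rfl
  have h2 : coin p false = ENNReal.ofReal (1 - p) := by
    rw [ENNReal.ofReal_sub _ p.2.1, ENNReal.ofReal_one, ENNReal.ofReal,
      Real.toNNReal_of_nonneg p.2.1]
    rfl
  unfold expect
  rw [tsum_bool, add_comm, h1, h2]

theorem expect_coin_ofReal (p : unitInterval) (f : Bool → ℝ) (hf : ∀ x, 0 ≤ f x) :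
    expect (coin p) (fun x => ENNReal.ofReal (f x))
      = ENNReal.ofReal (p * f true + (1 - p) * f false) := by
  have h0 := p.2.1
  have h1 : 0 ≤ 1 - (p : ℝ) := sub_nonneg.2 p.2.2
  rw [expect_coin, ← ENNReal.ofReal_mul h0, ← ENNReal.ofReal_mul h1,
    ← ENNReal.ofReal_add (mul_nonneg h0 (hf _)) (mul_nonneg h1 (hf _))]

theorem expect_uniformOfFinset_ofReal {α : Type*} [Fintype α] [DecidableEq α]
    (s : Finset α) (hs : s.Nonempty)
    (f : α → ℝ) (hf : ∀ x, 0 ≤ f x) :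
    expect (PMF.uniformOfFinset s hs) (fun x => ENNReal.ofReal (f x))
      = ENNReal.ofReal ((∑ x ∈ s, f x) / s.card) := by
  have hc : (0 : ℝ) < s.card := by exact_mod_cast hs.card_pos
  unfold expect
  rw [tsum_fintype]
  simp only [PMF.uniformOfFinset_apply, ite_mul, zero_mul]
  rw [← Finset.sum_filter, Finset.filter_mem_eq_inter, Finset.univ_inter, ← Finset.mul_sum,
    ← ENNReal.ofReal_sum_of_nonneg fun x _ => hf x, div_eq_inv_mul,
    ENNReal.ofReal_mul (inv_nonneg.2 hc.le), ENNReal.ofReal_inv_of_pos hc,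
    ENNReal.ofReal_natCast]

/-! ### Replay schedules -/

theorem sampleList_cons (l s m : ℕ) (rest : List (ℕ × ℕ)) :
    sampleList l ((s, m) :: rest) = (sampleList l rest).bind fun B =>
      (coin (replayProb l s m)).bind fun x =>
        PMF.pure (Function.update B s (Function.update (B s) m x)) := rfl

/-- Independence of the entries of a replay schedule. -/
theorem expect_sampleList (l : ℕ) (Q : List (ℕ × ℕ)) (hQ : Q.Nodup)
    (φ : ℕ × ℕ → Bool → ℝ≥0∞) :
    expect (sampleList l Q) (fun B => (Q.map fun q => φ q (B q.1 q.2)).prod)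
      = (Q.map fun q => expect (coin (replayProb l q.1 q.2)) (φ q)).prod := by
  induction Q with
  | nil => simp [sampleList, expect_pure]
  | cons q Q ih =>
    obtain ⟨s, m⟩ := q
    obtain ⟨hq, hQ'⟩ := List.nodup_cons.1 hQ
    have key : ∀ (B : ℕ → ℕ → Bool) (x : Bool),
        (((s, m) :: Q).map fun q =>
          φ q (Function.update B s (Function.update (B s) m x) q.1 q.2)).prod
        = φ (s, m) x * (Q.map fun q => φ q (B q.1 q.2)).prod := by
      intro B x
      rw [List.map_cons, List.prod_cons]
      congr 2
      · simp
      · refine List.map_congr_left fun q hq' => ?_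
        have hne : q ≠ (s, m) := fun h => hq (h ▸ hq')
        congr 1
        by_cases h1 : q.1 = s
        · have h2 : q.2 ≠ m := fun h2 => hne (Prod.ext h1 h2)
          rw [h1]
          simp [h2]
        · simp [h1]
    rw [sampleList_cons]
    simp only [expect_bind, expect_pure, key]
    have h : ∀ B : ℕ → ℕ → Bool, expect (coin (replayProb l s m))
        (fun x => φ (s, m) x * (Q.map fun q => φ q (B q.1 q.2)).prod)
        = expect (coin (replayProb l s m)) (φ (s, m)) * (Q.map fun q => φ q (B q.1 q.2)).prod := by
      intro B
      rw [mul_comm (expect _ _), ← expect_const_mul]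
      simp only [mul_comm]
    simp only [h]
    rw [expect_const_mul, ih hQ', List.map_cons, List.prod_cons]

theorem mem_durations {T m : ℕ} : m ∈ durations T ↔ ∃ i < Nat.clog 2 T, 2 ^ (i + 1) = m := by
  simp [durations]

theorem nodup_durations (T : ℕ) : (durations T).Nodup :=
  List.nodup_range.map fun i j h => by
    have := Nat.pow_right_injective le_rfl h
    omega

/-- If `ψ q ≥ 0` dominates the logarithmic moment of `φ`, the exponential moment of the sum
over a schedule is at most one. -/
theorem expect_sampleSchedule_exp_le_one (T l : ℕ) (g : ℕ × ℕ → Bool → ℝ)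
    (hg : ∀ q, (replayProb l q.1 q.2 : ℝ) * Real.exp (g q true)
      + (1 - replayProb l q.1 q.2) * Real.exp (g q false) ≤ 1) (s : Finset (ℕ × ℕ))
    (hs : ∀ q ∈ s, q.1 ∈ Finset.Icc (l + 1) T ∧ q.2 ∈ durations T) :
    expect (sampleSchedule T l)
      (fun B => ENNReal.ofReal (Real.exp (∑ q ∈ s, g q (B q.1 q.2)))) ≤ 1 := by
  classical
  set Q := (List.range' (l + 1) (T - l)).product (durations T) with hQ
  have hnd : Q.Nodup := List.Nodup.product (List.nodup_range') (nodup_durations T)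
  have hsub : s ⊆ Q.toFinset := by
    intro q hq
    obtain ⟨h1, h2⟩ := hs q hq
    rw [Finset.mem_Icc] at h1
    rw [List.mem_toFinset, hQ]
    obtain ⟨a, b⟩ := q
    rw [List.pair_mem_product, List.mem_range']
    simp only at h1 h2
    exact ⟨⟨a - (l + 1), by omega, by omega⟩, h2⟩
  -- Entries outside `s` get the factor 1, so the product over the whole schedule is the exponential
  -- of the sum over `s`.
  set φ : ℕ × ℕ → Bool → ℝ≥0∞ := fun q x =>
    ENNReal.ofReal (if q ∈ s then Real.exp (g q x) else 1) with hφ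
  have h := expect_sampleList l Q hnd φ
  have hprod : ∀ B : ℕ → ℕ → Bool, (Q.map fun q => φ q (B q.1 q.2)).prod
      = ENNReal.ofReal (Real.exp (∑ q ∈ s, g q (B q.1 q.2))) := by
    intro B
    rw [← List.prod_toFinset _ hnd, Real.exp_sum, ← ENNReal.ofReal_prod_of_nonneg]
    · congr 1
      rw [Finset.prod_ite, Finset.prod_const_one, mul_one, Finset.filter_mem_eq_inter,
        Finset.inter_eq_right.2 hsub]
    · intro q _
      split_ifs <;> positivity
  simp only [hprod] at h
  change expect (sampleList l Q) _ ≤ 1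
  rw [h]
  have hone : ∀ L : List ℝ≥0∞, (∀ x ∈ L, x ≤ 1) → L.prod ≤ 1 := by
    intro L hL
    induction L with
    | nil => simp
    | cons x L ih =>
      rw [List.prod_cons]
      exact mul_le_one' (hL x (by simp)) (ih fun y hy => hL y (by simp [hy]))
  refine hone _ ?_
  intro x hx
  obtain ⟨q, _, rfl⟩ := List.mem_map.1 hx
  rw [hφ, expect_coin_ofReal]
  · rw [← ENNReal.ofReal_one]
    refine ENNReal.ofReal_le_ofReal ?_
    split_ifs
    · exact hg q
    · simp
  · intro x
    split_ifs <;> positivity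

/-! ### Tail bounds for replay schedules -/

/-- Chernoff bound with exponent 1: a coin x of mean p satisfies E exp(x - 2p) = (1 + p(e - 1))
exp(-2p) ≤ 1, because e - 1 ≤ 2. -/
theorem prob_count_le (T l m u : ℕ) (hm : m ∈ durations T) (hu : u ≤ T) (b : ℝ) :
    prob (sampleSchedule T l) (fun B =>
      b ≤ ∑ s ∈ Finset.Icc (l + 1) u, ((if B s m then 1 else 0) - 2 * (replayProb l s m : ℝ)))
      ≤ ENNReal.ofReal (Real.exp (-b)) := by
  set emb : ℕ ↪ ℕ × ℕ := ⟨fun s => (s, m), fun _ _ h => (Prod.mk.inj h).1⟩ with hemb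
  have h := expect_sampleSchedule_exp_le_one T l
    (fun q x => (if x then 1 else 0) - 2 * (replayProb l q.1 q.2 : ℝ)) ?_
    ((Finset.Icc (l + 1) u).map emb) ?_
  · refine prob_le_of_expect_exp _ _ b (fun B hB => ?_) h
    rw [Finset.sum_map]
    exact hB
  · intro q
    simp only [if_true, Bool.false_eq_true, if_false]
    generalize hp : (replayProb l q.1 q.2 : ℝ) = p
    have hp0 : 0 ≤ p := hp ▸ (replayProb l q.1 q.2).2.1
    rw [sub_eq_add_neg, Real.exp_add, zero_sub]
    have h2 : Real.exp 1 ≤ 3 := by linarith [Real.exp_one_lt_d9]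
    have h3 : 2 * p + 1 ≤ Real.exp (2 * p) := Real.add_one_le_exp _
    have h4 : p * (Real.exp 1 * Real.exp (-(2 * p))) + (1 - p) * Real.exp (-(2 * p))
        = (1 + p * (Real.exp 1 - 1)) * Real.exp (-(2 * p)) := by ring
    rw [h4, Real.exp_neg, ← div_eq_mul_inv, div_le_one (Real.exp_pos _)]
    nlinarith
  · intro q hq
    obtain ⟨s, hs, rfl⟩ := Finset.mem_map.1 hq
    rw [Finset.mem_Icc] at hs
    exact ⟨Finset.mem_Icc.2 ⟨hs.1, hs.2.trans hu⟩, hm⟩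

/-- Chernoff bound with exponent -1: E exp(p/2 - x) = (1 - p(1 - 1/e)) exp(p/2) ≤ 1, because 1/e ≤
1/2. If every coin misses, the sum of p/2 - x is half the expected number of hits. -/
theorem prob_miss_le (T l : ℕ) (S : Finset ℕ) (μ : ℕ → ℕ) (hS : S ⊆ Finset.Icc (l + 1) T)
    (hμ : ∀ s ∈ S, μ s ∈ durations T) (b : ℝ)
    (hb : 2 * b ≤ ∑ s ∈ S, (replayProb l s (μ s) : ℝ)) :
    prob (sampleSchedule T l) (fun B => ∀ s ∈ S, B s (μ s) = false)
      ≤ ENNReal.ofReal (Real.exp (-b)) := by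
  set emb : ℕ ↪ ℕ × ℕ := ⟨fun s => (s, μ s), fun _ _ h => (Prod.mk.inj h).1⟩ with hemb
  have h := expect_sampleSchedule_exp_le_one T l
    (fun q x => (replayProb l q.1 q.2 : ℝ) / 2 - (if x then 1 else 0)) ?_
    (S.map emb) ?_
  · refine prob_le_of_expect_exp _ _ b (fun B hB => ?_) h
    rw [Finset.sum_map]
    calc b ≤ ∑ s ∈ S, (replayProb l s (μ s) : ℝ) / 2 := by rw [← Finset.sum_div]; linarith
      _ ≤ _ := Finset.sum_le_sum fun s hs => by
          change _ ≤ (replayProb l s (μ s) : ℝ) / 2 - (if B s (μ s) then 1 else 0)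
          simp [hB s hs]
  · intro q
    simp only [if_true, Bool.false_eq_true, if_false]
    generalize hp : (replayProb l q.1 q.2 : ℝ) = p
    have hp0 : 0 ≤ p := hp ▸ (replayProb l q.1 q.2).2.1
    rw [sub_eq_add_neg, Real.exp_add, sub_zero]
    have h2 : Real.exp (-1) ≤ 1 / 2 := by
      rw [Real.exp_neg, inv_eq_one_div]
      exact one_div_le_one_div_of_le (by norm_num) (by linarith [Real.exp_one_gt_d9])
    have h3 : -(p / 2) + 1 ≤ Real.exp (-(p / 2)) := Real.add_one_le_exp _
    have h4 : p * (Real.exp (p / 2) * Real.exp (-1)) + (1 - p) * Real.exp (p / 2)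
        = (1 - p * (1 - Real.exp (-1))) * Real.exp (p / 2) := by ring
    calc _ = (1 - p * (1 - Real.exp (-1))) * Real.exp (p / 2) := h4
      _ ≤ Real.exp (-(p / 2)) * Real.exp (p / 2) :=
          mul_le_mul_of_nonneg_right (by nlinarith) (Real.exp_pos _).le
      _ = 1 := by rw [← Real.exp_add]; simp
  · intro q hq
    obtain ⟨s, hs, rfl⟩ := Finset.mem_map.1 hq
    exact ⟨hS hs, hμ s hs⟩

/-- The schedule of an episode that starts in round `l` has no more replays than expected, up to
constants and logarithms, and hits every set `opp l u a` of opportunities (replays of duration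
`dur a s` in round `s`) that has a large expected number of hits. -/
def GoodSchedule {K : ℕ} (T : ℕ) (opp : ℕ → ℕ → Fin K → Finset ℕ) (dur : Fin K → ℕ → ℕ) (l : ℕ)
    (B : ℕ → ℕ → Bool) : Prop :=
  (∀ m ∈ durations T, ∀ u ≤ T, ∑ s ∈ Finset.Icc (l + 1) u,
    ((if B s m then 1 else 0) - 2 * (replayProb l s m : ℝ)) ≤ 6 * Real.log T) ∧
  ∀ u ≤ T, ∀ a, (∀ s ∈ opp l u a, B s (dur a s) = false) →
    ∑ s ∈ opp l u a, (replayProb l s (dur a s) : ℝ) ≤ 12 * Real.log T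

/-- A union bound over pairs (m, u) for the counts and pairs (u, a) for the misses. It applies
because the sets `opp l u a` do not depend on the sampled schedule. -/
theorem prob_not_goodSchedule_le {K T : ℕ} (opp : ℕ → ℕ → Fin K → Finset ℕ)
    (dur : Fin K → ℕ → ℕ)
    (hopp : ∀ l, ∀ u ≤ T, ∀ a, opp l u a ⊆ Finset.Icc (l + 1) T)
    (hdur : ∀ l, ∀ u ≤ T, ∀ a, ∀ s ∈ opp l u a, dur a s ∈ durations T) (l : ℕ) :
    prob (sampleSchedule T l) (fun B => ¬ GoodSchedule T opp dur l B)
      ≤ ((T + 1) * Nat.clog 2 T + (T + 1) * K : ℕ) *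
        ENNReal.ofReal (Real.exp (-(6 * Real.log T))) := by
  set ε := ENNReal.ofReal (Real.exp (-(6 * Real.log T))) with hε
  have h1 : prob (sampleSchedule T l) (fun B =>
      ∃ q ∈ (durations T).toFinset ×ˢ Finset.range (T + 1),
      6 * Real.log T ≤ ∑ s ∈ Finset.Icc (l + 1) q.2,
        ((if B s q.1 then 1 else 0) - 2 * (replayProb l s q.1 : ℝ)))
      ≤ ((T + 1) * Nat.clog 2 T : ℕ) * ε := by
    refine (prob_exists_le _ _ _ ε fun q hq => ?_).trans ?_
    · rw [Finset.mem_product, List.mem_toFinset, Finset.mem_range] at hq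
      exact prob_count_le T l q.1 q.2 hq.1 (by omega) _
    · rw [Finset.card_product, List.toFinset_card_of_nodup (nodup_durations T)]
      simp [durations, mul_comm]
  have h2 : prob (sampleSchedule T l) (fun B =>
      ∃ q ∈ Finset.range (T + 1) ×ˢ (Finset.univ : Finset (Fin K)),
      (∀ s ∈ opp l q.1 q.2, B s (dur q.2 s) = false) ∧
        12 * Real.log T < ∑ s ∈ opp l q.1 q.2, (replayProb l s (dur q.2 s) : ℝ))
      ≤ ((T + 1) * K : ℕ) * ε := by
    refine (prob_exists_le _ _ _ ε fun q hq => ?_).trans ?_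
    · rw [Finset.mem_product, Finset.mem_range] at hq
      -- The expected number of hits is deterministic: when it is at most 12 log T the event is
      -- empty.
      by_cases hlt : 12 * Real.log T < ∑ s ∈ opp l q.1 q.2, (replayProb l s (dur q.2 s) : ℝ)
      · refine le_trans ?_ (prob_miss_le T l (opp l q.1 q.2) (dur q.2)
          (hopp l _ (by omega) _) (hdur l _ (by omega) _) (6 * Real.log T) (by linarith))
        exact prob_mono_of_support _ fun B _ hB => hB.1
      · simp [hlt, prob, expect]
    · simp
  calc prob (sampleSchedule T l) (fun B => ¬ GoodSchedule T opp dur l B)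
      ≤ _ := prob_mono_of_support _ fun B _ hB => by
          rw [GoodSchedule, not_and_or] at hB
          push Not at hB
          rcases hB with ⟨m, hm, u, hu, h⟩ | ⟨u, hu, a, h, h'⟩
          · exact Or.inl ⟨(m, u), by simp [hm, Nat.lt_succ_of_le hu], h.le⟩
          · exact Or.inr ⟨(u, a), by simp [Nat.lt_succ_of_le hu], h, h'⟩
    _ ≤ _ := prob_or_le _ _ _
    _ ≤ _ := add_le_add h1 h2
    _ = _ := by push_cast; ring

/-! ### Concentration of the gap estimates -/

variable {K : ℕ}

/-- Conditional expectation of `Round.gapEst` in round `t`, given the set of active arms. -/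
noncomputable def Round.gapMean (P : ℕ → PrefMatrix K) (t : ℕ) (r : Round K) (a b : Fin K) : ℝ :=
  if a ∈ r.active ∧ b ∈ r.active then (P t).gap a b else -1 / 2

/-- Law of the record of round `t` when the pair is drawn from `A`. -/
noncomputable def roundLaw (P : ℕ → PrefMatrix K) (t : ℕ) (A : Finset (Fin K)) (hA : A.Nonempty) :
    PMF (Round K) :=
  (PMF.uniformOfFinset A hA).bind fun a => (PMF.uniformOfFinset A hA).bind fun b =>
    (coin ((P t).p a b)).bind fun o => PMF.pure ⟨A, a, b, o⟩

/-- Separating the record of the round from the update of the state reduces concentration to the law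
of a single record. -/
theorem playRound_eq [NeZero K] (C : ℝ) (T : ℕ) (P : ℕ → PrefMatrix K) (t : ℕ) (S : State K) :
    playRound C T P t S =
      (roundLaw P t S.playSet S.playSet_nonempty).bind (advance C T t S) := by
  simp only [playRound, roundLaw, PMF.bind_bind, PMF.pure_bind]
  rfl

theorem newEpisode_eq (T l : ℕ) (H : ℕ → Round K) :
    newEpisode T l H = (sampleSchedule T l).bind fun B =>
      PMF.pure ⟨l, Finset.univ, B, [⟨l, T + 1 - l, Finset.univ⟩], H⟩ := rfl

theorem expect_advance_hist (C : ℝ) (T t : ℕ) (S : State K) (r : Round K)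
    (F : (ℕ → Round K) → ℝ≥0∞) :
    expect (advance C T t S r) (fun S' => F S'.hist) = F (Function.update S.hist t r) := by
  unfold advance
  simp only
  split_ifs
  · rw [newEpisode_eq, expect_bind]
    simp only [expect_pure, expect_const]
  · rw [expect_pure]

/-- With n active arms the estimate plus 1/2 is n² times a Bernoulli variable of mean q/n², so its
second moment is at most n² ≤ K². The assumption on `c` makes the exponent c n² at most 1 in
absolute value, where exp x ≤ 1 + x + x². For an inactive pair q = 0 and the estimate is exactly its
mean -1/2. -/
theorem expect_roundLaw_exp_le_one (P : ℕ → PrefMatrix K) (t : ℕ) (A : Finset (Fin K))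
    (hA : A.Nonempty) (a b : Fin K) (c : ℝ) (hc : |c| * (K : ℝ) ^ 2 ≤ 1) :
    expect (roundLaw P t A hA) (fun r => ENNReal.ofReal (Real.exp
      (c * (r.gapEst a b - r.gapMean P t a b) - c ^ 2 * (K : ℝ) ^ 2))) ≤ 1 := by
  set n : ℝ := (A.card : ℝ) with hn
  have hn0 : 0 < n := by rw [hn]; exact_mod_cast hA.card_pos
  have hnK : n ≤ K := by
    rw [hn]; exact_mod_cast (Finset.card_le_univ A).trans_eq (Fintype.card_fin K)
  set q : ℝ := if a ∈ A ∧ b ∈ A then ((P t).p a b : ℝ) else 0 with hq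
  have hq0 : 0 ≤ q := by rw [hq]; split_ifs; exacts [((P t).p a b).2.1, le_rfl]
  have hq1 : q ≤ 1 := by rw [hq]; split_ifs; exacts [((P t).p a b).2.2, zero_le_one]
  set d : ℝ := Real.exp (-(c * q) - c ^ 2 * (K : ℝ) ^ 2) with hd
  set z : ℝ := Real.exp (c * n ^ 2) - 1 with hz
  have hval : ∀ x y o, Real.exp (c * ((⟨A, x, y, o⟩ : Round K).gapEst a b
      - (⟨A, x, y, o⟩ : Round K).gapMean P t a b) - c ^ 2 * (K : ℝ) ^ 2)
      = d * (1 + if x = a ∧ y = b then (if o then z else 0) else 0) := by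
    intro x y o
    have h : (⟨A, x, y, o⟩ : Round K).gapEst a b - (⟨A, x, y, o⟩ : Round K).gapMean P t a b
        = (if x = a ∧ y = b then (if o then n ^ 2 else 0) else 0) - q := by
      simp only [Round.gapEst, Round.gapMean, PrefMatrix.gap, hq]
      split_ifs <;> ring
    rw [h, hd, hz]
    split_ifs
    · rw [add_sub_cancel, ← Real.exp_add]; congr 1; ring
    · rw [add_zero, mul_one]; congr 1; ring
    · rw [add_zero, mul_one]; congr 1; ring
  simp only [roundLaw, expect_bind, expect_pure, hval]
  have hpos : ∀ (x y : Fin K) (o : Bool),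
      0 ≤ d * (1 + if x = a ∧ y = b then (if o then z else 0) else 0) := fun x y o => by
    rw [← hval]; exact (Real.exp_pos _).le
  have hcoin : ∀ x y : Fin K, expect (coin ((P t).p x y)) (fun o => ENNReal.ofReal
      (d * (1 + if x = a ∧ y = b then (if o then z else 0) else 0)))
      = ENNReal.ofReal (d * (1 + if x = a ∧ y = b then ((P t).p a b : ℝ) * z else 0)) := by
    intro x y
    rw [expect_coin_ofReal _ _ (hpos x y)]
    congr 1
    by_cases h : x = a ∧ y = b
    · obtain ⟨rfl, rfl⟩ := h
      simp only [and_self, if_true, Bool.false_eq_true, if_false]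
      ring
    · simp only [h, if_false]
      ring
  have hpos2 : ∀ x y : Fin K, 0 ≤ d * (1 + if x = a ∧ y = b then ((P t).p a b : ℝ) * z else 0) := by
    intro x y
    refine mul_nonneg (Real.exp_pos _).le ?_
    have hp := ((P t).p a b).2
    have hz1 : -1 ≤ z := by rw [hz]; linarith [Real.exp_pos (c * n ^ 2)]
    split_ifs <;> nlinarith [hp.1, hp.2]
  simp only [hcoin]
  simp only [expect_uniformOfFinset_ofReal A hA _ (hpos2 _)]
  rw [expect_uniformOfFinset_ofReal A hA _
    (fun x => div_nonneg (Finset.sum_nonneg fun y _ => hpos2 x y) hn0.le)]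
  rw [← ENNReal.ofReal_one]
  refine ENNReal.ofReal_le_ofReal ?_
  have hsum : (∑ x ∈ A, (∑ y ∈ A,
      d * (1 + if x = a ∧ y = b then ((P t).p a b : ℝ) * z else 0)) / n) / n
      = d * (1 + z * q / n ^ 2) := by
    rw [← Finset.sum_div]
    simp only [← Finset.mul_sum, Finset.sum_add_distrib, Finset.sum_const, nsmul_eq_mul, mul_one,
      ← hn, ite_and]
    have : (∑ x ∈ A, ∑ y ∈ A, if x = a then if y = b then ((P t).p a b : ℝ) * z else 0 else 0)
        = z * q := by
      have h1 : ∀ x ∈ A, (∑ y ∈ A, if x = a then if y = b then ((P t).p a b : ℝ) * z else 0 else 0)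
          = if x = a then (if b ∈ A then ((P t).p a b : ℝ) * z else 0) else 0 := by
        intro x _
        split_ifs <;> simp_all
      rw [Finset.sum_congr rfl h1, Finset.sum_ite_eq', hq, ite_and]
      split_ifs <;> ring
    rw [this]
    field_simp
  rw [← hn, hsum]
  have habs : |c * n ^ 2| ≤ 1 := by
    rw [abs_mul, abs_of_nonneg (by positivity : (0:ℝ) ≤ n ^ 2)]
    exact (mul_le_mul_of_nonneg_left (by gcongr) (abs_nonneg c)).trans hc
  have hz2 : z ≤ c * n ^ 2 + (c * n ^ 2) ^ 2 := by
    have := (abs_le.1 (Real.abs_exp_sub_one_sub_id_le habs)).2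
    rw [hz]; linarith
  have hzq : z * q / n ^ 2 ≤ c * q + c ^ 2 * (K : ℝ) ^ 2 := by
    rw [div_le_iff₀ (by positivity)]
    calc z * q ≤ (c * n ^ 2 + (c * n ^ 2) ^ 2) * q := mul_le_mul_of_nonneg_right hz2 hq0
      _ = c * q * n ^ 2 + c ^ 2 * n ^ 2 * n ^ 2 * q := by ring
      _ ≤ c * q * n ^ 2 + c ^ 2 * K ^ 2 * n ^ 2 * 1 := by gcongr
      _ = _ := by ring
  calc d * (1 + z * q / n ^ 2) ≤ d * Real.exp (c * q + c ^ 2 * (K : ℝ) ^ 2) := by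
        refine mul_le_mul_of_nonneg_left ?_ (Real.exp_pos _).le
        linarith [Real.add_one_le_exp (c * q + c ^ 2 * (K : ℝ) ^ 2)]
    _ = 1 := by rw [hd, ← Real.exp_add]; simp

/-- An exponential supermartingale along the rounds in `s`. -/
theorem expect_anaconda_exp_le_one [NeZero K] (C : ℝ) (T : ℕ) (P : ℕ → PrefMatrix K)
    (D : ℕ → Round K → ℝ)
    (hD : ∀ t A hA, expect (roundLaw P t A hA) (fun r => ENNReal.ofReal (Real.exp (D t r))) ≤ 1)
    (s : Finset ℕ) (hs : ∀ t ∈ s, 1 ≤ t) (n : ℕ) :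
    expect (anaconda C T P n) (fun S => ENNReal.ofReal (Real.exp
      (∑ t ∈ s with t ≤ n, D t (S.hist t)))) ≤ 1 := by
  induction n with
  | zero =>
    have h0 : (s.filter fun t => t ≤ 0) = ∅ :=
      Finset.filter_eq_empty_iff.2 fun t ht h => by have := hs t ht; omega
    simp only [h0, Finset.sum_empty, Real.exp_zero, ENNReal.ofReal_one, expect_const, le_refl]
  | succ n ih =>
    have hstep : anaconda C T P (n + 1) = (anaconda C T P n).bind (playRound C T P (n + 1)) := rfl
    rw [hstep, expect_bind]
    refine (expect_mono _ fun S => ?_).trans ih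
    rw [playRound_eq, expect_bind]
    -- The update may draw a new schedule, but the history it produces is determined by the record.
    simp only [expect_advance_hist C T (n + 1) S _ fun H => ENNReal.ofReal (Real.exp
      (∑ t ∈ s with t ≤ n + 1, D t (H t)))]
    have hold : ∀ r, ∑ t ∈ s with t ≤ n, D t (Function.update S.hist (n + 1) r t)
        = ∑ t ∈ s with t ≤ n, D t (S.hist t) := fun r =>
      Finset.sum_congr rfl fun t ht => by
        rw [Finset.mem_filter] at ht
        rw [Function.update_of_ne (by omega)]
    by_cases hn : n + 1 ∈ s
    · have hf : (s.filter fun t => t ≤ n + 1) = insert (n + 1) (s.filter fun t => t ≤ n) := by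
        ext t
        simp only [Finset.mem_filter, Finset.mem_insert]
        constructor
        · rintro ⟨h1, h2⟩
          by_cases h : t = n + 1
          · exact Or.inl h
          · exact Or.inr ⟨h1, by omega⟩
        · rintro (rfl | ⟨h1, h2⟩)
          · exact ⟨hn, le_rfl⟩
          · exact ⟨h1, by omega⟩
      simp only [hf]
      rw [show (fun r => ENNReal.ofReal (Real.exp (∑ t ∈ insert (n + 1) (s.filter fun t => t ≤ n),
          D t (Function.update S.hist (n + 1) r t))))
        = fun r => ENNReal.ofReal (Real.exp (∑ t ∈ s with t ≤ n, D t (S.hist t))) *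
          ENNReal.ofReal (Real.exp (D (n + 1) r)) from ?_]
      · rw [expect_const_mul]
        exact mul_le_of_le_one_right' (hD _ _ _)
      · funext r
        rw [Finset.sum_insert (by simp), hold, Function.update_self, Real.exp_add,
          ENNReal.ofReal_mul (Real.exp_pos _).le, mul_comm]
    · have hf : (s.filter fun t => t ≤ n + 1) = s.filter fun t => t ≤ n := by
        refine Finset.filter_congr fun t ht => ?_
        have : t ≠ n + 1 := fun h => hn (h ▸ ht)
        omega
      simp only [hf, hold, expect_const, le_refl]

/-- All interval sums of gap estimates are close to the sums of the conditional expectations. -/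
def Concentrated (T : ℕ) (P : ℕ → PrefMatrix K) (H : ℕ → Round K) : Prop :=
  ∀ x y, 1 ≤ x → x ≤ y → y ≤ T → ∀ a b,
    |∑ t ∈ Finset.Icc x y, ((H t).gapEst a b - (H t).gapMean P t a b)|
      ≤ 9 * Real.log T * K * √(max ((y : ℝ) - x) ((K : ℝ) ^ 2))

/-- Holds because log 2 > 2/3; used throughout to absorb additive constants into multiples of log T.
-/
theorem two_le_three_mul_log {T : ℕ} (hT : 2 ≤ T) : 2 ≤ 3 * Real.log T := by
  have h1 : Real.log 2 ≤ Real.log T := Real.log_le_log (by norm_num) (by exact_mod_cast hT)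
  linarith [Real.log_two_gt_d9]

/-- The tilt c = σ/(K √M) has |c| K² = K/√M ≤ 1 and compensator c² K² = 1/M per round. An interval
has at most M + 1 ≤ 2M rounds, so the compensators sum to at most 2 ≤ 3 log T, and 9 log T - 3 log T
= 6 log T remains. -/
theorem prob_deviation_le [NeZero K] (C : ℝ) {T : ℕ} (hT : 2 ≤ T) (P : ℕ → PrefMatrix K)
    {x y : ℕ} (hx : 1 ≤ x) (hxy : x ≤ y) (hy : y ≤ T) (a b : Fin K) (σ : ℝ) (hσ : |σ| = 1) :
    prob (anaconda C T P T) (fun S =>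
      9 * Real.log T * K * √(max ((y : ℝ) - x) ((K : ℝ) ^ 2))
        < σ * ∑ t ∈ Finset.Icc x y, ((S.hist t).gapEst a b - (S.hist t).gapMean P t a b))
      ≤ ENNReal.ofReal (Real.exp (-(6 * Real.log T))) := by
  set M : ℝ := max ((y : ℝ) - x) ((K : ℝ) ^ 2) with hM
  have hK : (1 : ℝ) ≤ K := by exact_mod_cast NeZero.one_le
  have hMK : (K : ℝ) ^ 2 ≤ M := le_max_right _ _
  have hM1 : 1 ≤ M := le_trans (by nlinarith) hMK
  have hsK : (K : ℝ) ≤ √M := Real.le_sqrt_of_sq_le hMK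
  have hs0 : 0 < √M := by linarith
  set c : ℝ := σ / (K * √M) with hc
  have hσ2 : σ ^ 2 = 1 := by rw [← sq_abs, hσ, one_pow]
  have hcsq : c ^ 2 * (K : ℝ) ^ 2 = 1 / M := by
    rw [hc, div_pow, mul_pow, hσ2, Real.sq_sqrt (by linarith)]
    field_simp
  have hcabs : |c| * (K : ℝ) ^ 2 ≤ 1 := by
    rw [hc, abs_div, hσ, abs_of_pos (by positivity), div_mul_eq_mul_div, one_mul,
      div_le_one (by positivity)]
    nlinarith
  have h := expect_anaconda_exp_le_one C T P
    (fun t r => c * (r.gapEst a b - r.gapMean P t a b) - c ^ 2 * (K : ℝ) ^ 2)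
    (fun t A hA => expect_roundLaw_exp_le_one P t A hA a b c hcabs) (Finset.Icc x y)
    (fun t ht => hx.trans (Finset.mem_Icc.1 ht).1) T
  refine prob_le_of_expect_exp _ _ _ (fun S hS => ?_) h
  have hf : (Finset.Icc x y).filter (fun t => t ≤ T) = Finset.Icc x y :=
    Finset.filter_true_of_mem fun t ht => (Finset.mem_Icc.1 ht).2.trans hy
  rw [hf, Finset.sum_sub_distrib, ← Finset.mul_sum, Finset.sum_const, Nat.card_Icc, hcsq,
    nsmul_eq_mul]
  set Z := ∑ t ∈ Finset.Icc x y, ((S.hist t).gapEst a b - (S.hist t).gapMean P t a b)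
  have hcard : ((y + 1 - x : ℕ) : ℝ) * (1 / M) ≤ 2 := by
    rw [Nat.cast_sub (by omega), mul_one_div, div_le_iff₀ (by linarith)]
    push_cast
    have : (y : ℝ) - x ≤ M := le_max_left _ _
    linarith
  have hcZ : 9 * Real.log T ≤ c * Z := by
    rw [hc, div_mul_eq_mul_div, le_div_iff₀ (by positivity)]
    linarith
  have := two_le_three_mul_log hT
  linarith

theorem prob_not_concentrated_le [NeZero K] (C : ℝ) {T : ℕ} (hT : 2 ≤ T) (P : ℕ → PrefMatrix K) :
    prob (anaconda C T P T) (fun S => ¬ Concentrated T P S.hist)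
      ≤ (2 * T ^ 2 * K ^ 2 : ℕ) * ENNReal.ofReal (Real.exp (-(6 * Real.log T))) := by
  set ε := ENNReal.ofReal (Real.exp (-(6 * Real.log T))) with hε
  set I := (Finset.Icc 1 T ×ˢ Finset.Icc 1 T) ×ˢ
    ((Finset.univ : Finset (Fin K)) ×ˢ (Finset.univ : Finset (Fin K))) with hI
  -- One union bound for each sign of the deviation.
  have hone : ∀ σ : ℝ, |σ| = 1 → prob (anaconda C T P T) (fun S => ∃ q ∈ I,
      q.1.1 ≤ q.1.2 ∧ 9 * Real.log T * K * √(max ((q.1.2 : ℝ) - q.1.1) ((K : ℝ) ^ 2))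
        < σ * ∑ t ∈ Finset.Icc q.1.1 q.1.2,
          ((S.hist t).gapEst q.2.1 q.2.2 - (S.hist t).gapMean P t q.2.1 q.2.2))
      ≤ (T ^ 2 * K ^ 2 : ℕ) * ε := by
    intro σ hσ
    refine (prob_exists_le _ _ _ ε fun q hq => ?_).trans_eq ?_
    · simp only [hI, Finset.mem_product, Finset.mem_Icc, Finset.mem_univ, and_true] at hq
      by_cases hle : q.1.1 ≤ q.1.2
      · refine le_trans (prob_mono_of_support _ fun S _ hS => hS.2) (prob_deviation_le C hT P
          hq.1.1 hle hq.2.2 q.2.1 q.2.2 σ hσ)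
      · simp [hle, prob, expect]
    · simp [hI, sq]
  calc _ ≤ _ := prob_mono_of_support _ fun S _ hS => by
          unfold Concentrated at hS
          push Not at hS
          obtain ⟨x, y, hx, hxy, hy, a, b, h⟩ := hS
          have hmem : ((x, y), (a, b)) ∈ I := by
            simp [hI]; omega
          rcases lt_abs.1 h with h | h
          · exact Or.inl ⟨((x, y), (a, b)), hmem, hxy, by rw [one_mul]; exact h⟩
          · exact Or.inr ⟨((x, y), (a, b)), hmem, hxy, by rw [neg_one_mul]; exact h⟩
    _ ≤ _ := prob_or_le _ _ _
    _ ≤ _ := add_le_add (hone 1 (by simp)) (hone (-1) (by simp))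
    _ = _ := by push_cast; ring

/-! ### Elimination sets -/

theorem elimSet_mono (C : ℝ) (T : ℕ) (H : ℕ → Round K) {l l' u u' : ℕ} (hl : l' ≤ l)
    (hu : u ≤ u') : elimSet C T H l u ⊆ elimSet C T H l' u' := by
  classical
  intro a ha
  simp only [elimSet, Finset.mem_filter, Finset.mem_univ, true_and] at ha ⊢
  obtain ⟨s₁, s₂, h1, h2, h3, h⟩ := ha
  exact ⟨s₁, s₂, hl.trans h1, h2, h3.trans_le hu, h⟩

theorem elimSet_congr (C : ℝ) (T : ℕ) {H H' : ℕ → Round K} {l u : ℕ}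
    (h : ∀ t, l ≤ t → t < u → H t = H' t) : elimSet C T H l u = elimSet C T H' l u := by
  classical
  unfold elimSet
  refine Finset.filter_congr fun a _ => ?_
  refine exists_congr fun s₁ => exists_congr fun s₂ => and_congr_right fun h1 =>
    and_congr_right fun h2 => and_congr_right fun h3 => exists_congr fun a' => ?_
  rw [Finset.sum_congr rfl fun t ht => ?_]
  rw [Finset.mem_Icc] at ht
  rw [h t (h1.trans ht.1) (ht.2.trans_lt h3)]

theorem elimSet_eq_empty (C : ℝ) (T : ℕ) (H : ℕ → Round K) {l u : ℕ} (h : u ≤ l + 1) :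
    elimSet C T H l u = ∅ := by
  classical
  refine Finset.filter_eq_empty_iff.2 fun a _ => ?_
  rintro ⟨s₁, s₂, h1, h2, h3, -⟩
  omega

theorem elimSet_update (C : ℝ) (T : ℕ) (H : ℕ → Round K) (r : Round K) {l u t : ℕ} (h : u ≤ t) :
    elimSet C T (Function.update H t r) l u = elimSet C T H l u :=
  elimSet_congr C T fun t' _ h2 => Function.update_of_ne (by omega) _ _

/-! ### The stack of calls -/

theorem resume_of_empty (C : ℝ) (T : ℕ) (H : ℕ → Round K) (t : ℕ) {good : Finset (Fin K)}
    (hg : ¬ good.Nonempty) (calls : List (Call K)) : resume C T H t good calls = [] := by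
  induction calls with
  | nil => rfl
  | cons c rest ih => simp [resume, hg, ih]

theorem resume_spec (C : ℝ) (T : ℕ) (H : ℕ → Round K) (t : ℕ) {good : Finset (Fin K)}
    (hg : good.Nonempty) (calls : List (Call K)) :
    (resume C T H t good calls = [] ∧ ∀ c ∈ calls, c.start + c.dur < t) ∨
    ∃ pre c rest, calls = pre ++ c :: rest ∧ (∀ x ∈ pre, x.start + x.dur < t) ∧
      t ≤ c.start + c.dur ∧ resume C T H t good calls =
        { c with active := c.active \ elimSet C T H c.start t } :: rest := by
  induction calls with
  | nil => exact Or.inl ⟨rfl, by simp⟩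
  | cons c rest ih =>
    by_cases hc : t ≤ c.start + c.dur
    · exact Or.inr ⟨[], c, rest, rfl, by simp, hc, by simp [resume, hc, hg]⟩
    · have hres : resume C T H t good (c :: rest) = resume C T H t good rest := by
        simp [resume, hc]
      rw [hres]
      rcases ih with ⟨h1, h2⟩ | ⟨pre, c', rest', h1, h2, h3, h4⟩
      · refine Or.inl ⟨h1, fun x hx => ?_⟩
        rcases List.mem_cons.1 hx with rfl | hx
        · omega
        · exact h2 x hx
      · refine Or.inr ⟨c :: pre, c', rest', by rw [h1, List.cons_append], fun x hx => ?_, h3, h4⟩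
        rcases List.mem_cons.1 hx with rfl | hx
        · omega
        · exact h2 x hx

theorem mem_scheduled {T : ℕ} {B : ℕ → ℕ → Bool} {s m : ℕ} :
    m ∈ scheduled T B s ↔ m ∈ durations T ∧ B s m = true := by
  simp [scheduled]

theorem pushChild_spec (T : ℕ) (B : ℕ → ℕ → Bool) (s : ℕ) (calls : List (Call K)) :
    (pushChild T B s calls = calls ∧ ∀ m ∈ durations T, B s m = false) ∨
    ∃ m ∈ durations T, B s m = true ∧ (∀ m' ∈ durations T, B s m' = true → m' ≤ m) ∧
      pushChild T B s calls = ⟨s, m, Finset.univ⟩ :: calls := by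
  unfold pushChild
  rcases h : (scheduled T B s).max? with _ | m
  · left
    refine ⟨rfl, fun m hm => ?_⟩
    rw [List.max?_eq_none_iff] at h
    by_contra hB
    have : m ∈ scheduled T B s := mem_scheduled.2 ⟨hm, by simpa using hB⟩
    simp [h] at this
  · right
    rw [List.max?_eq_some_iff] at h
    obtain ⟨h1, h2⟩ := mem_scheduled.1 h.1
    exact ⟨m, h1, h2, fun m' hm' hB => h.2 m' (mem_scheduled.2 ⟨hm', hB⟩), rfl⟩

/-- Invariants of the state of the algorithm just before round `t`. -/
structure StateInv (C : ℝ) (T t : ℕ) (S : State K) : Prop where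
  one_le : 1 ≤ S.epStart
  le : S.epStart ≤ t
  -- The good arms lag one round behind the active sets: the update after a round does not yet use
  -- that round's record.
  good : S.good = Finset.univ \ elimSet C T S.hist S.epStart (t - 1)
  good_nonempty : S.good.Nonempty
  start_mem : ∀ c ∈ S.calls, S.epStart ≤ c.start ∧ c.start ≤ t
  scheduled : ∀ c ∈ S.calls, c.start = S.epStart ∨
    (c.dur ∈ durations T ∧ S.sched c.start c.dur = true)
  -- An interrupted call keeps an outdated, hence larger, set; only the call on top is up to date.
  active : ∀ c ∈ S.calls, Finset.univ \ elimSet C T S.hist c.start t ⊆ c.active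
  top : ∃ c rest, S.calls = c :: rest ∧ t ≤ c.start + c.dur ∧
    c.active = Finset.univ \ elimSet C T S.hist c.start t
  sorted : S.calls.Pairwise fun c c' => c'.start ≤ c.start
  root : ∃ c ∈ S.calls, T + 1 ≤ c.start + c.dur
  -- Only the largest scheduled duration is started, so the open call may be longer than `m`, but it
  -- still covers round `t`.
  complete : ∀ s m, S.epStart < s → s ≤ t → m ∈ durations T → S.sched s m = true → t ≤ s + m →
    ∃ c ∈ S.calls, c.start = s ∧ m ≤ c.dur

theorem stateInv_newEpisode [NeZero K] {C : ℝ} {T l : ℕ} (hl : 1 ≤ l) (hlT : l ≤ T + 1)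
    (B : ℕ → ℕ → Bool) (H : ℕ → Round K) :
    StateInv C T l ⟨l, Finset.univ, B, [⟨l, T + 1 - l, Finset.univ⟩], H⟩ where
  one_le := hl
  le := le_rfl
  good := by rw [elimSet_eq_empty _ _ _ (by simp only; omega), Finset.sdiff_empty]
  good_nonempty := Finset.univ_nonempty
  start_mem := by simp
  scheduled := by simp
  active := by simp
  top := ⟨_, _, rfl, by simp only; omega, by
    rw [elimSet_eq_empty _ _ _ (by simp only; omega), Finset.sdiff_empty]⟩
  sorted := by simp
  root := ⟨_, List.mem_singleton.2 rfl, by simp only; omega⟩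
  complete := fun s m h1 h2 => by simp only at h1; omega

theorem mem_support_newEpisode {T l : ℕ} {H : ℕ → Round K} {S : State K}
    (h : S ∈ (newEpisode T l H).support) :
    ∃ B, S = ⟨l, Finset.univ, B, [⟨l, T + 1 - l, Finset.univ⟩], H⟩ := by
  rw [newEpisode_eq, PMF.mem_support_bind_iff] at h
  obtain ⟨B, -, hB⟩ := h
  exact ⟨B, by simpa using hB⟩

/-- Expired calls are popped and the rest of the stack keeps its order. The root call outlasts the
horizon, so the stack can only become empty when no good arm is left; this is why an episode ends
within the horizon only after all arms have been eliminated. -/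
theorem StateInv.advance [NeZero K] {C : ℝ} {T t : ℕ} {S S' : State K} (h : StateInv C T t S)
    (htT : t ≤ T) (r : Round K)
    (hS' : S' ∈ (DuelingBandit.advance C T t S r).support) :
    StateInv C T (t + 1) S' ∧ S'.hist = Function.update S.hist t r ∧
    ((S'.epStart = S.epStart ∧ S'.sched = S.sched) ∨
      (S'.epStart = t + 1 ∧ elimSet C T S.hist S.epStart t = Finset.univ)) := by
  unfold DuelingBandit.advance at hS'
  set H := Function.update S.hist t r with hH
  have hE : elimSet C T H S.epStart t = elimSet C T S.hist S.epStart t :=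
    elimSet_update C T S.hist r le_rfl
  have hgood : S.good \ elimSet C T H S.epStart t
      = Finset.univ \ elimSet C T S.hist S.epStart t := by
    rw [hE, h.good, sdiff_sdiff_left, Finset.sup_eq_union]
    congr 1
    exact Finset.union_eq_right.2 (elimSet_mono C T _ le_rfl (Nat.sub_le _ _))
  simp only [hgood] at hS'
  set good := Finset.univ \ elimSet C T S.hist S.epStart t with hgd
  set pushed := pushChild T S.sched (t + 1) S.calls with hpushed
  have hroot : ∃ c ∈ pushed, T + 1 ≤ c.start + c.dur := by
    obtain ⟨c, hc, hc'⟩ := h.root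
    rcases pushChild_spec T S.sched (t + 1) S.calls with ⟨h1, -⟩ | ⟨m, -, -, -, h1⟩
    · exact ⟨c, by rw [hpushed, h1]; exact hc, hc'⟩
    · exact ⟨c, by rw [hpushed, h1]; exact List.mem_cons_of_mem _ hc, hc'⟩
  split_ifs at hS' with hcalls
  · obtain ⟨B, rfl⟩ := mem_support_newEpisode hS'
    refine ⟨stateInv_newEpisode (by omega) (by omega) B H, rfl, Or.inr ⟨rfl, ?_⟩⟩
    -- With a good arm left, the unexpired root call would keep the stack nonempty.
    by_contra hne
    have hg : good.Nonempty := by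
      rw [hgd, Finset.sdiff_nonempty]
      exact fun hsub => hne (Finset.univ_subset_iff.1 hsub)
    obtain ⟨c, hc, hc'⟩ := hroot
    rcases resume_spec C T H (t + 1) hg pushed with ⟨-, h2⟩ | ⟨pre, c', rest, -, -, -, h4⟩
    · have := h2 c hc
      omega
    · rw [hcalls] at h4
      simp at h4
  · rw [PMF.mem_support_pure_iff] at hS'
    subst hS'
    refine ⟨?_, rfl, Or.inl ⟨rfl, rfl⟩⟩
    have hg : good.Nonempty := by
      by_contra hg
      exact hcalls (resume_of_empty C T H (t + 1) hg pushed)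
    rcases resume_spec C T H (t + 1) hg pushed with ⟨h1, -⟩ | ⟨pre, c, rest, h1, h2, h3, h4⟩
    · exact absurd h1 hcalls
    have hElt : ∀ s, Finset.univ \ elimSet C T H s (t + 1)
        ⊆ Finset.univ \ elimSet C T S.hist s t := fun s => by
      rw [← elimSet_update C T S.hist r (le_refl t)]
      exact Finset.sdiff_subset_sdiff subset_rfl (elimSet_mono C T _ le_rfl (Nat.le_succ t))
    -- properties of the calls after the push
    have hp : (∀ c ∈ pushed, S.epStart ≤ c.start ∧ c.start ≤ t + 1) ∧
        (∀ c ∈ pushed, c.start = S.epStart ∨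
          (c.dur ∈ durations T ∧ S.sched c.start c.dur = true)) ∧
        (∀ c ∈ pushed, Finset.univ \ elimSet C T H c.start (t + 1) ⊆ c.active) ∧
        (pushed.Pairwise fun c c' => c'.start ≤ c.start) ∧
        (∀ s m, S.epStart < s → s ≤ t + 1 → m ∈ durations T → S.sched s m = true →
          t + 1 ≤ s + m → ∃ c ∈ pushed, c.start = s ∧ m ≤ c.dur) := by
      have hle := h.le
      rcases pushChild_spec T S.sched (t + 1) S.calls with ⟨e, hno⟩ | ⟨m₀, hm₀, hB, hmax, e⟩
      · rw [hpushed, e]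
        refine ⟨fun c hc => ?_, h.scheduled, fun c hc => (hElt _).trans (h.active c hc),
          h.sorted, ?_⟩
        · have := h.start_mem c hc; omega
        · intro s m h5 h6 h7 h8 h9
          rcases Nat.lt_or_ge t s with h10 | h10
          · obtain rfl : s = t + 1 := by omega
            rw [hno m h7] at h8
            exact absurd h8 (by simp)
          · exact h.complete s m h5 h10 h7 h8 (by omega)
      · rw [hpushed, e]
        refine ⟨fun c hc => ?_, fun c hc => ?_, fun c hc => ?_, ?_, ?_⟩
        · rcases List.mem_cons.1 hc with rfl | hc
          · simp only; omega
          · have := h.start_mem c hc; omega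
        · rcases List.mem_cons.1 hc with rfl | hc
          · exact Or.inr ⟨hm₀, hB⟩
          · exact h.scheduled c hc
        · rcases List.mem_cons.1 hc with rfl | hc
          · exact Finset.subset_univ _
          · exact (hElt _).trans (h.active c hc)
        · refine List.pairwise_cons.2 ⟨fun c hc => ?_, h.sorted⟩
          have := h.start_mem c hc
          simp only; omega
        · intro s m h5 h6 h7 h8 h9
          rcases Nat.lt_or_ge t s with h10 | h10
          · obtain rfl : s = t + 1 := by omega
            exact ⟨_, List.mem_cons_self, rfl, hmax m h7 h8⟩
          · obtain ⟨c, hc, hc'⟩ := h.complete s m h5 h10 h7 h8 (by omega)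
            exact ⟨c, List.mem_cons_of_mem _ hc, hc'⟩
    obtain ⟨p1, p2, p3, p4, p5⟩ := hp
    set c' : Call K := { c with active := c.active \ elimSet C T H c.start (t + 1) } with hc'
    have hcmem : c ∈ pushed := by rw [h1]; simp
    -- The saved set contains every arm not eliminated since the call began, so one removal of the
    -- current elimination set brings it up to date.
    have hact : c'.active = Finset.univ \ elimSet C T H c.start (t + 1) := by
      refine le_antisymm (Finset.sdiff_subset_sdiff (Finset.subset_univ _) subset_rfl) ?_
      intro a ha
      exact Finset.mem_sdiff.2 ⟨p3 c hcmem ha, (Finset.mem_sdiff.1 ha).2⟩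
    -- transfer along the popped stack
    have htr : ∀ x ∈ c' :: rest, ∃ y ∈ pushed, y.start = x.start ∧ y.dur = x.dur := by
      intro x hx
      rcases List.mem_cons.1 hx with rfl | hx
      · exact ⟨c, hcmem, rfl, rfl⟩
      · exact ⟨x, by rw [h1]; simp [hx], rfl, rfl⟩
    have hkeep : ∀ y ∈ pushed, t + 1 ≤ y.start + y.dur →
        ∃ x ∈ c' :: rest, x.start = y.start ∧ x.dur = y.dur := by
      intro y hy hy'
      rw [h1] at hy
      rcases List.mem_append.1 hy with hy | hy
      · have := h2 y hy; omega
      · rcases List.mem_cons.1 hy with rfl | hy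
        · exact ⟨c', List.mem_cons_self, rfl, rfl⟩
        · exact ⟨y, List.mem_cons_of_mem _ hy, rfl, rfl⟩
    refine ⟨h.one_le, by have := h.le; simp only; omega, ?_, hg, ?_, ?_, ?_, ?_, ?_, ?_, ?_⟩
    · simp only [Nat.add_sub_cancel]
      rw [hE]
    · simp only [h4]
      intro x hx
      obtain ⟨y, hy, e1, e2⟩ := htr x hx
      rw [← e1]
      exact p1 y hy
    · simp only [h4]
      intro x hx
      obtain ⟨y, hy, e1, e2⟩ := htr x hx
      rw [← e1, ← e2]
      exact p2 y hy
    · simp only [h4]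
      intro x hx
      rcases List.mem_cons.1 hx with rfl | hx
      · rw [hact]
      · exact p3 x (by rw [h1]; simp [hx])
    · exact ⟨c', rest, h4, h3, hact⟩
    · simp only [h4]
      have h5 : (c :: rest).Pairwise fun c c' => c'.start ≤ c.start := by
        rw [h1] at p4
        exact (List.pairwise_append.1 p4).2.1
      exact List.pairwise_cons.2 (List.pairwise_cons.1 h5)
    · simp only [h4]
      obtain ⟨y, hy, hy'⟩ := hroot
      obtain ⟨x, hx, e1, e2⟩ := hkeep y hy (by omega)
      exact ⟨x, hx, by omega⟩
    · simp only [h4]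
      intro s m h5 h6 h7 h8 h9
      obtain ⟨y, hy, e1, e2⟩ := p5 s m h5 h6 h7 h8 h9
      obtain ⟨x, hx, e3, e4⟩ := hkeep y hy (by omega)
      exact ⟨x, hx, by omega, by omega⟩

/-! ### Trajectories -/

/-- Law of the sequence of the states after rounds `0, …, n` (constant from then on). -/
noncomputable def trajectory [NeZero K] (C : ℝ) (T : ℕ) (P : ℕ → PrefMatrix K) :
    ℕ → PMF (ℕ → State K)
  | 0 => (newEpisode T 1 fun _ => default).bind fun S => PMF.pure fun _ => S
  | n + 1 => (trajectory C T P n).bind fun ω =>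
      (playRound C T P (n + 1) (ω n)).bind fun S => PMF.pure (Function.update ω (n + 1) S)

/-- Lets events about all intermediate schedules be combined with events about the final history,
although `anaconda` records only the last state. -/
theorem expect_trajectory [NeZero K] (C : ℝ) (T : ℕ) (P : ℕ → PrefMatrix K) (n : ℕ)
    (f : State K → ℝ≥0∞) :
    expect (trajectory C T P n) (fun ω => f (ω n)) = expect (anaconda C T P n) f := by
  induction n generalizing f with
  | zero => simp only [trajectory, anaconda, expect_bind, expect_pure]
  | succ n ih =>
    have h : anaconda C T P (n + 1) = (anaconda C T P n).bind (playRound C T P (n + 1)) := rfl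
    rw [h, expect_bind, ← ih]
    simp only [trajectory, expect_bind, expect_pure, Function.update_self]

/-- What the history `H` of a run has to satisfy: `ep t` is the start of the episode of round `t`,
`st t` the scheduled time of the call that plays round `t`, and `sch t` the replay schedule. -/
structure IsRun (C : ℝ) (T : ℕ) (H : ℕ → Round K) (ep st : ℕ → ℕ) (sch : ℕ → ℕ → ℕ → Bool) :
    Prop where
  ep_one : ep 1 = 1
  fst_mem : ∀ t ∈ Finset.Icc 1 T, (H t).fst ∈ (H t).active
  snd_mem : ∀ t ∈ Finset.Icc 1 T, (H t).snd ∈ (H t).active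
  active : ∀ t ∈ Finset.Icc 1 T, (H t).active =
    if Finset.univ \ elimSet C T H (st t) t = ∅ then Finset.univ
    else Finset.univ \ elimSet C T H (st t) t
  one_le_ep : ∀ t ∈ Finset.Icc 1 T, 1 ≤ ep t
  ep_le_st : ∀ t ∈ Finset.Icc 1 T, ep t ≤ st t
  st_le : ∀ t ∈ Finset.Icc 1 T, st t ≤ t
  st_eq_or : ∀ t ∈ Finset.Icc 1 T, st t = ep t ∨
    ∃ m ∈ durations T, sch t (st t) m = true ∧ t ≤ st t + m
  le_st : ∀ t ∈ Finset.Icc 1 T, ∀ s m, ep t < s → s ≤ t → m ∈ durations T →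
    sch t s m = true → t ≤ s + m → s ≤ st t
  exists_good : ∀ t ∈ Finset.Icc 1 T, ∃ a, a ∉ elimSet C T H (ep t) (t - 1)
  step : ∀ t ∈ Finset.Icc 1 T, t + 1 ≤ T → (ep (t + 1) = ep t ∧ sch (t + 1) = sch t) ∨
    (ep (t + 1) = t + 1 ∧ elimSet C T H (ep t) t = Finset.univ)

/-- The states before rounds `1, …, n + 1` satisfy the invariants and are linked by rounds. -/
theorem trajectory_support [NeZero K] {C : ℝ} {T : ℕ} {P : ℕ → PrefMatrix K} {n : ℕ}
    (hn : n ≤ T) {ω : ℕ → State K} (hω : ω ∈ (trajectory C T P n).support) :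
    (ω 0).epStart = 1 ∧ (∀ i ≤ n, StateInv C T (i + 1) (ω i)) ∧
    ∀ i < n, ∃ r : Round K, r.active = (ω i).playSet ∧ r.fst ∈ r.active ∧ r.snd ∈ r.active ∧
      (ω (i + 1)).hist = Function.update (ω i).hist (i + 1) r ∧
      (((ω (i + 1)).epStart = (ω i).epStart ∧ (ω (i + 1)).sched = (ω i).sched) ∨
      ((ω (i + 1)).epStart = i + 2 ∧
        elimSet C T (ω i).hist (ω i).epStart (i + 1) = Finset.univ)) := by
  induction n generalizing ω with
  | zero =>
    rw [trajectory, PMF.mem_support_bind_iff] at hω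
    obtain ⟨S, hS, hω⟩ := hω
    rw [PMF.mem_support_pure_iff] at hω
    subst hω
    obtain ⟨B, rfl⟩ := mem_support_newEpisode hS
    refine ⟨rfl, fun i hi => ?_, fun i hi => absurd hi (by omega)⟩
    obtain rfl : i = 0 := by omega
    exact stateInv_newEpisode le_rfl (by omega) B _
  | succ n ih =>
    rw [trajectory, PMF.mem_support_bind_iff] at hω
    obtain ⟨ω', hω', hω⟩ := hω
    rw [PMF.mem_support_bind_iff] at hω
    obtain ⟨S, hS, hω⟩ := hω
    rw [PMF.mem_support_pure_iff] at hω
    subst hω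
    obtain ⟨h0, h1, h2⟩ := ih (by omega) hω'
    rw [playRound_eq, PMF.mem_support_bind_iff] at hS
    obtain ⟨r, hr, hS⟩ := hS
    have hr' : r.active = (ω' n).playSet ∧ r.fst ∈ r.active ∧ r.snd ∈ r.active := by
      simp only [roundLaw, PMF.mem_support_bind_iff, PMF.mem_support_uniformOfFinset_iff,
        PMF.mem_support_pure_iff] at hr
      obtain ⟨a, ha, b, hb, o, -, rfl⟩ := hr
      exact ⟨rfl, ha, hb⟩
    obtain ⟨i1, i2, i3⟩ := (h1 n le_rfl).advance (by omega) r hS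
    have hlt : ∀ i ≤ n, Function.update ω' (n + 1) S i = ω' i := fun i hi =>
      Function.update_of_ne (by omega) _ _
    refine ⟨by rw [hlt 0 (by omega)]; exact h0, fun i hi => ?_, fun i hi => ?_⟩
    · rcases Nat.lt_or_ge n i with h | h
      · obtain rfl : i = n + 1 := by omega
        rw [Function.update_self]
        exact i1
      · rw [hlt i h]; exact h1 i h
    · rcases Nat.lt_or_ge i n with h | h
      · rw [hlt i h.le, hlt (i + 1) h]
        exact h2 i h
      · obtain rfl : i = n := by omega
        rw [hlt i le_rfl, Function.update_self]
        exact ⟨r, hr'.1, hr'.2.1, hr'.2.2, i2, i3⟩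

/-- Histories only grow, so elimination sets computed during the run equal those computed from the
final history. The function `st` records the start of the call on top of the stack. -/
theorem isRun_of_mem_support [NeZero K] {C : ℝ} {T : ℕ} {P : ℕ → PrefMatrix K}
    {ω : ℕ → State K} (hω : ω ∈ (trajectory C T P T).support) :
    ∃ st, IsRun C T (ω T).hist (fun t => (ω (t - 1)).epStart) st fun t => (ω (t - 1)).sched := by
  obtain ⟨h0, hinv, hstep⟩ := trajectory_support le_rfl hω
  have hhist : ∀ j ≤ T, ∀ i ≤ j, ∀ t, t ≤ i → (ω j).hist t = (ω i).hist t := by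
    intro j hj
    induction j with
    | zero =>
      intro i hi t _
      obtain rfl : i = 0 := by omega
      rfl
    | succ j ih =>
      intro i hi t ht
      rcases Nat.lt_or_ge j i with h | h
      · obtain rfl : i = j + 1 := by omega
        rfl
      · obtain ⟨r, -, -, -, hr, -⟩ := hstep j (by omega)
        rw [hr, Function.update_of_ne (by omega)]
        exact ih (by omega) i h t ht
  have hE : ∀ i ≤ T, ∀ l u, u ≤ i + 1 →
      elimSet C T (ω i).hist l u = elimSet C T (ω T).hist l u := fun i hi l u hu =>
    elimSet_congr C T fun t _ h2 => (hhist T le_rfl i hi t (by omega)).symm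
  have htop : ∀ t, ∃ s, t ∈ Finset.Icc 1 T → ∃ c rest, (ω (t - 1)).calls = c :: rest ∧
      t ≤ c.start + c.dur ∧ c.active = Finset.univ \ elimSet C T (ω (t - 1)).hist c.start t ∧
      c.start = s := by
    intro t
    by_cases ht : t ∈ Finset.Icc 1 T
    · rw [Finset.mem_Icc] at ht
      have h := (hinv (t - 1) (by omega)).top
      rw [Nat.sub_add_cancel ht.1] at h
      obtain ⟨c, rest, e1, e2, e3⟩ := h
      exact ⟨c.start, fun _ => ⟨c, rest, e1, e2, e3, rfl⟩⟩
    · exact ⟨0, fun h => absurd h ht⟩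
  choose st hst using htop
  have hinv' : ∀ t ∈ Finset.Icc 1 T, StateInv C T t (ω (t - 1)) := by
    intro t ht
    rw [Finset.mem_Icc] at ht
    have h := hinv (t - 1) (by omega)
    rwa [Nat.sub_add_cancel ht.1] at h
  have hround : ∀ t ∈ Finset.Icc 1 T, ((ω T).hist t).active = (ω (t - 1)).playSet ∧
      ((ω T).hist t).fst ∈ ((ω T).hist t).active ∧
      ((ω T).hist t).snd ∈ ((ω T).hist t).active := by
    intro t ht
    rw [Finset.mem_Icc] at ht
    obtain ⟨r, h1, h2, h3, h4, -⟩ := hstep (t - 1) (by omega)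
    rw [Nat.sub_add_cancel ht.1] at h4
    have : (ω T).hist t = r := by
      rw [hhist T le_rfl t ht.2 t le_rfl, h4, Function.update_self]
    rw [this]
    exact ⟨h1, h2, h3⟩
  refine ⟨st, h0, fun t ht => (hround t ht).2.1, fun t ht => (hround t ht).2.2, fun t ht => ?_,
    fun t ht => (hinv' t ht).one_le, fun t ht => ?_, fun t ht => ?_, fun t ht => ?_,
    fun t ht => ?_, fun t ht => ?_, fun t ht htT => ?_⟩
  · obtain ⟨c, rest, e1, e2, e3, e4⟩ := hst t ht
    rw [Finset.mem_Icc] at ht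
    rw [(hround t (Finset.mem_Icc.2 ht)).1, State.playSet, e1]
    simp only
    rw [hE (t - 1) (by omega) _ _ (by omega), e4] at e3
    rw [e3]
  · obtain ⟨c, rest, e1, e2, e3, e4⟩ := hst t ht
    rw [← e4]
    exact ((hinv' t ht).start_mem c (by rw [e1]; simp)).1
  · obtain ⟨c, rest, e1, e2, e3, e4⟩ := hst t ht
    rw [← e4]
    exact ((hinv' t ht).start_mem c (by rw [e1]; simp)).2
  · obtain ⟨c, rest, e1, e2, e3, e4⟩ := hst t ht
    rw [← e4]
    rcases (hinv' t ht).scheduled c (by rw [e1]; simp) with h | h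
    · exact Or.inl h
    · exact Or.inr ⟨c.dur, h.1, h.2, e2⟩
  · intro s m h1 h2 h3 h4 h5
    obtain ⟨c, rest, e1, e2, e3, e4⟩ := hst t ht
    obtain ⟨c', hc', e5, -⟩ := (hinv' t ht).complete s m h1 h2 h3 h4 h5
    -- The running call is on top of a stack sorted by starting time, so no open call started later.
    have hs := (hinv' t ht).sorted
    rw [e1] at hs hc'
    rw [← e4, ← e5]
    rcases List.mem_cons.1 hc' with rfl | hc'
    · exact le_rfl
    · exact (List.pairwise_cons.1 hs).1 c' hc'
  · have h := (hinv' t ht).good_nonempty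
    rw [(hinv' t ht).good] at h
    rw [Finset.mem_Icc] at ht
    rw [hE (t - 1) (by omega) _ _ (by omega)] at h
    obtain ⟨a, ha⟩ := h
    exact ⟨a, (Finset.mem_sdiff.1 ha).2⟩
  · rw [Finset.mem_Icc] at ht
    obtain ⟨r, -, -, -, -, h⟩ := hstep (t - 1) (by omega)
    simp only [Nat.add_sub_cancel]
    rw [Nat.sub_add_cancel ht.1] at h
    rcases h with h | ⟨h, h'⟩
    · exact Or.inl h
    · rw [hE (t - 1) (by omega) _ _ (by omega)] at h'
      exact Or.inr ⟨by omega, h'⟩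

/-! ### Consequences of SST and STI -/

namespace PrefMatrix

variable {M N : PrefMatrix K} {w x : Fin K}

theorem gap_swap (M : PrefMatrix K) (a b : Fin K) : M.gap a b = -M.gap b a := by
  have := M.symm_half a b
  simp only [gap]; linarith

theorem pref_iff (a b : Fin K) : M.Pref a b ↔ 0 ≤ M.gap a b := by
  simp [Pref, gap]

theorem pref_total (M : PrefMatrix K) (a b : Fin K) : M.Pref a b ∨ M.Pref b a := by
  rw [pref_iff, pref_iff, M.gap_swap b a]
  rcases le_total 0 (M.gap a b) with h | h
  · exact Or.inl h
  · exact Or.inr (by linarith)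

theorem gap_self (M : PrefMatrix K) (a : Fin K) : M.gap a a = 0 := by
  have := M.gap_swap a a; linarith

theorem gap_le_half (M : PrefMatrix K) (a b : Fin K) : M.gap a b ≤ 1 / 2 := by
  have := (M.p a b).2.2
  simp only [gap]; linarith

theorem IsCondorcetWinner.pref (hw : M.IsCondorcetWinner w) (a : Fin K) : M.Pref w a := by
  by_cases h : a = w
  · rw [h, pref_iff, gap_self]
  · exact (hw a h).le

theorem IsCondorcetWinner.gap_nonneg (hw : M.IsCondorcetWinner w) (a : Fin K) :
    0 ≤ M.gap w a := pref_iff w a |>.1 (hw.pref a)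

/-- If a is preferred to b, this is SST along w, a, b; otherwise the left side is negative. -/
theorem SST.gap_le (h : M.SST) (hw : M.IsCondorcetWinner w) (a b : Fin K) :
    M.gap a b ≤ M.gap w b := by
  by_cases hab : M.Pref a b
  · exact (le_max_right _ _).trans (h w a b (hw.pref a) hab)
  · rw [pref_iff] at hab
    linarith [hw.gap_nonneg b]

/-- If a is preferred to b, STI along w, a, b suffices and costs one regret of a. Otherwise SST
gives r(b) ≤ r(a) and δ(b, a) ≤ r(a), which costs two. -/
theorem STI.le_gap (h : M.STI) (hs : M.SST) (hw : M.IsCondorcetWinner w) (a b : Fin K) :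
    M.gap w b - 2 * M.gap w a ≤ M.gap a b := by
  have h0 := hw.gap_nonneg a
  rcases M.pref_total a b with hab | hba
  · linarith [h w a b (hw.pref a) hab]
  · have h1 := (le_max_left _ _).trans (hs w b a (hw.pref b) hba)
    have h2 := hs.gap_le hw b a
    rw [M.gap_swap a b]
    linarith

/-- The regrets `gap w ·` change by at most twice the change of the winner's preferences. -/
theorem abs_gap_sub_le (hM : M.IsCondorcetWinner w) (hN : N.IsCondorcetWinner x)
    (sN : N.SST) (tN : N.STI) {v : ℝ}
    (hv : ∀ a, |(M.p w a : ℝ) - (N.p w a : ℝ)| ≤ v) (a : Fin K) :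
    |M.gap w a - N.gap x a| ≤ 2 * v := by
  have hv' : ∀ a, M.gap w a - N.gap w a ≤ v ∧ N.gap w a - M.gap w a ≤ v := fun a => by
    have := abs_le.1 (hv a)
    simp only [gap]
    constructor <;> linarith [this.1, this.2]
  have hv0 : 0 ≤ v := (abs_nonneg _).trans (hv a)
  -- The new winner w beats x in M, and its row moved by at most v, so in N it loses to the old
  -- winner x by at most v.
  have h1 : N.gap x w ≤ v := by
    rw [N.gap_swap]
    linarith [hM.gap_nonneg x, (hv' x).1]
  have h2 := sN.gap_le hN w a
  have h3 : N.gap x a ≤ v + v + M.gap w a := by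
    rcases N.pref_total w a with h | h
    · linarith [tN x w a (hN.pref w) h, (hv' a).2]
    · have := (le_max_left _ _).trans (sN x a w (hN.pref a) h)
      linarith [hM.gap_nonneg a]
  rw [abs_le]
  constructor <;> linarith [(hv' a).1]

end PrefMatrix

/-! ### Environments described by regrets -/

/-- The regrets `r t a` of the arms control the gaps of the preference sequence in the rounds
`1, …, T`, some arm has regret zero, and the regrets change by at most `v t` in round `t`. -/
structure IsEnv (T : ℕ) (P : ℕ → PrefMatrix K) (r : ℕ → Fin K → ℝ) (v : ℕ → ℝ) : Prop where
  nonneg : ∀ t ∈ Finset.Icc 1 T, ∀ a, 0 ≤ r t a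
  le_half : ∀ t ∈ Finset.Icc 1 T, ∀ a, r t a ≤ 1 / 2
  exists_zero : ∀ t ∈ Finset.Icc 1 T, ∃ a, r t a = 0
  gap_le : ∀ t ∈ Finset.Icc 1 T, ∀ a b, (P t).gap a b ≤ r t b
  le_gap : ∀ t ∈ Finset.Icc 1 T, ∀ a b, r t b - 2 * r t a ≤ (P t).gap a b
  var_nonneg : ∀ t, 0 ≤ v t
  abs_sub_le : ∀ t, 1 ≤ t → t + 1 ≤ T → ∀ a, |r (t + 1) a - r t a| ≤ v (t + 1)

/-- Twice the summands of the Condorcet Winner Variation. -/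
noncomputable def regretVariation [NeZero K] (P : ℕ → PrefMatrix K) (w : ℕ → Fin K) (t : ℕ) : ℝ :=
  if 2 ≤ t then 2 * Finset.univ.sup' Finset.univ_nonempty
    (fun a : Fin K => |((P t).p (w t) a : ℝ) - ((P (t - 1)).p (w t) a : ℝ)|) else 0

theorem isEnv_gap [NeZero K] {T : ℕ} {P : ℕ → PrefMatrix K} {w : ℕ → Fin K}
    (hw : ∀ t ∈ Finset.Icc 1 T, (P t).IsCondorcetWinner (w t))
    (hs : ∀ t ∈ Finset.Icc 1 T, (P t).SST) (ht : ∀ t ∈ Finset.Icc 1 T, (P t).STI) :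
    IsEnv T P (fun t a => (P t).gap (w t) a) (regretVariation P w) where
  nonneg t h a := (hw t h).gap_nonneg a
  le_half t _ a := (P t).gap_le_half _ _
  exists_zero t _ := ⟨w t, (P t).gap_self _⟩
  gap_le t h a b := (hs t h).gap_le (hw t h) a b
  le_gap t h a b := (ht t h).le_gap (hs t h) (hw t h) a b
  var_nonneg t := by
    unfold regretVariation
    split_ifs
    · exact mul_nonneg zero_le_two ((abs_nonneg _).trans
        (Finset.le_sup' (fun a : Fin K => |((P t).p (w t) a : ℝ) - ((P (t - 1)).p (w t) a : ℝ)|)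
          (Finset.mem_univ 0)))
    · exact le_rfl
  abs_sub_le t h1 h2 a := by
    have m1 : t ∈ Finset.Icc 1 T := Finset.mem_Icc.2 ⟨h1, by omega⟩
    have m2 : t + 1 ∈ Finset.Icc 1 T := Finset.mem_Icc.2 ⟨by omega, h2⟩
    rw [regretVariation, if_pos (by omega), Nat.add_sub_cancel]
    exact PrefMatrix.abs_gap_sub_le (hw _ m2) (hw _ m1) (hs _ m1) (ht _ m1)
      (fun a => Finset.le_sup'
        (fun a : Fin K => |((P (t + 1)).p (w (t + 1)) a : ℝ) - ((P t).p (w (t + 1)) a : ℝ)|)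
        (Finset.mem_univ a)) a

theorem sum_regretVariation [NeZero K] (T : ℕ) (P : ℕ → PrefMatrix K) (w : ℕ → Fin K) :
    ∑ t ∈ Finset.Icc 1 T, regretVariation P w t = 2 * cwVariation T P w := by
  rw [cwVariation, Finset.mul_sum]
  symm
  refine Finset.sum_subset_zero_on_sdiff (fun t ht => ?_) (fun t ht => ?_) (fun t ht => ?_)
  · rw [Finset.mem_Icc] at ht ⊢; omega
  · rw [Finset.mem_sdiff, Finset.mem_Icc, Finset.mem_Icc] at ht
    rw [regretVariation, if_neg (by omega)]
  · rw [Finset.mem_Icc] at ht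
    rw [regretVariation, if_pos ht.1]

/-! ### Sums of inverse square roots -/

/-- `1 / √(t - a + 1)`. -/
noncomputable def invSqrtGap (a t : ℕ) : ℝ := 1 / √((t : ℝ) - a + 1)

theorem invSqrtGap_nonneg (a t : ℕ) : 0 ≤ invSqrtGap a t := by
  unfold invSqrtGap; positivity

theorem sum_invSqrtGap_le (a n : ℕ) :
    ∑ t ∈ Finset.Ico a (a + n), invSqrtGap a t ≤ 2 * √n := by
  induction n with
  | zero => simp
  | succ n ih =>
    rw [← add_assoc, Finset.sum_Ico_succ_top (by omega)]
    have h0 : invSqrtGap a (a + n) = 1 / √((n + 1 : ℕ) : ℝ) := by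
      unfold invSqrtGap; congr 2; push_cast; ring
    rw [h0]
    set x := √(n : ℝ) with hx
    set y := √((n + 1 : ℕ) : ℝ) with hy
    have hx2 : x ^ 2 = n := Real.sq_sqrt (by positivity)
    have hy2 : y ^ 2 = n + 1 := by rw [hy, Real.sq_sqrt (by positivity)]; push_cast; ring
    have hy0 : 0 < y := Real.sqrt_pos.2 (by positivity)
    have hx0 : 0 ≤ x := Real.sqrt_nonneg _
    have hxy : 1 / y ≤ 2 * y - 2 * x := by
      rw [div_le_iff₀ hy0]
      nlinarith [sq_nonneg (y - x)]
    linarith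

theorem sum_invSqrtGap_le_of_subset {s : Finset ℕ} {a b : ℕ} (hab : a ≤ b)
    (hs : s ⊆ Finset.Ico a b) : ∑ t ∈ s, invSqrtGap a t ≤ 2 * √((b : ℝ) - a) := by
  obtain ⟨n, rfl⟩ := Nat.exists_eq_add_of_le hab
  refine (Finset.sum_le_sum_of_subset_of_nonneg hs fun t _ _ => invSqrtGap_nonneg a t).trans
    ((sum_invSqrtGap_le a n).trans_eq ?_)
  congr 2; push_cast; ring

/-! ### Blocks of rounds -/

/-- First round of the block of length `len` that contains round `t`. -/
def blockStart (len t : ℕ) : ℕ := len * ((t - 1) / len) + 1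

/-- Sum of `v` over the block of `t`. -/
noncomputable def blockVar (T len : ℕ) (v : ℕ → ℝ) (t : ℕ) : ℝ :=
  ∑ τ ∈ Finset.Icc 1 T with (τ - 1) / len = (t - 1) / len, v τ

theorem block_eq_iff {len t k : ℕ} (hlen : 0 < len) (ht : 1 ≤ t) :
    (t - 1) / len = k ↔ len * k + 1 ≤ t ∧ t ≤ len * k + len := by
  rw [Nat.div_eq_iff hlen, mul_comm k len]
  omega

theorem blockStart_le {len t : ℕ} (ht : 1 ≤ t) : blockStart len t ≤ t := by
  have := Nat.mul_div_le (t - 1) len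
  unfold blockStart; omega

theorem one_le_blockStart (len t : ℕ) : 1 ≤ blockStart len t := by
  unfold blockStart; omega

theorem blockStart_block {len : ℕ} (hlen : 0 < len) (t : ℕ) :
    (blockStart len t - 1) / len = (t - 1) / len := by
  rw [blockStart, Nat.add_sub_cancel, Nat.mul_div_cancel_left _ hlen]

/-- Each v τ is counted once for every round of its own block, at most `len` times. -/
theorem sum_blockVar_le {T len : ℕ} (hlen : 0 < len) {v : ℕ → ℝ} (hv : ∀ t, 0 ≤ v t) :
    ∑ t ∈ Finset.Icc 1 T, blockVar T len v t ≤ len * ∑ t ∈ Finset.Icc 1 T, v t := by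
  simp only [blockVar, Finset.sum_filter]
  rw [Finset.sum_comm, Finset.mul_sum]
  refine Finset.sum_le_sum fun τ hτ => ?_
  rw [← Finset.sum_filter, Finset.sum_const, nsmul_eq_mul]
  refine mul_le_mul_of_nonneg_right ?_ (hv τ)
  have hsub : (Finset.Icc 1 T).filter (fun t => (τ - 1) / len = (t - 1) / len)
      ⊆ Finset.Icc (len * ((τ - 1) / len) + 1) (len * ((τ - 1) / len) + len) := by
    intro t ht
    rw [Finset.mem_filter, Finset.mem_Icc] at ht
    rw [Finset.mem_Icc]
    exact (block_eq_iff hlen ht.1.1).1 ht.2.symm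
  have := Finset.card_le_card hsub
  rw [Nat.card_Icc] at this
  exact_mod_cast this.trans_eq (by omega)

/-- Each block contributes at most 2 √len, and since len ≤ T there are at most 2T/len blocks,
including an incomplete last one. -/
theorem sum_invSqrtGap_blockStart_le {T len : ℕ} (hlen : 0 < len) (hT : len ≤ T) :
    ∑ t ∈ Finset.Icc 1 T, invSqrtGap (blockStart len t) t ≤ 4 * (T / √len) := by
  have hmap : ∀ t ∈ Finset.Icc 1 T, (t - 1) / len ∈ Finset.range ((T - 1) / len + 1) := by
    intro t ht
    rw [Finset.mem_Icc] at ht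
    rw [Finset.mem_range]
    exact Nat.lt_succ_of_le (Nat.div_le_div_right (by omega))
  rw [← Finset.sum_fiberwise_of_maps_to hmap]
  have hfib : ∀ k ∈ Finset.range ((T - 1) / len + 1),
      ∑ t ∈ Finset.Icc 1 T with (t - 1) / len = k, invSqrtGap (blockStart len t) t
        ≤ 2 * √(len : ℝ) := by
    intro k _
    rw [Finset.sum_congr rfl fun t ht => by
      rw [show blockStart len t = len * k + 1 by
        rw [blockStart, (Finset.mem_filter.1 ht).2]]]
    refine (sum_invSqrtGap_le_of_subset (b := len * k + 1 + len) (by omega) fun t ht => ?_).trans ?_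
    · rw [Finset.mem_filter, Finset.mem_Icc] at ht
      have := (block_eq_iff hlen ht.1.1).1 ht.2
      rw [Finset.mem_Ico]; omega
    · apply le_of_eq; congr 2; push_cast; ring
  refine (Finset.sum_le_sum hfib).trans ?_
  rw [Finset.sum_const, Finset.card_range, nsmul_eq_mul]
  have hlen' : (0 : ℝ) < len := by exact_mod_cast hlen
  have hs : 0 < √(len : ℝ) := Real.sqrt_pos.2 hlen'
  have hss : √(len : ℝ) * √(len : ℝ) = len := Real.mul_self_sqrt hlen'.le
  have hcount : (((T - 1) / len + 1 : ℕ) : ℝ) * len ≤ 2 * T := by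
    have h1 : ((T - 1) / len + 1) * len ≤ 2 * T := by
      have := Nat.div_mul_le_self (T - 1) len
      rw [add_mul]; omega
    exact_mod_cast h1
  rw [← mul_div_assoc, le_div_iff₀ hs]
  nlinarith

section Env

variable {T : ℕ} {P : ℕ → PrefMatrix K} {r : ℕ → Fin K → ℝ} {v : ℕ → ℝ}

theorem IsEnv.abs_sub_le_sum (h : IsEnv T P r v) {x y : ℕ} (hx : 1 ≤ x) (hxy : x ≤ y)
    (hy : y ≤ T) (a : Fin K) : |r y a - r x a| ≤ ∑ t ∈ Finset.Ioc x y, v t := by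
  induction y, hxy using Nat.le_induction with
  | base => simp
  | succ y hxy ih =>
    rw [← Finset.insert_Ioc_right_eq_Ioc_add_one hxy, Finset.sum_insert (by simp)]
    have h1 := h.abs_sub_le y (by omega) hy a
    have h2 := ih (by omega)
    have h3 := _root_.abs_sub_le (r (y + 1) a) (r y a) (r x a)
    linarith

theorem blockVar_nonneg (hv : ∀ t, 0 ≤ v t) (len t : ℕ) : 0 ≤ blockVar T len v t :=
  Finset.sum_nonneg fun τ _ => hv τ

theorem IsEnv.le_add_blockVar (h : IsEnv T P r v) {len : ℕ} (hlen : 0 < len) {s t : ℕ}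
    (hs : s ∈ Finset.Icc 1 T) (ht : t ∈ Finset.Icc 1 T) (hst : (s - 1) / len = (t - 1) / len)
    (a : Fin K) : r s a ≤ r t a + blockVar T len v t := by
  rw [Finset.mem_Icc] at hs ht
  have hsub : ∀ x y, (x = s ∧ y = t ∨ x = t ∧ y = s) → Finset.Ioc x y ⊆
      (Finset.Icc 1 T).filter fun τ => (τ - 1) / len = (t - 1) / len := by
    intro x y hxy τ hτ
    rw [Finset.mem_Ioc] at hτ
    rw [Finset.mem_filter, Finset.mem_Icc]
    have b1 := (block_eq_iff hlen hs.1).1 hst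
    have b2 := (block_eq_iff hlen ht.1).1 rfl
    refine ⟨by omega, (block_eq_iff hlen (by omega)).2 (by omega)⟩
  have hle : ∀ x y, (x = s ∧ y = t ∨ x = t ∧ y = s) →
      ∑ τ ∈ Finset.Ioc x y, v τ ≤ blockVar T len v t := fun x y hxy =>
    Finset.sum_le_sum_of_subset_of_nonneg (hsub x y hxy) fun τ _ _ => h.var_nonneg τ
  rcases le_total s t with hle' | hle'
  · have h1 := (abs_le.1 (h.abs_sub_le_sum hs.1 hle' ht.2 a)).1
    linarith [hle s t (Or.inl ⟨rfl, rfl⟩)]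
  · have h1 := (abs_le.1 (h.abs_sub_le_sum ht.1 hle' hs.2 a)).2
    linarith [hle t s (Or.inr ⟨rfl, rfl⟩)]

theorem blockVar_congr {len s t : ℕ} (hst : (s - 1) / len = (t - 1) / len) :
    blockVar T len v s = blockVar T len v t := by
  simp only [blockVar, hst]

end Env

/-! ### Elimination and regret -/

section Elimination

variable {T : ℕ} {P : ℕ → PrefMatrix K} {H : ℕ → Round K} {r : ℕ → Fin K → ℝ} {v : ℕ → ℝ}

/-- The threshold constant 18 minus the deviation 9 leaves 9. No arm needs to be active: the mean
-1/2 for an inactive pair is also below the regret. -/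
theorem exists_sum_regret_of_mem_elimSet (henv : IsEnv T P r v) (hc : Concentrated T P H)
    {x u : ℕ} (hx : 1 ≤ x) (hu : u ≤ T + 1) {a : Fin K} (ha : a ∈ elimSet 18 T H x u) :
    ∃ s₁ s₂ : ℕ, x ≤ s₁ ∧ s₁ < s₂ ∧ s₂ < u ∧
      9 * Real.log T * K * √(max ((s₂ : ℝ) - s₁) ((K : ℝ) ^ 2))
        < ∑ t ∈ Finset.Icc s₁ s₂, r t a := by
  classical
  simp only [elimSet, Finset.mem_filter, Finset.mem_univ, true_and] at ha
  obtain ⟨s₁, s₂, h1, h2, h3, a', h4⟩ := ha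
  refine ⟨s₁, s₂, h1, h2, h3, ?_⟩
  have h5 := (abs_le.1 (hc s₁ s₂ (by omega) h2.le (by omega) a' a)).2
  rw [Finset.sum_sub_distrib] at h5
  have h6 : ∑ t ∈ Finset.Icc s₁ s₂, (H t).gapMean P t a' a ≤ ∑ t ∈ Finset.Icc s₁ s₂, r t a := by
    refine Finset.sum_le_sum fun t ht => ?_
    rw [Finset.mem_Icc] at ht
    have ht' : t ∈ Finset.Icc 1 T := Finset.mem_Icc.2 (by omega)
    unfold Round.gapMean
    split_ifs
    · exact henv.gap_le t ht' a' a
    · linarith [henv.nonneg t ht' a]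
  linarith

/-- The constant is 27 = 18 + 9. Activity is needed here, because only for an active pair does the
estimate have the true gap as its mean. -/
theorem sum_regret_le_of_notMem_elimSet (henv : IsEnv T P r v) (hc : Concentrated T P H)
    {x u s₁ s₂ : ℕ} (hx : 1 ≤ x) (hu : u ≤ T + 1) {a a' : Fin K} (ha : a ∉ elimSet 18 T H x u)
    (h1 : x ≤ s₁) (h2 : s₁ < s₂) (h3 : s₂ < u)
    (hact : ∀ t ∈ Finset.Icc s₁ s₂, a ∈ (H t).active)
    (hact' : ∀ t ∈ Finset.Icc s₁ s₂, a' ∈ (H t).active) :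
    ∑ t ∈ Finset.Icc s₁ s₂, (r t a - 2 * r t a')
      ≤ 27 * Real.log T * K * √(max ((s₂ : ℝ) - s₁) ((K : ℝ) ^ 2)) := by
  classical
  simp only [elimSet, Finset.mem_filter, Finset.mem_univ, true_and] at ha
  push Not at ha
  have h4 := ha s₁ s₂ h1 h2 h3 a'
  have h5 := (abs_le.1 (hc s₁ s₂ (by omega) h2.le (by omega) a' a)).1
  rw [Finset.sum_sub_distrib] at h5
  have h6 : ∑ t ∈ Finset.Icc s₁ s₂, (r t a - 2 * r t a')
      ≤ ∑ t ∈ Finset.Icc s₁ s₂, (H t).gapMean P t a' a := by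
    refine Finset.sum_le_sum fun t ht => ?_
    rw [Round.gapMean, if_pos ⟨hact' t ht, hact t ht⟩]
    rw [Finset.mem_Icc] at ht
    exact henv.le_gap t (Finset.mem_Icc.2 (by omega)) a' a
  linarith

/-- The interval causing elimination has n + 1 ≤ 2n rounds of regret at most W, against a threshold
of at least 9 K log T √n; divide by √n. This protects arms of small regret. -/
theorem lt_of_mem_elimSet (henv : IsEnv T P r v) (hc : Concentrated T P H)
    {x u : ℕ} (hx : 1 ≤ x) (hu : u ≤ T + 1) {a : Fin K} (ha : a ∈ elimSet 18 T H x u) {W : ℝ}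
    (hW0 : 0 ≤ W) (hW : ∀ t, x ≤ t → t < u → r t a ≤ W) :
    9 * Real.log T * K < 2 * W * √((u : ℝ) - x) := by
  obtain ⟨s₁, s₂, h1, h2, h3, h4⟩ := exists_sum_regret_of_mem_elimSet henv hc hx hu ha
  have hlog : 0 ≤ Real.log T := Real.log_natCast_nonneg T
  set n : ℝ := (s₂ : ℝ) - s₁ with hn
  have hn1 : 1 ≤ n := by
    have : (s₁ : ℝ) + 1 ≤ s₂ := by exact_mod_cast h2
    linarith
  have h5 : ∑ t ∈ Finset.Icc s₁ s₂, r t a ≤ (n + 1) * W := by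
    calc _ ≤ ∑ t ∈ Finset.Icc s₁ s₂, W := Finset.sum_le_sum fun t ht => by
          rw [Finset.mem_Icc] at ht
          exact hW t (by omega) (by omega)
      _ = (n + 1) * W := by
          rw [Finset.sum_const, Nat.card_Icc, nsmul_eq_mul, Nat.cast_sub (by omega)]
          push_cast; rw [hn]; ring
  have hs : 0 < √n := Real.sqrt_pos.2 (by linarith)
  have hss : √n * √n = n := Real.mul_self_sqrt (by linarith)
  have h6 : 9 * Real.log T * K * √n < 2 * W * √n * √n := by
    calc 9 * Real.log T * K * √n
        ≤ 9 * Real.log T * K * √(max n ((K : ℝ) ^ 2)) := by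
          gcongr; exact le_max_left _ _
      _ < (n + 1) * W := h4.trans_le h5
      _ ≤ 2 * n * W := by gcongr; linarith
      _ = 2 * W * √n * √n := by rw [mul_assoc (2 * W), hss]; ring
  have h7 : 9 * Real.log T * K < 2 * W * √n := lt_of_mul_lt_mul_right h6 hs.le
  refine h7.trans_le (mul_le_mul_of_nonneg_left (Real.sqrt_le_sqrt ?_) (by positivity))
  have e1 : (s₂ : ℝ) ≤ u := by exact_mod_cast h3.le
  have e2 : (x : ℝ) ≤ s₁ := by exact_mod_cast h1
  linarith

end Elimination

/-! ### Active arms along a run -/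

section Run

variable {C : ℝ} {T : ℕ} {H : ℕ → Round K} {ep st : ℕ → ℕ} {sch : ℕ → ℕ → ℕ → Bool}

theorem IsRun.ep_eq (hrun : IsRun C T H ep st sch) {t : ℕ} (ht : 1 ≤ t) (htT : t ≤ T) :
    ∀ τ, ep t ≤ τ → τ ≤ t → ep τ = ep t ∧ sch τ = sch t := by
  induction t, ht using Nat.le_induction with
  | base =>
    intro τ h1 h2
    rw [hrun.ep_one] at h1
    obtain rfl : τ = 1 := by omega
    exact ⟨rfl, rfl⟩
  | succ t ht ih =>
    intro τ h1 h2
    rcases Nat.lt_or_ge t τ with h3 | h3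
    · obtain rfl : τ = t + 1 := by omega
      exact ⟨rfl, rfl⟩
    · rcases hrun.step t (Finset.mem_Icc.2 ⟨ht, by omega⟩) htT with ⟨e1, e2⟩ | ⟨e1, -⟩
      · rw [e1, e2]
        exact ih (by omega) τ (by omega) h3
      · omega

/-- The fallback to all arms when everything has been eliminated only enlarges the set that is
played. -/
theorem IsRun.mem_active (hrun : IsRun C T H ep st sch) {t : ℕ} (ht : t ∈ Finset.Icc 1 T)
    {a : Fin K} (ha : a ∉ elimSet C T H (st t) t) : a ∈ (H t).active := by
  have hmem : a ∈ Finset.univ \ elimSet C T H (st t) t := by simp [ha]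
  rw [hrun.active t ht]
  split_ifs with h
  · exact Finset.mem_univ _
  · exact hmem

theorem IsRun.notMem_of_mem_active (hrun : IsRun C T H ep st sch) {t : ℕ}
    (ht : t ∈ Finset.Icc 1 T) (hne : elimSet C T H (st t) t ≠ Finset.univ)
    {a : Fin K} (ha : a ∈ (H t).active) : a ∉ elimSet C T H (st t) t := by
  rw [hrun.active t ht, if_neg] at ha
  · exact (Finset.mem_sdiff.1 ha).2
  · rw [Finset.sdiff_eq_empty_iff_subset]
    exact fun h => hne (Finset.univ_subset_iff.1 h)

/-- Calls are nested: between its start and round t the call of round t stays open, so the rounds in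
between are played by it or by calls started later. Their elimination sets are smaller, so an arm
not eliminated by this call at t was active in all these rounds. -/
theorem IsRun.st_le_st (hrun : IsRun C T H ep st sch) {t : ℕ} (ht : t ∈ Finset.Icc 1 T)
    {τ : ℕ} (h1 : st t ≤ τ) (h2 : τ ≤ t) : st t ≤ st τ := by
  have ht' := Finset.mem_Icc.1 ht
  have hle := hrun.ep_le_st t ht
  have hone := hrun.one_le_ep t ht
  have hτ : τ ∈ Finset.Icc 1 T := Finset.mem_Icc.2 (by omega)
  obtain ⟨e1, e2⟩ := hrun.ep_eq ht'.1 ht'.2 τ (by omega) h2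
  have hleτ := hrun.ep_le_st τ hτ
  rcases Nat.lt_or_ge (ep t) (st t) with h | h
  · rcases hrun.st_eq_or t ht with h3 | ⟨m, hm, hB, hle'⟩
    · omega
    · exact hrun.le_st τ hτ (st t) m (by omega) h1 hm (by rw [e2]; exact hB) (by omega)
  · omega

variable {P : ℕ → PrefMatrix K} {r : ℕ → Fin K → ℝ} {v : ℕ → ℝ}

/-- Regret of the active arms in terms of the regret of an arm that survives the episode. -/
theorem IsRun.regret_le_of_active [NeZero K] (hrun : IsRun 18 T H ep st sch)
    (henv : IsEnv T P r v) (hc : Concentrated T P H) (hT : 2 ≤ T) {len : ℕ} (hlen : 0 < len)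
    {t : ℕ} (ht : t ∈ Finset.Icc 1 T) {a aL : Fin K}
    (haL : aL ∉ elimSet 18 T H (ep t) (t - 1)) (ha : a ∉ elimSet 18 T H (st t) t) :
    r t a ≤ 2 * r t aL + 3 * blockVar T len v t + 54 * K * Real.log T *
      (invSqrtGap (st t) t + invSqrtGap (blockStart len t) t) := by
  have ht' := Finset.mem_Icc.1 ht
  have hlog := two_le_three_mul_log hT
  have hK : (1 : ℝ) ≤ K := by exact_mod_cast NeZero.one_le
  have hst := hrun.st_le t ht
  have hep := hrun.ep_le_st t ht
  have hone := hrun.one_le_ep t ht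
  have hbs := blockStart_le (len := len) ht'.1
  have hW := blockVar_nonneg (T := T) henv.var_nonneg len t
  have haL0 := henv.nonneg t ht aL
  -- From round j on, the call has been open and the regrets have moved by at most W.
  set j := max (st t) (blockStart len t) with hj
  have hjt : j ≤ t := max_le hst hbs
  have hgap : invSqrtGap j t ≤ invSqrtGap (st t) t + invSqrtGap (blockStart len t) t := by
    rcases max_choice (st t) (blockStart len t) with h | h
    · rw [hj, h]; linarith [invSqrtGap_nonneg (blockStart len t) t]
    · rw [hj, h]; linarith [invSqrtGap_nonneg (st t) t]
  suffices hs : r t a ≤ 2 * r t aL + 3 * blockVar T len v t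
      + 54 * K * Real.log T * invSqrtGap j t by
    have : 54 * K * Real.log T * invSqrtGap j t ≤ 54 * K * Real.log T *
      (invSqrtGap (st t) t + invSqrtGap (blockStart len t) t) := by gcongr
    linarith
  unfold invSqrtGap
  set d : ℝ := (t : ℝ) - j with hd
  have hd0 : 0 ≤ d := by
    have : (j : ℝ) ≤ t := by exact_mod_cast hjt
    linarith
  have hy : 0 < √(d + 1) := Real.sqrt_pos.2 (by linarith)
  -- On a window of length at most K² the trivial bound 1/2 on the regret is already below the last
  -- term.
  rcases le_or_gt d ((K : ℝ) ^ 2) with hdK | hdK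
  · have h1 : √(d + 1) ≤ 2 * K := by
      rw [Real.sqrt_le_left (by linarith)]
      nlinarith
    have h2 : 1 / 2 ≤ 54 * K * Real.log T * (1 / √(d + 1)) := by
      rw [mul_one_div, le_div_iff₀ hy]
      nlinarith
    linarith [henv.le_half t ht a]
  · have hd2 : 1 < d := lt_of_le_of_lt (by nlinarith) hdK
    have hjt1 : j + 1 < t := by
      have : (j : ℝ) + 1 < t := by linarith
      exact_mod_cast this
    have hmem : ∀ τ ∈ Finset.Icc j (t - 1), τ ∈ Finset.Icc 1 T ∧ st t ≤ τ ∧ τ ≤ t - 1 ∧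
        (τ - 1) / len = (t - 1) / len := by
      intro τ hτ
      rw [Finset.mem_Icc] at hτ
      have e1 : st t ≤ τ := (le_max_left _ _).trans hτ.1
      have e2 : blockStart len t ≤ τ := (le_max_right _ _).trans hτ.1
      refine ⟨Finset.mem_Icc.2 (by omega), e1, hτ.2, ?_⟩
      have e3 := (block_eq_iff hlen ht'.1).1 rfl
      have e4 : blockStart len t = len * ((t - 1) / len) + 1 := rfl
      exact (block_eq_iff hlen (by omega)).2 (by omega)
    have hsum := sum_regret_le_of_notMem_elimSet henv hc (x := st t) (u := t) (s₁ := j)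
      (s₂ := t - 1) (a := a) (a' := aL) (by omega) (by omega) ha (le_max_left _ _) (by omega)
      (by omega) ?_ ?_
    · have hlow : d * (r t a - 2 * r t aL - 3 * blockVar T len v t)
          ≤ ∑ τ ∈ Finset.Icc j (t - 1), (r τ a - 2 * r τ aL) := by
        calc d * (r t a - 2 * r t aL - 3 * blockVar T len v t)
            = ∑ τ ∈ Finset.Icc j (t - 1), (r t a - 2 * r t aL - 3 * blockVar T len v t) := by
              rw [Finset.sum_const, Nat.card_Icc, nsmul_eq_mul, Nat.sub_add_cancel ht'.1,
                Nat.cast_sub hjt]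
          -- Moving both regrets from τ to t costs W for `a` and 2W for `aL`.
          _ ≤ _ := Finset.sum_le_sum fun τ hτ => by
              obtain ⟨m1, -, -, m2⟩ := hmem τ hτ
              have e1 := henv.le_add_blockVar hlen ht m1 m2.symm a
              have e2 := henv.le_add_blockVar hlen m1 ht m2 aL
              rw [blockVar_congr (T := T) (v := v) m2] at e1
              linarith
      have hcast : ((t - 1 : ℕ) : ℝ) - j = d - 1 := by
        rw [Nat.cast_sub ht'.1]; push_cast; rw [hd]; ring
      rw [hcast] at hsum
      have hmax : √(max (d - 1) ((K : ℝ) ^ 2)) ≤ √d :=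
        Real.sqrt_le_sqrt (max_le (by linarith) hdK.le)
      have hsd : 0 < √d := Real.sqrt_pos.2 (by linarith)
      have hsdd : √d * √d = d := Real.mul_self_sqrt hd0
      have hy2 : √(d + 1) ≤ 2 * √d := by
        rw [Real.sqrt_le_left (by positivity), mul_pow, Real.sq_sqrt hd0]
        linarith
      have h1 : √d * (√d * (r t a - 2 * r t aL - 3 * blockVar T len v t))
          ≤ √d * (27 * Real.log T * K) := by
        rw [← mul_assoc, hsdd]
        calc _ ≤ 27 * Real.log T * K * √(max (d - 1) ((K : ℝ) ^ 2)) := hlow.trans hsum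
          _ ≤ 27 * Real.log T * K * √d := by gcongr
          _ = _ := by ring
      have h2 := le_of_mul_le_mul_left h1 hsd
      set X := r t a - 2 * r t aL - 3 * blockVar T len v t with hX
      have h3 : X ≤ 54 * K * Real.log T * (1 / √(d + 1)) := by
        rw [mul_one_div, le_div_iff₀ hy]
        rcases le_total X 0 with h | h
        · have : 0 ≤ 54 * K * Real.log T := by positivity
          nlinarith
        · nlinarith
      linarith
    · intro τ hτ
      obtain ⟨m1, m2, m3, -⟩ := hmem τ hτ
      refine hrun.mem_active m1 fun h => ha ?_
      exact elimSet_mono _ _ _ (hrun.st_le_st ht m2 (by omega)) (by omega) h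
    · intro τ hτ
      obtain ⟨m1, m2, m3, -⟩ := hmem τ hτ
      refine hrun.mem_active m1 fun h => haL ?_
      have e1 := (hrun.ep_eq ht'.1 ht'.2 τ (by omega) (by omega)).1
      have e2 := hrun.ep_le_st τ m1
      exact elimSet_mono _ _ _ (by omega) m3 h

end Run

/-! ### Replay lengths -/

theorem clog_two_le {T : ℕ} (hT : 2 ≤ T) : (Nat.clog 2 T : ℝ) ≤ 3 * Real.log T := by
  have h1 : 2 ^ (Nat.clog 2 T).pred < T := Nat.pow_pred_clog_lt_self (by norm_num) (by omega)
  have hpos : 0 < Nat.clog 2 T := Nat.clog_pos (by norm_num) hT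
  have hT0 : (0 : ℝ) < T := by positivity
  have h2 : ((Nat.clog 2 T).pred : ℝ) * Real.log 2 ≤ Real.log T := by
    rw [← Real.log_pow]
    exact Real.log_le_log (by positivity) (by exact_mod_cast h1.le)
  have h3 : ((Nat.clog 2 T).pred : ℝ) = Nat.clog 2 T - 1 := by
    rw [Nat.pred_eq_sub_one, Nat.cast_sub hpos]; simp
  rw [h3] at h2
  have hl2 := Real.log_two_gt_d9
  have h4 : Real.log 2 ≤ Real.log T := Real.log_le_log (by norm_num) (by exact_mod_cast hT)
  nlinarith

theorem replayProb_eq {l s m : ℕ} (h : l ≤ s) :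
    (replayProb l s m : ℝ) = 1 / √(m : ℝ) * (1 / √((s : ℝ) - l)) := by
  simp only [replayProb]
  rw [Nat.cast_mul, Nat.cast_sub h, Real.sqrt_mul (by positivity)]
  ring

section Count

variable {T : ℕ} {H : ℕ → Round K} {C : ℝ} {ep st : ℕ → ℕ} {sch : ℕ → ℕ → ℕ → Bool}

/-- At most about 4 √n/√m replays are expected, up to the fluctuation 6 log T, and each costs at
most 2 √(m + 1), so m cancels. The fluctuation is charged at the other bound 2 √n on the cost of one
replay. -/
theorem sum_replays_le {opp : ℕ → ℕ → Fin K → Finset ℕ} {dur : Fin K → ℕ → ℕ} (hT : 2 ≤ T)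
    {l e m : ℕ} (hle : l ≤ e) (heT : e ≤ T) {B : ℕ → ℕ → Bool} (hB : GoodSchedule T opp dur l B)
    (hm : m ∈ durations T) :
    ∑ s ∈ Finset.Icc (l + 1) e, (if B s m then 2 * √(min (m + 1) ((e : ℝ) + 1 - l)) else 0)
      ≤ 36 * Real.log T * √((e : ℝ) + 1 - l) := by
  have hlog := two_le_three_mul_log hT
  have hle' : (l : ℝ) ≤ e := by exact_mod_cast hle
  set n : ℝ := (e : ℝ) + 1 - l with hn
  have hn1 : 1 ≤ n := by linarith
  have hm1 : (1 : ℝ) ≤ m := by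
    obtain ⟨i, -, rfl⟩ := mem_durations.1 hm
    exact_mod_cast Nat.one_le_two_pow
  have hcount := hB.1 m hm e heT
  rw [Finset.sum_sub_distrib, ← Finset.mul_sum] at hcount
  have hp : ∑ s ∈ Finset.Icc (l + 1) e, (replayProb l s m : ℝ) ≤ 1 / √(m : ℝ) * (2 * √n) := by
    rw [Finset.sum_congr rfl fun s hs => replayProb_eq (m := m) (l := l) (s := s)
      (by rw [Finset.mem_Icc] at hs; omega), ← Finset.mul_sum]
    refine mul_le_mul_of_nonneg_left ?_ (by positivity)
    have h1 := sum_invSqrtGap_le_of_subset (s := Finset.Icc (l + 1) e) (a := l + 1) (b := e + 1)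
      (by omega) (fun s hs => by rw [Finset.mem_Icc] at hs; rw [Finset.mem_Ico]; omega)
    calc _ = ∑ s ∈ Finset.Icc (l + 1) e, invSqrtGap (l + 1) s := by
          refine Finset.sum_congr rfl fun s _ => ?_
          unfold invSqrtGap; congr 2; push_cast; ring
      _ ≤ _ := h1
      _ ≤ 2 * √n := by
          gcongr
          push_cast; rw [hn]; linarith
  have hsm : 0 < √(m : ℝ) := Real.sqrt_pos.2 (by linarith)
  have hsn : 0 < √n := Real.sqrt_pos.2 (by linarith)
  set q := √(min (m + 1) n) with hq
  have hq0 : 0 ≤ q := Real.sqrt_nonneg _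
  have hqn : q ≤ √n := Real.sqrt_le_sqrt (min_le_right _ _)
  have hqm : q ≤ 2 * √(m : ℝ) := by
    rw [hq, Real.sqrt_le_left (by positivity), mul_pow, Real.sq_sqrt (by linarith)]
    exact (min_le_left _ _).trans (by linarith)
  have hqm' : 1 / √(m : ℝ) * q ≤ 2 := by
    rw [one_div_mul_eq_div, div_le_iff₀ hsm]; exact hqm
  have hrw : ∑ s ∈ Finset.Icc (l + 1) e, (if B s m then 2 * q else 0)
      = 2 * q * ∑ s ∈ Finset.Icc (l + 1) e, (if B s m then (1 : ℝ) else 0) := by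
    rw [Finset.mul_sum]
    exact Finset.sum_congr rfl fun s _ => by split_ifs <;> ring
  rw [hrw]
  calc 2 * q * ∑ s ∈ Finset.Icc (l + 1) e, (if B s m then (1 : ℝ) else 0)
      ≤ 2 * q * (6 * Real.log T + 2 * (1 / √(m : ℝ) * (2 * √n))) := by
        refine mul_le_mul_of_nonneg_left ?_ (by linarith)
        linarith
    _ = 12 * Real.log T * q + 8 * (1 / √(m : ℝ) * q) * √n := by ring
    _ ≤ 12 * Real.log T * √n + 8 * 2 * √n := by gcongr
    _ ≤ 36 * Real.log T * √n := by nlinarith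

/-- The regret caused by the restarts of the active set at replays. -/
theorem IsRun.sum_invSqrtGap_st_le {opp : ℕ → ℕ → Fin K → Finset ℕ} {dur : Fin K → ℕ → ℕ}
    (hrun : IsRun C T H ep st sch) (hT : 2 ≤ T) {l e : ℕ} (hl : 1 ≤ l) (hle : l ≤ e) (heT : e ≤ T)
    {B : ℕ → ℕ → Bool} (hep : ∀ t ∈ Finset.Icc l e, ep t = l ∧ sch t = B)
    (hB : GoodSchedule T opp dur l B) :
    ∑ t ∈ Finset.Icc l e, invSqrtGap (st t) t ≤ 113 * Real.log T ^ 2 * √((e : ℝ) + 1 - l) := by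
  have hlog := two_le_three_mul_log hT
  have hle' : (l : ℝ) ≤ e := by exact_mod_cast hle
  set n : ℝ := (e : ℝ) + 1 - l with hn
  set D := (durations T).toFinset with hD
  set f : ℕ → ℕ → ℕ → ℝ := fun m s t =>
    if B s m = true ∧ s ≤ t ∧ t ≤ s + m then invSqrtGap s t else 0 with hf
  have hf0 : ∀ m s t, 0 ≤ f m s t := fun m s t => by
    rw [hf]; simp only; split_ifs; exacts [invSqrtGap_nonneg _ _, le_rfl]
  have hpt : ∀ t ∈ Finset.Icc l e, invSqrtGap (st t) t
      ≤ invSqrtGap l t + ∑ m ∈ D, ∑ s ∈ Finset.Icc (l + 1) e, f m s t := by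
    intro t ht
    obtain ⟨e1, e2⟩ := hep t ht
    rw [Finset.mem_Icc] at ht
    have htT : t ∈ Finset.Icc 1 T := Finset.mem_Icc.2 (by omega)
    have h1 := hrun.ep_le_st t htT
    have h2 := hrun.st_le t htT
    have hsum0 : 0 ≤ ∑ m ∈ D, ∑ s ∈ Finset.Icc (l + 1) e, f m s t :=
      Finset.sum_nonneg fun m _ => Finset.sum_nonneg fun s _ => hf0 m s t
    rcases Nat.lt_or_ge l (st t) with h | h
    · rcases hrun.st_eq_or t htT with h3 | ⟨m, hm, hBm, hm'⟩
      · omega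
      · rw [e2] at hBm
        have h4 : invSqrtGap (st t) t = f m (st t) t := by
          rw [hf]; simp only; rw [if_pos ⟨hBm, h2, hm'⟩]
        have h5 : f m (st t) t ≤ ∑ s ∈ Finset.Icc (l + 1) e, f m s t :=
          Finset.single_le_sum (f := fun s => f m s t) (fun s _ => hf0 m s t)
            (Finset.mem_Icc.2 (by omega))
        have h6 : ∑ s ∈ Finset.Icc (l + 1) e, f m s t
            ≤ ∑ m ∈ D, ∑ s ∈ Finset.Icc (l + 1) e, f m s t :=
          Finset.single_le_sum (f := fun m => ∑ s ∈ Finset.Icc (l + 1) e, f m s t)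
            (fun m _ => Finset.sum_nonneg fun s _ => hf0 m s t) (List.mem_toFinset.2 hm)
        linarith [invSqrtGap_nonneg l t]
    · have h3 : st t = l := by omega
      rw [h3]; linarith
  have hms : ∀ m ∈ D, ∀ s ∈ Finset.Icc (l + 1) e, ∑ t ∈ Finset.Icc l e, f m s t
      ≤ if B s m then 2 * √(min (m + 1) n) else 0 := by
    intro m _ s hs
    rw [Finset.mem_Icc] at hs
    by_cases hBs : B s m = true
    · simp only [hf, hBs, true_and, if_true]
      rw [← Finset.sum_filter]
      have hsub : (Finset.Icc l e).filter (fun t => s ≤ t ∧ t ≤ s + m)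
          ⊆ Finset.Ico s (min (s + m + 1) (e + 1)) := by
        intro t ht
        rw [Finset.mem_filter, Finset.mem_Icc] at ht
        rw [Finset.mem_Ico]
        refine ⟨ht.2.1, lt_min (by omega) (by omega)⟩
      refine (sum_invSqrtGap_le_of_subset (le_min (by omega) (by omega)) hsub).trans ?_
      gcongr
      have hsl : (l : ℝ) ≤ s := by exact_mod_cast (by omega : l ≤ s)
      refine le_min ?_ ?_
      · have : ((min (s + m + 1) (e + 1) : ℕ) : ℝ) ≤ (s + m + 1 : ℕ) := by
          exact_mod_cast min_le_left _ _
        push_cast at this ⊢; linarith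
      · have : ((min (s + m + 1) (e + 1) : ℕ) : ℝ) ≤ (e + 1 : ℕ) := by
          exact_mod_cast min_le_right _ _
        push_cast at this ⊢; rw [hn]; linarith
    · simp [hf, hBs]
  have hroot : ∑ t ∈ Finset.Icc l e, invSqrtGap l t ≤ 2 * √n := by
    refine (sum_invSqrtGap_le_of_subset (b := e + 1) (by omega) fun t ht => ?_).trans_eq ?_
    · rw [Finset.mem_Icc] at ht; rw [Finset.mem_Ico]; omega
    · push_cast; rfl
  have hrep : ∑ t ∈ Finset.Icc l e, ∑ m ∈ D, ∑ s ∈ Finset.Icc (l + 1) e, f m s t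
      ≤ D.card * (36 * Real.log T * √n) := by
    rw [Finset.sum_comm]
    refine (Finset.sum_le_card_nsmul D _ (36 * Real.log T * √n) fun m hm => ?_).trans_eq
      (nsmul_eq_mul _ _)
    rw [Finset.sum_comm]
    exact (Finset.sum_le_sum fun s hs => hms m hm s hs).trans
      (sum_replays_le hT hle heT hB (List.mem_toFinset.1 hm))
  have hcard : (D.card : ℝ) ≤ 3 * Real.log T := by
    rw [hD, List.toFinset_card_of_nodup (nodup_durations T)]
    simpa [durations] using clog_two_le hT
  calc ∑ t ∈ Finset.Icc l e, invSqrtGap (st t) t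
      ≤ ∑ t ∈ Finset.Icc l e, (invSqrtGap l t + ∑ m ∈ D, ∑ s ∈ Finset.Icc (l + 1) e, f m s t) :=
        Finset.sum_le_sum hpt
    _ ≤ 2 * √n + D.card * (36 * Real.log T * √n) := by
        rw [Finset.sum_add_distrib]; exact add_le_add hroot hrep
    _ ≤ 2 * √n + 3 * Real.log T * (36 * Real.log T * √n) := by
        gcongr
    _ ≤ 113 * Real.log T ^ 2 * √n := by
        have : 0 ≤ √n := Real.sqrt_nonneg _
        nlinarith [mul_nonneg (mul_nonneg (by linarith : 0 ≤ 3 * Real.log T - 2)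
          (by linarith : 0 ≤ 3 * Real.log T + 2)) this]

end Count

/-! ### Regret of an arm that survives an episode -/

/-- Duration of a replay that detects, within the block of round `s`, that the arm `a` is bad. -/
noncomputable def detectDur (T len : ℕ) (r : ℕ → Fin K → ℝ) (a : Fin K) (s : ℕ) : ℕ :=
  2 ^ Nat.clog 2 ⌈(55 * K * Real.log T / r (blockStart len s) a) ^ 2⌉₊

open Classical in
/-- Rounds in which a replay of duration `detectDur` would detect that the arm `a` is bad, and
would end before round `u` and within a block. -/
noncomputable def detectRounds (T len : ℕ) (r : ℕ → Fin K → ℝ) (v : ℕ → ℝ) (l u : ℕ)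
    (a : Fin K) : Finset ℕ :=
  {s ∈ Finset.Icc (l + 1) T | 0 < r (blockStart len s) a ∧
    25 * blockVar T len v s ≤ r (blockStart len s) a ∧
    (s + detectDur T len r a s - 1 - 1) / len = (s - 1) / len ∧ s + detectDur T len r a s - 1 ≤ u}

section

variable {T len : ℕ} {P : ℕ → PrefMatrix K} {H : ℕ → Round K} {r : ℕ → Fin K → ℝ} {v : ℕ → ℝ}

theorem blockStart_mem (t : ℕ) (ht : t ∈ Finset.Icc 1 T) : blockStart len t ∈ Finset.Icc 1 T := by
  rw [Finset.mem_Icc] at ht ⊢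
  exact ⟨one_le_blockStart _ _, (blockStart_le ht.1).trans ht.2⟩

/-- Rounding z² up to an integer and then to a power of two costs at most a factor 4 in the
duration, hence 2 in its square root. Since z ≥ 2, the exponent is positive, as for every replay
duration. -/
theorem detectDur_bounds [NeZero K] (hT : 2 ≤ T) {a : Fin K} {s : ℕ}
    (hpos : 0 < r (blockStart len s) a) (hhalf : r (blockStart len s) a ≤ 1 / 2) :
    (∃ i, detectDur T len r a s = 2 ^ (i + 1)) ∧
    55 * K * Real.log T ≤ √(detectDur T len r a s : ℝ) * r (blockStart len s) a ∧
    √(detectDur T len r a s : ℝ) * r (blockStart len s) a ≤ 110 * K * Real.log T := by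
  have hlog := two_le_three_mul_log hT
  have hK : (1 : ℝ) ≤ K := by exact_mod_cast NeZero.one_le
  unfold detectDur
  set ρ := r (blockStart len s) a with hρ
  set z : ℝ := 55 * K * Real.log T / ρ with hz
  have hz1 : 2 ≤ z := by
    rw [hz, le_div_iff₀ hpos]; nlinarith
  have hzz : z * ρ = 55 * K * Real.log T := by rw [hz]; field_simp
  set x := ⌈z ^ 2⌉₊ with hx
  have hx1 : z ^ 2 ≤ x := Nat.le_ceil _
  have hx2 : (x : ℝ) < z ^ 2 + 1 := Nat.ceil_lt_add_one (by positivity)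
  have hx3 : 1 < x := by
    have : (1 : ℝ) < x := lt_of_lt_of_le (by nlinarith) hx1
    exact_mod_cast this
  have hpos' : 0 < Nat.clog 2 x := Nat.clog_pos (by norm_num) hx3
  have hlow : x ≤ 2 ^ Nat.clog 2 x := Nat.le_pow_clog (by norm_num) x
  have hup : 2 ^ Nat.clog 2 x < 2 * x := by
    have h1 := Nat.pow_pred_clog_lt_self (b := 2) (by norm_num) hx3
    obtain ⟨i, hi⟩ := Nat.exists_eq_add_of_lt hpos'
    rw [hi] at h1 ⊢
    simp only [zero_add, Nat.pred_eq_sub_one, Nat.add_sub_cancel] at h1 ⊢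
    rw [pow_succ]; omega
  set m : ℕ := 2 ^ Nat.clog 2 x with hm
  have hm1 : z ^ 2 ≤ m := hx1.trans (by exact_mod_cast hlow)
  have hm2 : (m : ℝ) ≤ (2 * z) ^ 2 := by
    have : (m : ℝ) < 2 * x := by exact_mod_cast hup
    nlinarith
  refine ⟨⟨Nat.clog 2 x - 1, by rw [hm, Nat.sub_add_cancel hpos']⟩, ?_, ?_⟩
  · rw [← hzz]
    exact mul_le_mul_of_nonneg_right (Real.le_sqrt_of_sq_le hm1) hpos.le
  · have h1 : √(m : ℝ) ≤ 2 * z := by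
      rw [Real.sqrt_le_left (by linarith)]; exact hm2
    nlinarith

theorem detectRounds_subset (l u : ℕ) (a : Fin K) :
    detectRounds T len r v l u a ⊆ Finset.Icc (l + 1) T := by
  classical
  exact Finset.filter_subset _ _

theorem detectDur_mem_durations [NeZero K] (hT : 2 ≤ T) (henv : IsEnv T P r v) {l u : ℕ}
    (hu : u ≤ T) {a : Fin K} {s : ℕ} (hs : s ∈ detectRounds T len r v l u a) :
    detectDur T len r a s ∈ durations T := by
  classical
  simp only [detectRounds, Finset.mem_filter, Finset.mem_Icc] at hs
  obtain ⟨hs1, hpos, -, -, hle⟩ := hs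
  have hmem : s ∈ Finset.Icc 1 T := Finset.mem_Icc.2 (by omega)
  obtain ⟨⟨i, hi⟩, -, -⟩ := detectDur_bounds hT hpos (henv.le_half _ (blockStart_mem s hmem) a)
  rw [mem_durations]
  refine ⟨i, ?_, hi.symm⟩
  have h1 : 2 ^ (i + 1) ≤ T := by omega
  have h2 := Nat.clog_mono_right 2 h1
  rw [Nat.clog_pow 2 _ (by norm_num)] at h2
  omega

variable {ep st : ℕ → ℕ} {sch : ℕ → ℕ → ℕ → Bool}

/-- No replay of a bad arm that survives the episode is scheduled in a detection round. -/
theorem IsRun.not_scheduled_of_survives [NeZero K] (hrun : IsRun 18 T H ep st sch)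
    (henv : IsEnv T P r v) (hc : Concentrated T P H) (hT : 2 ≤ T) (hlen : 0 < len)
    {l e : ℕ} (hl : 1 ≤ l) (hle : l ≤ e) (heT : e ≤ T)
    {B : ℕ → ℕ → Bool} (hep : ∀ t ∈ Finset.Icc l e, ep t = l ∧ sch t = B)
    {a : Fin K} (ha : a ∉ elimSet 18 T H l (e - 1)) {s : ℕ}
    (hs : s ∈ detectRounds T len r v l (e - 2) a) : B s (detectDur T len r a s) = false := by
  classical
  by_contra hB
  rw [Bool.not_eq_false] at hB
  have hdur := detectDur_mem_durations (len := len) hT henv (by omega : e - 2 ≤ T) hs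
  simp only [detectRounds, Finset.mem_filter, Finset.mem_Icc] at hs
  obtain ⟨hs1, hpos, hW, hblk, hend⟩ := hs
  have hmem : s ∈ Finset.Icc 1 T := Finset.mem_Icc.2 (by omega)
  have hbmem := blockStart_mem (len := len) s hmem
  obtain ⟨⟨i, hi⟩, hm1, hm2⟩ := detectDur_bounds hT hpos (henv.le_half _ hbmem a)
  have hWnn := blockVar_nonneg (T := T) henv.var_nonneg len s
  set m := detectDur T len r a s with hm
  set ρ := r (blockStart len s) a with hρ
  set W := blockVar T len v s with hWdef
  have hm2' : 2 ≤ m := by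
    rw [hi, pow_succ]; have := Nat.one_le_two_pow (n := i); omega
  have hlog := two_le_three_mul_log hT
  have hK : (1 : ℝ) ≤ K := by exact_mod_cast NeZero.one_le
  -- An arm without regret at the start of the block is the benchmark: throughout the replay its
  -- regret is at most W.
  obtain ⟨a₀, ha₀⟩ := henv.exists_zero _ hbmem
  have hb1 := (block_eq_iff hlen (by omega : 1 ≤ s)).1 rfl
  have hb2 := (block_eq_iff hlen (by omega : 1 ≤ s + m - 1)).1 hblk
  have hround : ∀ τ, s ≤ τ → τ ≤ s + m - 1 → τ ∈ Finset.Icc 1 T ∧ s ≤ st τ ∧ st τ ≤ τ ∧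
      ep τ = l ∧ (τ - 1) / len = (s - 1) / len := by
    intro τ h1 h2
    have hτ : τ ∈ Finset.Icc 1 T := Finset.mem_Icc.2 (by omega)
    obtain ⟨e1, e2⟩ := hep τ (Finset.mem_Icc.2 (by omega))
    exact ⟨hτ, hrun.le_st τ hτ s m (by omega) h1 hdur (by rw [e2]; exact hB) (by omega),
      hrun.st_le τ hτ, e1, (block_eq_iff hlen (by omega)).2 (by omega)⟩
  have hreg : ∀ τ, s ≤ τ → τ ≤ s + m - 1 → r τ a₀ ≤ W ∧ ρ - W ≤ r τ a := by
    intro τ h1 h2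
    obtain ⟨hτ, -, -, -, hbτ⟩ := hround τ h1 h2
    have e0 := blockStart_block hlen s
    have e1 := henv.le_add_blockVar hlen hτ hbmem (hbτ.trans e0.symm) a₀
    have e2 := henv.le_add_blockVar hlen hbmem hτ (e0.trans hbτ.symm) a
    rw [ha₀, blockVar_congr (T := T) (v := v) e0] at e1
    rw [blockVar_congr (T := T) (v := v) hbτ] at e2
    constructor <;> linarith
  -- The replay ends by round e - 2, the last round visible to the elimination set in `ha`.
  have hsum := sum_regret_le_of_notMem_elimSet henv hc (x := l) (u := e - 1) (s₁ := s)
    (s₂ := s + m - 1) (a := a) (a' := a₀) hl (by omega) ha (by omega) (by omega) (by omega)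
    (fun τ hτ => ?_) (fun τ hτ => ?_)
  · have hm0 : (0 : ℝ) < m := by exact_mod_cast (by omega : 0 < m)
    have hsm : 0 < √(m : ℝ) := Real.sqrt_pos.2 hm0
    have hsmm : √(m : ℝ) * √(m : ℝ) = m := Real.mul_self_sqrt hm0.le
    have hlow : m * (ρ - 3 * W) ≤ ∑ τ ∈ Finset.Icc s (s + m - 1), (r τ a - 2 * r τ a₀) := by
      calc m * (ρ - 3 * W) = ∑ τ ∈ Finset.Icc s (s + m - 1), (ρ - 3 * W) := by
            rw [Finset.sum_const, Nat.card_Icc, nsmul_eq_mul]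
            congr 2; omega
        _ ≤ _ := Finset.sum_le_sum fun τ hτ => by
            rw [Finset.mem_Icc] at hτ
            obtain ⟨e1, e2⟩ := hreg τ hτ.1 hτ.2
            linarith
    have hmK : (K : ℝ) ≤ √(m : ℝ) := by
      have h1 : ρ ≤ 1 / 2 := henv.le_half _ hbmem a
      have h2 : √(m : ℝ) * ρ ≤ √(m : ℝ) * (1 / 2) := by gcongr
      have h3 : (K : ℝ) * 2 ≤ K * (3 * Real.log T) := by gcongr
      linarith
    have hmax : √(max (((s + m - 1 : ℕ) : ℝ) - s) ((K : ℝ) ^ 2)) ≤ √(m : ℝ) := by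
      refine Real.sqrt_le_sqrt (max_le ?_ ?_)
      · rw [Nat.cast_sub (by omega)]; push_cast; linarith
      · rw [← Real.sq_sqrt hm0.le]; gcongr
    have h1 : √(m : ℝ) * (√(m : ℝ) * (ρ - 3 * W)) ≤ √(m : ℝ) * (27 * Real.log T * K) := by
      rw [← mul_assoc, hsmm]
      calc _ ≤ 27 * Real.log T * K * _ := hlow.trans hsum
        _ ≤ 27 * Real.log T * K * √(m : ℝ) := by gcongr
        _ = _ := by ring
    have h2 := le_of_mul_le_mul_left h1 hsm
    have h3 : √(m : ℝ) * (25 * W) ≤ √(m : ℝ) * ρ := mul_le_mul_of_nonneg_left hW hsm.le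
    have h4 : 0 < K * Real.log T := mul_pos (by linarith) (by linarith)
    -- Since ρ ≥ 25 W, √m (ρ - 3W) ≥ (22/25) √m ρ ≥ 48.4 K log T, which exceeds 27 K log T.
    linarith
  · rw [Finset.mem_Icc] at hτ
    obtain ⟨h1, h2, h3, h4, -⟩ := hround τ hτ.1 hτ.2
    refine hrun.mem_active h1 fun h => ha ?_
    have := hrun.ep_le_st τ h1
    exact elimSet_mono _ _ _ (by omega) (by omega) h
  · rw [Finset.mem_Icc] at hτ
    obtain ⟨h1, h2, h3, h4, -⟩ := hround τ hτ.1 hτ.2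
    refine hrun.mem_active h1 fun h => ?_
    have hlt := lt_of_mem_elimSet henv hc (by omega) (by omega) h hWnn
      (fun t h5 h6 => (hreg t (by omega) (by omega)).1)
    have h7 : √((τ : ℝ) - st τ) ≤ √(m : ℝ) := by
      refine Real.sqrt_le_sqrt ?_
      have e1 : (s : ℝ) ≤ st τ := by exact_mod_cast h2
      have e2 : (τ : ℝ) ≤ s + m := by exact_mod_cast (by omega : τ ≤ s + m)
      linarith
    have h8 : 2 * W * √((τ : ℝ) - st τ) ≤ 2 * W * √(m : ℝ) := by gcongr
    have h9 : 25 * W * √(m : ℝ) ≤ ρ * √(m : ℝ) := by gcongr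
    have h4 : 0 < K * Real.log T := mul_pos (by linarith) (by linarith)
    -- The benchmark is never eliminated during the replay: 2 W √m ≤ (2/25) √m ρ ≤ 8.8 K log T,
    -- below the required 9 K log T. This fixes the factor 25.
    linarith

/-- With ρ the regret at the start of the block, three cases. If ρ ≤ 25 W, the variation pays. If
fewer than 2m rounds of the block are available, with m the detection duration, then ρ is of order K
log T/√m and inverse square roots pay. Otherwise at least half of these rounds can start a detecting
replay, and their scheduling probabilities pay. -/
theorem sum_regret_block_le [NeZero K] (henv : IsEnv T P r v) (hT : 2 ≤ T) (hlen : 0 < len)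
    {l u : ℕ} (hu : u ≤ T) {n : ℝ} (hn1 : 1 ≤ n) (hn : (u : ℝ) - l ≤ n) (a : Fin K) (k : ℕ) :
    ∑ t ∈ Finset.Icc (l + 1) u with (t - 1) / len = k, r t a
      ≤ ∑ t ∈ Finset.Icc (l + 1) u with (t - 1) / len = k, (26 * blockVar T len v t
        + 330 * K * Real.log T * (invSqrtGap (blockStart len t) t + invSqrtGap (l + 1) t))
      + 440 * K * Real.log T * √n *
        ∑ s ∈ detectRounds T len r v l u a with (s - 1) / len = k,
          (replayProb l s (detectDur T len r a s) : ℝ) := by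
  classical
  have hlog := two_le_three_mul_log hT
  have hK : (1 : ℝ) ≤ K := by exact_mod_cast NeZero.one_le
  set J := (Finset.Icc (l + 1) u).filter fun t => (t - 1) / len = k with hJ
  have hKL : 0 < K * Real.log T := by nlinarith
  have hopp0 : 0 ≤ ∑ s ∈ detectRounds T len r v l u a with (s - 1) / len = k,
      (replayProb l s (detectDur T len r a s) : ℝ) :=
    Finset.sum_nonneg fun s _ => (replayProb l s _).2.1
  have hterm0 : 0 ≤ 440 * K * Real.log T * √n *
      ∑ s ∈ detectRounds T len r v l u a with (s - 1) / len = k,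
        (replayProb l s (detectDur T len r a s) : ℝ) := by positivity
  have hinv0 : ∀ t, 0 ≤ 330 * K * Real.log T *
      (invSqrtGap (blockStart len t) t + invSqrtGap (l + 1) t) := fun t =>
    mul_nonneg (by positivity) (add_nonneg (invSqrtGap_nonneg _ _) (invSqrtGap_nonneg _ _))
  rcases J.eq_empty_or_nonempty with hJe | ⟨t₀, ht₀⟩
  · rw [hJe]; simpa using hterm0
  have hJmem : ∀ t ∈ J, t ∈ Finset.Icc 1 T ∧ l + 1 ≤ t ∧ t ≤ u ∧ (t - 1) / len = k := by
    intro t ht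
    rw [hJ, Finset.mem_filter, Finset.mem_Icc] at ht
    exact ⟨Finset.mem_Icc.2 (by omega), ht.1.1, ht.1.2, ht.2⟩
  obtain ⟨m₀, m₁, m₂, m₃⟩ := hJmem t₀ ht₀
  have hbs : ∀ t, (t - 1) / len = k → blockStart len t = len * k + 1 := fun t ht => by
    rw [blockStart, ht]
  set ρ := r (len * k + 1) a with hρ
  set W := blockVar T len v t₀ with hW
  have hW0 : 0 ≤ W := blockVar_nonneg henv.var_nonneg _ _
  have hWeq : ∀ t, (t - 1) / len = k → blockVar T len v t = W := fun t ht =>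
    blockVar_congr (ht.trans m₃.symm)
  have hbmem : len * k + 1 ∈ Finset.Icc 1 T := by
    rw [← hbs t₀ m₃]; exact blockStart_mem t₀ m₀
  have hρ2 : ρ ≤ 1 / 2 := henv.le_half _ hbmem a
  have hle : ∀ t ∈ J, r t a ≤ ρ + W := by
    intro t ht
    obtain ⟨h1, -, -, h4⟩ := hJmem t ht
    have e0 : (len * k + 1 - 1) / len = k := by
      rw [Nat.add_sub_cancel, Nat.mul_div_cancel_left _ hlen]
    have := henv.le_add_blockVar hlen h1 hbmem (h4.trans e0.symm) a
    rwa [hWeq _ e0] at this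
  have hrhs : ∑ t ∈ J, (26 * blockVar T len v t
      + 330 * K * Real.log T * (invSqrtGap (blockStart len t) t + invSqrtGap (l + 1) t))
      = ∑ t ∈ J, (26 * W
      + 330 * K * Real.log T * (invSqrtGap (len * k + 1) t + invSqrtGap (l + 1) t)) :=
    Finset.sum_congr rfl fun t ht => by rw [hWeq t (hJmem t ht).2.2.2, hbs t (hJmem t ht).2.2.2]
  by_cases hcase : ρ ≤ 25 * W
  · have : ∑ t ∈ J, r t a ≤ ∑ t ∈ J, (26 * blockVar T len v t
        + 330 * K * Real.log T * (invSqrtGap (blockStart len t) t + invSqrtGap (l + 1) t)) :=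
      Finset.sum_le_sum fun t ht => by
        rw [hWeq t (hJmem t ht).2.2.2]
        linarith [hle t ht, hinv0 t]
    linarith
  rw [not_le] at hcase
  have hρ0 : 0 < ρ := by linarith
  have hdur : ∀ t, (t - 1) / len = k → detectDur T len r a t = detectDur T len r a t₀ :=
    fun t ht => by rw [detectDur, detectDur, hbs t ht, hbs t₀ m₃]
  have hbd := detectDur_bounds (len := len) (r := r) hT (a := a) (s := t₀)
    (by rw [hbs t₀ m₃]; exact hρ0) (by rw [hbs t₀ m₃]; exact hρ2)
  rw [hbs t₀ m₃, ← hρ] at hbd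
  set m := detectDur T len r a t₀ with hm
  obtain ⟨⟨i, hi⟩, hm1, hm2⟩ := hbd
  have hm2' : 2 ≤ m := by
    rw [hi, pow_succ]; have := Nat.one_le_two_pow (n := i); omega
  have hm0 : (0 : ℝ) < m := by exact_mod_cast (by omega : 0 < m)
  have hsm : 0 < √(m : ℝ) := Real.sqrt_pos.2 hm0
  have hr2 : ∀ t ∈ J, r t a ≤ 2 * ρ := fun t ht => by linarith [hle t ht]
  have hJIcc : J = Finset.Icc (max (l + 1) (len * k + 1)) (min u (len * k + len)) := by
    ext t
    rw [hJ, Finset.mem_filter, Finset.mem_Icc, Finset.mem_Icc]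
    constructor
    · rintro ⟨h1, h2⟩
      have := (block_eq_iff hlen (by omega)).1 h2
      omega
    · intro h
      exact ⟨by omega, (block_eq_iff hlen (by omega)).2 (by omega)⟩
  set α := max (l + 1) (len * k + 1) with hα
  set β := min u (len * k + len) with hβ
  have hαβ : α ≤ β := by
    rw [hJIcc, Finset.mem_Icc] at ht₀; omega
  have hcard : J.card = β + 1 - α := by rw [hJIcc, Nat.card_Icc]
  have hq0 : (0 : ℝ) < J.card := by rw [hcard]; exact_mod_cast (by omega : 0 < β + 1 - α)
  rcases Nat.lt_or_ge J.card (2 * m) with hq | hq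
  · -- the block is too short for detection
    have hpt : ∀ t ∈ J, r t a ≤ 26 * W +
        330 * K * Real.log T * (invSqrtGap (len * k + 1) t + invSqrtGap (l + 1) t) := by
      intro t ht
      have ht' := ht
      rw [hJIcc, Finset.mem_Icc] at ht'
      have hgap : invSqrtGap α t ≤ invSqrtGap (len * k + 1) t + invSqrtGap (l + 1) t := by
        rcases max_choice (l + 1) (len * k + 1) with h | h
        · rw [hα, h]; linarith [invSqrtGap_nonneg (len * k + 1) t]
        · rw [hα, h]; linarith [invSqrtGap_nonneg (l + 1) t]
      have hρle : 2 * ρ ≤ 330 * K * Real.log T * invSqrtGap α t := by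
        unfold invSqrtGap
        have hαt : (α : ℝ) ≤ t := by exact_mod_cast ht'.1
        have hy : 0 < √((t : ℝ) - α + 1) := Real.sqrt_pos.2 (by linarith)
        rw [mul_one_div, le_div_iff₀ hy]
        -- At most 2m rounds lie between α and t, and √2 ≤ 1.5; hence 330 = 2 · 1.5 · 110.
        have hy2 : √((t : ℝ) - α + 1) ≤ 1.5 * √(m : ℝ) := by
          rw [Real.sqrt_le_left (by positivity), mul_pow, Real.sq_sqrt hm0.le]
          have h1 : t + 1 ≤ 2 * m + α := by omega
          have h2 : (t : ℝ) + 1 ≤ 2 * m + α := by exact_mod_cast h1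
          linarith
        calc 2 * ρ * √((t : ℝ) - α + 1) ≤ 2 * ρ * (1.5 * √(m : ℝ)) := by gcongr
          _ = 3 * (√(m : ℝ) * ρ) := by ring
          _ ≤ 3 * (110 * K * Real.log T) := by gcongr
          _ = _ := by ring
      calc r t a ≤ 2 * ρ := hr2 t ht
        _ ≤ 330 * K * Real.log T * invSqrtGap α t := hρle
        _ ≤ 330 * K * Real.log T * (invSqrtGap (len * k + 1) t + invSqrtGap (l + 1) t) := by
            gcongr
        _ ≤ _ := by linarith
    rw [hrhs]
    linarith [Finset.sum_le_sum hpt]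
  · -- many detection rounds
    -- These are the starting rounds for which a window of m rounds fits into the block and ends by
    -- u.
    have hsub : Finset.Icc α (β + 1 - m)
        ⊆ (detectRounds T len r v l u a).filter fun s => (s - 1) / len = k := by
      intro s hs
      rw [Finset.mem_Icc] at hs
      have hsk : (s - 1) / len = k := (block_eq_iff hlen (by omega)).2 (by omega)
      rw [Finset.mem_filter, detectRounds, Finset.mem_filter, Finset.mem_Icc, hdur s hsk,
        hbs s hsk, hWeq s hsk, hsk]
      exact ⟨⟨⟨by omega, by omega⟩, hρ0, hcase.le,
        (block_eq_iff hlen (by omega)).2 (by omega), by omega⟩, rfl⟩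
    have hprob : ∀ s ∈ Finset.Icc α (β + 1 - m),
        1 / (√(m : ℝ) * √n) ≤ (replayProb l s (detectDur T len r a s) : ℝ) := by
      intro s hs
      have hsf := hsub hs
      rw [Finset.mem_filter] at hsf
      rw [Finset.mem_Icc] at hs
      rw [hdur s hsf.2, replayProb_eq (by omega), ← one_div_mul_one_div]
      refine mul_le_mul_of_nonneg_left ?_ (by positivity)
      have h1 : (l : ℝ) + 1 ≤ s := by exact_mod_cast (by omega : l + 1 ≤ s)
      have h2 : (s : ℝ) ≤ u := by exact_mod_cast (by omega : s ≤ u)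
      exact one_div_le_one_div_of_le (Real.sqrt_pos.2 (by linarith))
        (Real.sqrt_le_sqrt (by linarith))
    have hsn : 0 < √n := Real.sqrt_pos.2 (by linarith)
    have hopp : (J.card : ℝ) / 2 * (1 / (√(m : ℝ) * √n))
        ≤ ∑ s ∈ detectRounds T len r v l u a with (s - 1) / len = k,
          (replayProb l s (detectDur T len r a s) : ℝ) := by
      calc (J.card : ℝ) / 2 * (1 / (√(m : ℝ) * √n))
          ≤ (Finset.Icc α (β + 1 - m)).card * (1 / (√(m : ℝ) * √n)) := by
            refine mul_le_mul_of_nonneg_right ?_ (by positivity)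
            rw [div_le_iff₀ (by norm_num), Nat.card_Icc]
            have : J.card ≤ (β + 1 - m + 1 - α) * 2 := by omega
            exact_mod_cast this
        _ ≤ ∑ s ∈ Finset.Icc α (β + 1 - m),
            (replayProb l s (detectDur T len r a s) : ℝ) := by
            rw [← nsmul_eq_mul]
            exact Finset.card_nsmul_le_sum _ _ _ hprob
        _ ≤ _ := Finset.sum_le_sum_of_subset_of_nonneg hsub fun s _ _ => (replayProb l s _).2.1
    have hmain : ∑ t ∈ J, r t a ≤ 440 * K * Real.log T * √n *
        ∑ s ∈ detectRounds T len r v l u a with (s - 1) / len = k,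
          (replayProb l s (detectDur T len r a s) : ℝ) := by
      calc ∑ t ∈ J, r t a ≤ J.card * (2 * ρ) := by
            rw [← nsmul_eq_mul]
            exact Finset.sum_le_card_nsmul _ _ _ hr2
        _ = 4 * (√(m : ℝ) * ρ) * √n * (J.card / 2 * (1 / (√(m : ℝ) * √n))) := by
            field_simp; ring
        _ ≤ 4 * (110 * K * Real.log T) * √n * (J.card / 2 * (1 / (√(m : ℝ) * √n))) := by
            gcongr
        _ = 440 * K * Real.log T * √n * (J.card / 2 * (1 / (√(m : ℝ) * √n))) := by ring
        _ ≤ _ := by gcongr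
    rw [hrhs]
    have h0 : 0 ≤ ∑ t ∈ J, (26 * W
        + 330 * K * Real.log T * (invSqrtGap (len * k + 1) t + invSqrtGap (l + 1) t)) :=
      Finset.sum_nonneg fun t _ => add_nonneg (by positivity)
        (mul_nonneg (by positivity) (add_nonneg (invSqrtGap_nonneg _ _) (invSqrtGap_nonneg _ _)))
    linarith

/-- Regret, over an episode, of an arm that survives it. -/
theorem IsRun.sum_regret_survivor_le [NeZero K] (hrun : IsRun 18 T H ep st sch)
    (henv : IsEnv T P r v) (hc : Concentrated T P H) (hT : 2 ≤ T) (hlen : 0 < len)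
    {l e : ℕ} (hl : 1 ≤ l) (hle : l ≤ e) (heT : e ≤ T)
    {B : ℕ → ℕ → Bool} (hep : ∀ t ∈ Finset.Icc l e, ep t = l ∧ sch t = B)
    (hB : GoodSchedule T (detectRounds T len r v) (detectDur T len r) l B)
    {a : Fin K} (ha : a ∉ elimSet 18 T H l (e - 1)) :
    ∑ t ∈ Finset.Icc l e, r t a ≤ 3 / 2 + ∑ t ∈ Finset.Icc l e, (26 * blockVar T len v t
        + 330 * K * Real.log T * invSqrtGap (blockStart len t) t)
      + (660 * Real.log T + 5280 * Real.log T ^ 2) * K * √((e : ℝ) + 1 - l) := by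
  classical
  have hlog := two_le_three_mul_log hT
  have hle' : (l : ℝ) ≤ e := by exact_mod_cast hle
  set n : ℝ := (e : ℝ) + 1 - l with hn
  -- Detection must be complete by round e - 2. Rounds l, e - 1 and e are dropped, at regret at most
  -- 1/2 each.
  set u := e - 2 with hu
  have hue : (u : ℝ) ≤ e := by exact_mod_cast (by omega : u ≤ e)
  have hsplit : ∑ t ∈ Finset.Icc l e, r t a
      ≤ 3 / 2 + ∑ t ∈ Finset.Icc (l + 1) u, r t a := by
    set A : Finset ℕ := (Finset.Icc l e) \ Finset.Icc (l + 1) u with hA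
    have hsub : Finset.Icc (l + 1) u ⊆ Finset.Icc l e := Finset.Icc_subset_Icc (by omega) (by omega)
    rw [← Finset.sum_sdiff hsub]
    gcongr
    have hcard : A.card ≤ 3 := by
      have : A ⊆ {l, e - 1, e} := by
        intro t ht
        rw [hA, Finset.mem_sdiff, Finset.mem_Icc, Finset.mem_Icc] at ht
        simp only [Finset.mem_insert, Finset.mem_singleton]
        omega
      exact (Finset.card_le_card this).trans Finset.card_le_three
    calc ∑ t ∈ A, r t a ≤ A.card • (1 / 2 : ℝ) := Finset.sum_le_card_nsmul _ _ _ fun t ht => by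
          rw [hA, Finset.mem_sdiff, Finset.mem_Icc] at ht
          exact henv.le_half t (Finset.mem_Icc.2 (by omega)) a
      _ ≤ 3 / 2 := by
          rw [nsmul_eq_mul]
          have : (A.card : ℝ) ≤ 3 := by exact_mod_cast hcard
          linarith
  have hmaps : ∀ s : Finset ℕ, s ⊆ Finset.Icc (l + 1) T →
      ∀ t ∈ s, (t - 1) / len ∈ Finset.range (T + 1) := by
    intro s hs t ht
    have := Finset.mem_Icc.1 (hs ht)
    have h2 := Nat.div_le_self (t - 1) len
    rw [Finset.mem_range]; omega
  have hI : Finset.Icc (l + 1) u ⊆ Finset.Icc (l + 1) T :=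
    Finset.Icc_subset_Icc le_rfl (by omega)
  have hblocks : ∑ t ∈ Finset.Icc (l + 1) u, r t a
      ≤ ∑ t ∈ Finset.Icc (l + 1) u, (26 * blockVar T len v t
        + 330 * K * Real.log T * (invSqrtGap (blockStart len t) t + invSqrtGap (l + 1) t))
      + 440 * K * Real.log T * √n *
        ∑ s ∈ detectRounds T len r v l u a, (replayProb l s (detectDur T len r a s) : ℝ) := by
    rw [← Finset.sum_fiberwise_of_maps_to (hmaps _ hI),
      ← Finset.sum_fiberwise_of_maps_to (hmaps _ hI) (fun t => 26 * blockVar T len v t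
        + 330 * K * Real.log T * (invSqrtGap (blockStart len t) t + invSqrtGap (l + 1) t)),
      ← Finset.sum_fiberwise_of_maps_to (hmaps _ (detectRounds_subset l u a)),
      Finset.mul_sum, ← Finset.sum_add_distrib]
    exact Finset.sum_le_sum fun k _ => sum_regret_block_le henv hT hlen (by omega)
      (by linarith) (by linarith) a k
  -- All detection rounds missed their replay, so a good schedule bounds their expected number of
  -- hits by 12 log T.
  have hmiss := hB.2 u (by omega) a fun s hs =>
    hrun.not_scheduled_of_survives henv hc hT hlen hl hle heT hep ha hs
  have hI0 : 0 ≤ √n := Real.sqrt_nonneg _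
  have hinv : ∑ t ∈ Finset.Icc (l + 1) u, invSqrtGap (l + 1) t ≤ 2 * √n := by
    refine (sum_invSqrtGap_le_of_subset (b := e + 1) (by omega) fun t ht => ?_).trans ?_
    · rw [Finset.mem_Icc] at ht; rw [Finset.mem_Ico]; omega
    · gcongr
      push_cast; linarith
  have hmono : ∑ t ∈ Finset.Icc (l + 1) u, (26 * blockVar T len v t
        + 330 * K * Real.log T * invSqrtGap (blockStart len t) t)
      ≤ ∑ t ∈ Finset.Icc l e, (26 * blockVar T len v t
        + 330 * K * Real.log T * invSqrtGap (blockStart len t) t) := by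
    refine Finset.sum_le_sum_of_subset_of_nonneg
      (Finset.Icc_subset_Icc (by omega) (by omega)) fun t _ _ => add_nonneg ?_ ?_
    · exact mul_nonneg (by norm_num) (blockVar_nonneg henv.var_nonneg _ _)
    · exact mul_nonneg (by positivity) (invSqrtGap_nonneg _ _)
  have hexp : ∑ t ∈ Finset.Icc (l + 1) u, (26 * blockVar T len v t
        + 330 * K * Real.log T * (invSqrtGap (blockStart len t) t + invSqrtGap (l + 1) t))
      = ∑ t ∈ Finset.Icc (l + 1) u, (26 * blockVar T len v t
        + 330 * K * Real.log T * invSqrtGap (blockStart len t) t)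
        + 330 * K * Real.log T * ∑ t ∈ Finset.Icc (l + 1) u, invSqrtGap (l + 1) t := by
    rw [Finset.mul_sum, ← Finset.sum_add_distrib]
    exact Finset.sum_congr rfl fun t _ => by ring
  have hA : 330 * K * Real.log T * ∑ t ∈ Finset.Icc (l + 1) u, invSqrtGap (l + 1) t
      ≤ 330 * K * Real.log T * (2 * √n) := by gcongr
  have hB' : 440 * K * Real.log T * √n *
      ∑ s ∈ detectRounds T len r v l u a, (replayProb l s (detectDur T len r a s) : ℝ)
      ≤ 440 * K * Real.log T * √n * (12 * Real.log T) := by gcongr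
  calc _ ≤ _ := hsplit
    _ ≤ 3 / 2 + (∑ t ∈ Finset.Icc l e, (26 * blockVar T len v t
        + 330 * K * Real.log T * invSqrtGap (blockStart len t) t)
        + 330 * K * Real.log T * (2 * √n) + 440 * K * Real.log T * √n * (12 * Real.log T)) := by
        linarith
    _ = _ := by ring

end

/-! ### Regret of a run -/

section

variable {T len : ℕ} {P : ℕ → PrefMatrix K} {H : ℕ → Round K} {r : ℕ → Fin K → ℝ} {v : ℕ → ℝ}
variable {ep st : ℕ → ℕ} {sch : ℕ → ℕ → ℕ → Bool}

/-- Regret of the rounds that the episode of round `e` has played up to round `e`. -/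
theorem IsRun.sum_regret_episode_le [NeZero K] (hrun : IsRun 18 T H ep st sch)
    (henv : IsEnv T P r v) (hc : Concentrated T P H) (hT : 2 ≤ T) (hlen : 0 < len)
    {e : ℕ} (he : e ∈ Finset.Icc 1 T)
    (hB : GoodSchedule T (detectRounds T len r v) (detectDur T len r) (ep e) (sch e)) :
    ∑ t ∈ Finset.Icc (ep e) e, (r t (H t).fst + r t (H t).snd) / 2
      ≤ ∑ t ∈ Finset.Icc (ep e) e, (55 * blockVar T len v t
        + 714 * K * Real.log T * invSqrtGap (blockStart len t) t)
      + 25000 * Real.log T ^ 3 * (K * √((e : ℝ) + 1 - ep e)) := by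
  classical
  have he' := Finset.mem_Icc.1 he
  have hlog := two_le_three_mul_log hT
  have hK : (1 : ℝ) ≤ K := by exact_mod_cast NeZero.one_le
  have hep := hrun.ep_eq he'.1 he'.2
  have hle : ep e ≤ e := (hrun.ep_le_st e he).trans (hrun.st_le e he)
  have hone := hrun.one_le_ep e he
  obtain ⟨aL, haL⟩ := hrun.exists_good e he
  set l := ep e with hl
  have hle' : (l : ℝ) ≤ e := by exact_mod_cast hle
  have hep' : ∀ t ∈ Finset.Icc l e, ep t = l ∧ sch t = sch e := fun t ht =>
    hep t (Finset.mem_Icc.1 ht).1 (Finset.mem_Icc.1 ht).2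
  set n : ℝ := (e : ℝ) + 1 - l with hn
  have hn1 : 1 ≤ √n := Real.one_le_sqrt.2 (by linarith)
  have hpt : ∀ t ∈ Finset.Icc l e, (r t (H t).fst + r t (H t).snd) / 2
      ≤ 2 * r t aL + 3 * blockVar T len v t + 54 * K * Real.log T *
      (invSqrtGap (st t) t + invSqrtGap (blockStart len t) t)
        + if t = e then 1 / 2 else 0 := by
    intro t ht
    have ht' := Finset.mem_Icc.1 ht
    have htT : t ∈ Finset.Icc 1 T := Finset.mem_Icc.2 (by omega)
    have hrhs : 0 ≤ 2 * r t aL + 3 * blockVar T len v t + 54 * K * Real.log T *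
        (invSqrtGap (st t) t + invSqrtGap (blockStart len t) t) := by
      have h1 := henv.nonneg t htT aL
      have h2 := blockVar_nonneg (T := T) henv.var_nonneg len t
      have h3 := invSqrtGap_nonneg (st t) t
      have h4 := invSqrtGap_nonneg (blockStart len t) t
      positivity
    by_cases hu : elimSet 18 T H (st t) t = Finset.univ
    · have hte : t = e := by
        by_contra hne
        refine haL (elimSet_mono _ _ _ ?_ (by omega : t ≤ e - 1)
          (hu ▸ Finset.mem_univ aL : aL ∈ elimSet 18 T H (st t) t))
        rw [← (hep' t ht).1]
        exact hrun.ep_le_st t htT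
      rw [if_pos hte]
      linarith [henv.le_half t htT (H t).fst, henv.le_half t htT (H t).snd]
    · have haL' : aL ∉ elimSet 18 T H (ep t) (t - 1) := fun h => haL
        (elimSet_mono _ _ _ (hep' t ht).1.ge (by omega) h)
      have h1 := hrun.regret_le_of_active henv hc hT hlen htT haL'
        (hrun.notMem_of_mem_active htT hu (hrun.fst_mem t htT))
      have h2 := hrun.regret_le_of_active henv hc hT hlen htT haL'
        (hrun.notMem_of_mem_active htT hu (hrun.snd_mem t htT))
      have h3 : (0 : ℝ) ≤ if t = e then 1 / 2 else 0 := by split_ifs <;> norm_num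
      linarith
  have hsurv := hrun.sum_regret_survivor_le henv hc hT hlen hone hle he'.2 hep' hB haL
  have hst := hrun.sum_invSqrtGap_st_le hT hone hle he'.2 hep' hB
  have hsum := Finset.sum_le_sum hpt
  have hite : ∑ t ∈ Finset.Icc l e, (if t = e then (1 / 2 : ℝ) else 0) = 1 / 2 := by
    rw [Finset.sum_ite_eq', if_pos (Finset.right_mem_Icc.2 hle)]
  simp only [Finset.sum_add_distrib, ← Finset.mul_sum, hite] at hsum hsurv ⊢
  set X := ∑ t ∈ Finset.Icc l e, blockVar T len v t
  set Y := ∑ t ∈ Finset.Icc l e, invSqrtGap (blockStart len t) t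
  set Z := ∑ t ∈ Finset.Icc l e, invSqrtGap (st t) t
  set Q := ∑ t ∈ Finset.Icc l e, r t aL
  set L := Real.log T
  set q := √n
  have h1 : 54 * K * L * Z ≤ 54 * K * L * (113 * L ^ 2 * q) := by gcongr
  have hL : 2 / 3 ≤ L := by linarith
  have hKq : 1 ≤ K * q := by nlinarith
  have hL1 : L ≤ 9 / 4 * L ^ 3 := by
    nlinarith [mul_nonneg (by linarith : 0 ≤ L) (by nlinarith : 0 ≤ L ^ 2 - 4 / 9)]
  have hL2 : L ^ 2 ≤ 3 / 2 * L ^ 3 := by nlinarith [sq_nonneg L]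
  have hL3 : 8 / 27 ≤ L ^ 3 := by nlinarith
  have hcoef : (7 / 2 : ℝ) + (1320 * L + 10560 * L ^ 2 + 6102 * L ^ 3) * (K * q)
      ≤ 25000 * L ^ 3 * (K * q) := by
    have e1 : (1320 * L + 10560 * L ^ 2 + 6102 * L ^ 3) * (K * q)
        ≤ 24912 * L ^ 3 * (K * q) := mul_le_mul_of_nonneg_right (by linarith) (by linarith)
    have e2 : (8 / 27 : ℝ) * 1 ≤ L ^ 3 * (K * q) := mul_le_mul hL3 hKq zero_le_one (by positivity)
    linarith
  linarith

/-- A completed episode is long or contains a large variation. -/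
theorem sqrt_le_of_completed [NeZero K] (henv : IsEnv T P r v) (hc : Concentrated T P H)
    (hT : 2 ≤ T) (hlen : 0 < len) {l e : ℕ} (hl : 1 ≤ l) (hle : l ≤ e) (heT : e ≤ T)
    (hcomp : elimSet 18 T H l e = Finset.univ) :
    K * √((e : ℝ) + 1 - l)
      ≤ ∑ t ∈ Finset.Icc l e, ((K : ℝ) / √(len : ℝ) + len * v t) := by
  have hlog := two_le_three_mul_log hT
  have hK : (1 : ℝ) ≤ K := by exact_mod_cast NeZero.one_le
  have hle' : (l : ℝ) ≤ e := by exact_mod_cast hle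
  have hlen' : (0 : ℝ) < len := by exact_mod_cast hlen
  set n : ℝ := (e : ℝ) + 1 - l with hn
  have hn1 : 1 ≤ n := by linarith
  have hsn : 0 < √n := Real.sqrt_pos.2 (by linarith)
  have hsnn : √n * √n = n := Real.mul_self_sqrt (by linarith)
  set W := ∑ t ∈ Finset.Icc l e, v t with hW
  have hW0 : 0 ≤ W := Finset.sum_nonneg fun t _ => henv.var_nonneg t
  rw [Finset.sum_add_distrib, ← Finset.mul_sum, ← hW, Finset.sum_const, Nat.card_Icc,
    nsmul_eq_mul, Nat.cast_sub (by omega)]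
  push_cast
  rw [← hn]
  have hsl : 0 < √(len : ℝ) := Real.sqrt_pos.2 hlen'
  -- A long episode is paid for by K/√len per round. In a short one even an arm without regret in
  -- round l was eliminated, which forces W √n ≥ K.
  rcases le_or_gt (len : ℝ) n with h | h
  · have h1 : √(len : ℝ) ≤ √n := Real.sqrt_le_sqrt h
    have h2 : K * √n ≤ n * (K / √(len : ℝ)) := by
      rw [← mul_div_assoc, le_div_iff₀ hsl]
      calc K * √n * √(len : ℝ) ≤ K * √n * √n := by gcongr
        _ = n * K := by rw [mul_assoc, hsnn, mul_comm]
    have : 0 ≤ len * W := by positivity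
    linarith
  · have hlT : l ∈ Finset.Icc 1 T := Finset.mem_Icc.2 (by omega)
    obtain ⟨a, ha⟩ := henv.exists_zero l hlT
    have hlt := lt_of_mem_elimSet henv hc hl (by omega : e ≤ T + 1)
      (hcomp ▸ Finset.mem_univ a : a ∈ elimSet 18 T H l e) hW0 (fun t h1 h2 => by
        have h3 := (abs_le.1 (henv.abs_sub_le_sum hl h1 (by omega) a)).2
        have h4 : ∑ τ ∈ Finset.Ioc l t, v τ ≤ W :=
          Finset.sum_le_sum_of_subset_of_nonneg (fun τ hτ => by
            rw [Finset.mem_Ioc] at hτ; rw [Finset.mem_Icc]; omega) fun τ _ _ => henv.var_nonneg τ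
        rw [ha] at h3
        linarith)
    have h5 : 2 * W * √((e : ℝ) - l) ≤ 2 * W * √n := by
      gcongr; linarith
    have h6 : (K : ℝ) ≤ W * √n := by
      have : (K : ℝ) * 2 ≤ K * (3 * Real.log T) := by gcongr
      linarith
    have h7 : K * √n ≤ len * W := by
      calc K * √n ≤ W * √n * √n := by gcongr
        _ = n * W := by rw [mul_assoc, hsnn, mul_comm]
        _ ≤ len * W := by gcongr
    have : 0 ≤ n * (K / √(len : ℝ)) := by positivity
    linarith

/-- The cost K √n of a completed episode is spread over its own rounds, so the number of episodes
never enters. Only the last, possibly incomplete, episode pays K √T. -/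
theorem IsRun.sum_regret_le [NeZero K] (hrun : IsRun 18 T H ep st sch)
    (henv : IsEnv T P r v) (hc : Concentrated T P H) (hT : 2 ≤ T) (hlen : 0 < len)
    (hlenT : len ≤ T) (hB : ∀ t ∈ Finset.Icc 1 T,
      GoodSchedule T (detectRounds T len r v) (detectDur T len r) (ep t) (sch t)) :
    ∑ t ∈ Finset.Icc 1 T, (r t (H t).fst + r t (H t).snd) / 2
      ≤ 32000 * Real.log T ^ 3 *
        (K * √(T : ℝ) + K * (T / √(len : ℝ)) + len * ∑ t ∈ Finset.Icc 1 T, v t) := by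
  have hlog := two_le_three_mul_log hT
  have hK : (1 : ℝ) ≤ K := by exact_mod_cast NeZero.one_le
  set L := Real.log T with hL
  set reg : ℕ → ℝ := fun t => (r t (H t).fst + r t (H t).snd) / 2 with hreg
  set h : ℕ → ℝ := fun t => 55 * blockVar T len v t
    + 714 * K * L * invSqrtGap (blockStart len t) t with hh
  set g : ℕ → ℝ := fun t => h t + 25000 * L ^ 3 * (K / √(len : ℝ) + len * v t) with hg
  have hg0 : ∀ t, h t ≤ g t := fun t => by
    have h1 := henv.var_nonneg t
    have : 0 ≤ 25000 * L ^ 3 * (K / √(len : ℝ) + len * v t) := by positivity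
    rw [hg]; simp only; linarith
  -- Induction over rounds; the sums only change when an episode is completed.
  have hprev : ∀ n, 1 ≤ n → n ≤ T →
      ∑ t ∈ Finset.Ico 1 (ep n), reg t ≤ ∑ t ∈ Finset.Ico 1 (ep n), g t := by
    intro n hn
    induction n, hn using Nat.le_induction with
    | base => intro _; rw [hrun.ep_one]; simp
    | succ n hn ih =>
      intro hnT
      have hmem : n ∈ Finset.Icc 1 T := Finset.mem_Icc.2 ⟨hn, by omega⟩
      rcases hrun.step n hmem hnT with ⟨e1, -⟩ | ⟨e1, hcomp⟩
      · rw [e1]; exact ih (by omega)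
      · have hone := hrun.one_le_ep n hmem
        have hle := (hrun.ep_le_st n hmem).trans (hrun.st_le n hmem)
        rw [e1, ← Finset.sum_Ico_consecutive _ hone (by omega : ep n ≤ n + 1),
          ← Finset.sum_Ico_consecutive g hone (by omega : ep n ≤ n + 1)]
        refine add_le_add (ih (by omega)) ?_
        rw [Finset.Ico_add_one_right_eq_Icc]
        have h1 := hrun.sum_regret_episode_le henv hc hT hlen hmem (hB n hmem)
        have h2 := sqrt_le_of_completed henv hc hT hlen hone hle (by omega) hcomp
        have h3 : 25000 * L ^ 3 * (K * √((n : ℝ) + 1 - ep n)) ≤ 25000 * L ^ 3 *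
          ∑ t ∈ Finset.Icc (ep n) n, ((K : ℝ) / √(len : ℝ) + len * v t) := by gcongr
        rw [hg]
        simp only
        rw [Finset.sum_add_distrib, ← Finset.mul_sum]
        linarith
  have hTmem : T ∈ Finset.Icc 1 T := Finset.mem_Icc.2 ⟨by omega, le_rfl⟩
  have hone := hrun.one_le_ep T hTmem
  have hle := (hrun.ep_le_st T hTmem).trans (hrun.st_le T hTmem)
  have hlast := hrun.sum_regret_episode_le henv hc hT hlen hTmem (hB T hTmem)
  have hone' : (1 : ℝ) ≤ ep T := by exact_mod_cast hone
  have hlast2 : 25000 * L ^ 3 * (K * √((T : ℝ) + 1 - ep T)) ≤ 25000 * L ^ 3 * (K * √(T : ℝ)) := by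
    gcongr
    linarith
  have htotal : ∑ t ∈ Finset.Icc 1 T, reg t
      ≤ ∑ t ∈ Finset.Icc 1 T, g t + 25000 * L ^ 3 * (K * √(T : ℝ)) := by
    rw [← Finset.Ico_add_one_right_eq_Icc,
      ← Finset.sum_Ico_consecutive _ hone (by omega : ep T ≤ T + 1),
      ← Finset.sum_Ico_consecutive g hone (by omega : ep T ≤ T + 1),
      Finset.Ico_add_one_right_eq_Icc]
    have h1 := hprev T (by omega) le_rfl
    have h2 : ∑ t ∈ Finset.Icc (ep T) T, h t ≤ ∑ t ∈ Finset.Icc (ep T) T, g t :=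
      Finset.sum_le_sum fun t _ => hg0 t
    linarith
  have hV := sum_blockVar_le (T := T) hlen henv.var_nonneg
  have hI := sum_invSqrtGap_blockStart_le hlen hlenT
  have hV0 : 0 ≤ ∑ t ∈ Finset.Icc 1 T, v t := Finset.sum_nonneg fun t _ => henv.var_nonneg t
  have hgsum : ∑ t ∈ Finset.Icc 1 T, g t = 55 * ∑ t ∈ Finset.Icc 1 T, blockVar T len v t
      + 714 * K * L * ∑ t ∈ Finset.Icc 1 T, invSqrtGap (blockStart len t) t
      + 25000 * L ^ 3 * (T * (K / √(len : ℝ)) + len * ∑ t ∈ Finset.Icc 1 T, v t) := by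
    simp only [hg, hh, Finset.sum_add_distrib, ← Finset.mul_sum, Finset.sum_const, Nat.card_Icc,
      Nat.add_sub_cancel, nsmul_eq_mul]
  have hL0 : 2 / 3 ≤ L := by linarith
  have hL1 : L ≤ 9 / 4 * L ^ 3 := by
    nlinarith [mul_nonneg (by linarith : 0 ≤ L) (by nlinarith : 0 ≤ L ^ 2 - 4 / 9)]
  have hL3 : 8 / 27 ≤ L ^ 3 := by nlinarith
  set V := ∑ t ∈ Finset.Icc 1 T, v t
  set D : ℝ := T / √(len : ℝ) with hD
  have hD0 : 0 ≤ D := by positivity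
  have e0 : (T : ℝ) * (K / √(len : ℝ)) = K * D := by rw [hD]; ring
  rw [e0] at hgsum
  have e1 : 714 * K * L * ∑ t ∈ Finset.Icc 1 T, invSqrtGap (blockStart len t) t
      ≤ 714 * K * L * (4 * D) := by gcongr
  have e2 : L * (K * D) ≤ 9 / 4 * L ^ 3 * (K * D) := by gcongr
  have e3 : 8 / 27 * (len * V) ≤ L ^ 3 * (len * V) := by gcongr
  have e4 : 0 ≤ L ^ 3 * (len * V) := by positivity
  have e5 : 0 ≤ L ^ 3 * (K * D) := by positivity
  have e6 : 0 ≤ L ^ 3 * (K * √(T : ℝ)) := by positivity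
  linarith

end

/-! ### The good event -/

/-- A schedule is drawn initially and at most once per round, and its law depends on the past only
through the episode start. Hence each step adds at most δ. -/
theorem prob_not_goodSchedule_trajectory_le [NeZero K] (C : ℝ) {T : ℕ} (P : ℕ → PrefMatrix K)
    (good : ℕ → (ℕ → ℕ → Bool) → Prop) {δ : ℝ≥0∞}
    (hδ : ∀ l, prob (sampleSchedule T l) (fun B => ¬ good l B) ≤ δ) (n : ℕ) :
    prob (trajectory C T P n) (fun ω => ∃ i ≤ n, ¬ good (ω i).epStart (ω i).sched)
      ≤ (n + 1 : ℕ) * δ := by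
  classical
  have hnew : ∀ l (H : ℕ → Round K),
      prob (newEpisode T l H) (fun S => ¬ good S.epStart S.sched) ≤ δ := by
    intro l H
    rw [newEpisode_eq]
    unfold prob
    simp only [expect_bind, expect_pure]
    exact hδ l
  induction n with
  | zero =>
    simp only [trajectory, prob, expect_bind, expect_pure]
    refine le_trans (expect_mono _ fun S => ?_) ((hnew 1 fun _ => default).trans_eq (by simp))
    by_cases h : good S.epStart S.sched <;> simp [h]
  | succ n ih =>
    have hround : ∀ S : State K, good S.epStart S.sched →
        prob (playRound C T P (n + 1) S) (fun S' => ¬ good S'.epStart S'.sched) ≤ δ := by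
      intro S hS
      rw [playRound_eq]
      unfold prob
      rw [expect_bind, ← expect_const (roundLaw P (n + 1) S.playSet S.playSet_nonempty) δ]
      refine expect_mono _ fun r => ?_
      unfold advance
      simp only
      split_ifs
      · exact hnew _ _
      · rw [expect_pure, if_neg (not_not.2 hS)]
        exact zero_le
    have hstep : prob (trajectory C T P (n + 1))
        (fun ω => ∃ i ≤ n + 1, ¬ good (ω i).epStart (ω i).sched)
        ≤ expect (trajectory C T P n) (fun ω =>
          (@ite _ (∃ i ≤ n, ¬ good (ω i).epStart (ω i).sched) (Classical.propDecidable _) 1 0)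
            + δ) := by
      unfold prob
      rw [trajectory, expect_bind]
      refine expect_mono _ fun ω => ?_
      simp only [expect_bind, expect_pure]
      by_cases hω : ∃ i ≤ n, ¬ good (ω i).epStart (ω i).sched
      · rw [if_pos hω]
        refine le_trans (expect_mono _ (g := fun _ => 1) fun S => ?_)
          ((expect_const _ 1).le.trans le_self_add)
        split_ifs <;> simp
      · rw [if_neg hω, zero_add]
        push Not at hω
        refine le_trans ?_ (hround (ω n) (hω n le_rfl))
        refine prob_mono_of_support (playRound C T P (n + 1) (ω n)) fun S _ hS => ?_
        obtain ⟨i, hi, hne⟩ := hS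
        rcases Nat.lt_or_ge n i with h | h
        · obtain rfl : i = n + 1 := by omega
          rwa [Function.update_self] at hne
        · rw [Function.update_of_ne (by omega)] at hne
          exact absurd (hω i h) hne
    refine hstep.trans ?_
    rw [expect_add, expect_const]
    exact (add_le_add ih le_rfl).trans_eq (by push_cast; ring)

theorem prob_regret_gt_le [NeZero K] {T len : ℕ} {P : ℕ → PrefMatrix K} {w : ℕ → Fin K}
    {v : ℕ → ℝ} (henv : IsEnv T P (fun t a => (P t).gap (w t) a) v) (hT : 2 ≤ T)
    (hlen : 0 < len) (hlenT : len ≤ T) (hKT : K ^ 2 ≤ T) :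
    prob (anaconda 18 T P T) (fun S => 32000 * Real.log T ^ 3 *
        (K * √(T : ℝ) + K * (T / √(len : ℝ)) + len * ∑ t ∈ Finset.Icc 1 T, v t)
        < dynRegret T P w S.hist)
      ≤ (10 * T ^ 3 : ℕ) * ENNReal.ofReal (Real.exp (-(6 * Real.log T))) := by
  set ε := ENNReal.ofReal (Real.exp (-(6 * Real.log T))) with hε
  set r : ℕ → Fin K → ℝ := fun t a => (P t).gap (w t) a with hr
  set good : ℕ → (ℕ → ℕ → Bool) → Prop :=
    GoodSchedule T (detectRounds T len r v) (detectDur T len r) with hgood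
  have h1 := prob_not_goodSchedule_trajectory_le 18 (T := T) P good
    (fun l => prob_not_goodSchedule_le (detectRounds T len r v) (detectDur T len r)
      (fun l u _ a => detectRounds_subset l u a)
      (fun l u hu a s hs => detectDur_mem_durations hT henv hu hs) l) T
  have h2 := prob_not_concentrated_le 18 hT P
  unfold prob at h2 ⊢
  rw [← expect_trajectory 18 T P T] at h2 ⊢
  -- K² ≤ T makes the size of both union bounds cubic in T, below the T⁻⁶ of a single event.
  have hcount : 2 * T ^ 2 * K ^ 2 + (T + 1) * ((T + 1) * Nat.clog 2 T + (T + 1) * K)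
      ≤ 10 * T ^ 3 := by
    have hcl : Nat.clog 2 T ≤ T := by
      rw [Nat.clog_le_iff_le_pow (by norm_num)]
      exact Nat.lt_two_pow_self.le
    have hKle : K ≤ T := (Nat.le_self_pow (by norm_num) K).trans hKT
    calc 2 * T ^ 2 * K ^ 2 + (T + 1) * ((T + 1) * Nat.clog 2 T + (T + 1) * K)
        ≤ 2 * T ^ 2 * T + (2 * T) * ((2 * T) * T + (2 * T) * T) := by
          gcongr <;> omega
      _ = 10 * T ^ 3 := by ring
  calc _ ≤ prob (trajectory 18 T P T) (fun ω => ¬ Concentrated T P (ω T).hist ∨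
        ∃ i ≤ T, ¬ good (ω i).epStart (ω i).sched) := by
        refine prob_mono_of_support _ fun ω hω hgt => ?_
        by_contra hcon
        push Not at hcon
        obtain ⟨hc, hsched⟩ := hcon
        obtain ⟨st, hrun⟩ := isRun_of_mem_support hω
        refine absurd hgt (not_lt.2 ?_)
        exact hrun.sum_regret_le henv hc hT hlen hlenT fun t ht => by
          rw [Finset.mem_Icc] at ht
          exact hsched (t - 1) (by omega)
    _ ≤ _ := prob_or_le _ _ _
    _ ≤ (2 * T ^ 2 * K ^ 2 : ℕ) * ε +
        (T + 1 : ℕ) * (((T + 1) * Nat.clog 2 T + (T + 1) * K : ℕ) * ε) := add_le_add h2 h1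
    _ = ((2 * T ^ 2 * K ^ 2
        + (T + 1) * ((T + 1) * Nat.clog 2 T + (T + 1) * K) : ℕ) : ℝ≥0∞) * ε := by
        push_cast; ring
    _ ≤ (10 * T ^ 3 : ℕ) * ε := by gcongr

/-! ### Expected regret -/

theorem dynRegret_le (T : ℕ) (P : ℕ → PrefMatrix K) (w : ℕ → Fin K) (H : ℕ → Round K) :
    dynRegret T P w H ≤ T := by
  calc dynRegret T P w H ≤ ∑ t ∈ Finset.Icc 1 T, (1 : ℝ) := Finset.sum_le_sum fun t _ => by
        linarith [(P t).gap_le_half (w t) (H t).fst, (P t).gap_le_half (w t) (H t).snd]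
    _ = T := by simp

theorem integral_le_add_of_prob_le {α : Type*} [MeasurableSpace α]
    (hα : ∀ s : Set α, MeasurableSet s)
    (p : PMF α) {X : α → ℝ} (hX : MeasureTheory.Integrable X p.toMeasure) {b M ε : ℝ} (hb : 0 ≤ b)
    (hM : 0 ≤ M) (hXM : ∀ a, X a ≤ M) (hε : 0 ≤ ε)
    (hp : prob p (fun a => b < X a) ≤ ENNReal.ofReal ε) :
    ∫ a, X a ∂p.toMeasure ≤ b + M * ε := by
  classical
  set s : Set α := {a | b < X a} with hs
  have hμ : p.toMeasure s ≤ ENNReal.ofReal ε := by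
    refine le_trans (le_of_eq ?_) hp
    rw [PMF.toMeasure_apply p (hα s)]
    refine tsum_congr fun a => ?_
    by_cases ha : b < X a <;> simp [hs, ha, Set.indicator]
  have hreal : p.toMeasure.real s ≤ ε := ENNReal.toReal_le_of_le_ofReal hε hμ
  have hint : MeasureTheory.Integrable (fun a => b + s.indicator (fun _ => M) a) p.toMeasure :=
    (MeasureTheory.integrable_const b).add ((MeasureTheory.integrable_const M).indicator (hα s))
  calc ∫ a, X a ∂p.toMeasure ≤ ∫ a, (b + s.indicator (fun _ => M) a) ∂p.toMeasure := by
        refine MeasureTheory.integral_mono hX hint fun a => ?_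
        by_cases ha : a ∈ s
        · simp only [Set.indicator_of_mem ha]; linarith [hXM a]
        · simp only [Set.indicator_of_notMem ha, add_zero]; exact not_lt.1 ha
    _ = b + p.toMeasure.real s * M := by
        rw [MeasureTheory.integral_add (MeasureTheory.integrable_const b)
          ((MeasureTheory.integrable_const M).indicator (hα s)),
          MeasureTheory.integral_indicator_const M (hα s)]
        simp
    _ ≤ b + M * ε := by nlinarith

theorem cwVariation_nonneg [NeZero K] (T : ℕ) (P : ℕ → PrefMatrix K) (w : ℕ → Fin K) :
    0 ≤ cwVariation T P w :=
  Finset.sum_nonneg fun t _ => (abs_nonneg _).trans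
    (Finset.le_sup' (fun a : Fin K => |((P t).p (w t) a : ℝ) - ((P (t - 1)).p (w t) a : ℝ)|)
      (Finset.mem_univ 0))

theorem cwVariation_le [NeZero K] (T : ℕ) (P : ℕ → PrefMatrix K) (w : ℕ → Fin K) :
    cwVariation T P w ≤ T := by
  calc cwVariation T P w ≤ ∑ t ∈ Finset.Icc 2 T, (1 : ℝ) := Finset.sum_le_sum fun t _ =>
        Finset.sup'_le _ _ fun a _ => by
          have h1 := ((P t).p (w t) a).2
          have h2 := ((P (t - 1)).p (w t) a).2
          rw [abs_le]
          constructor <;> linarith [h1.1, h1.2, h2.1, h2.2]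
    _ ≤ T := by simp

/-- Choice of the block length. -/
theorem exists_blockLength {K T : ℕ} {V : ℝ} (hK : 1 ≤ K) (hT : 1 ≤ T) (hV : 0 ≤ V)
    (hVT : V ≤ T) : ∃ len : ℕ, 0 < len ∧ len ≤ T ∧
      K * √(T : ℝ) + K * (T / √(len : ℝ)) + len * (2 * V)
        ≤ 5 * (K * √(T : ℝ) + V ^ (1 / 3 : ℝ) * ((K : ℝ) * T) ^ (2 / 3 : ℝ)) := by
  have hK' : (1 : ℝ) ≤ K := by exact_mod_cast hK
  have hT' : (1 : ℝ) ≤ T := by exact_mod_cast hT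
  have hsT : 0 < √(T : ℝ) := Real.sqrt_pos.2 (by linarith)
  have hsTT : √(T : ℝ) * √(T : ℝ) = T := Real.mul_self_sqrt (by linarith)
  have hR : 0 ≤ V ^ (1 / 3 : ℝ) * ((K : ℝ) * T) ^ (2 / 3 : ℝ) := by positivity
  -- For small variation one block suffices and K √T dominates; otherwise the balancing length is
  -- below T.
  rcases le_or_gt (V * √(T : ℝ)) K with h | h
  · refine ⟨T, hT, le_rfl, ?_⟩
    have h1 : (T : ℝ) / √(T : ℝ) = √(T : ℝ) := Real.div_sqrt
    have h2 : T * V ≤ K * √(T : ℝ) := by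
      calc T * V = V * √(T : ℝ) * √(T : ℝ) := by rw [mul_assoc, hsTT, mul_comm]
        _ ≤ K * √(T : ℝ) := by gcongr
    rw [h1]
    have : 0 ≤ K * √(T : ℝ) := by positivity
    linarith
  · have hV0 : 0 < V := by
      by_contra hneg
      have : V = 0 := le_antisymm (not_lt.1 hneg) hV
      rw [this, zero_mul] at h
      linarith
    -- The length ⌈y²⌉ balances K T/√len against len · V: both are of order y² V, which is exactly
    -- V^(1/3) (K T)^(2/3).
    set y : ℝ := (K * T / V) ^ (1 / 3 : ℝ) with hy
    have hKTV : 1 ≤ K * T / V := by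
      rw [le_div_iff₀ hV0]; nlinarith
    have hy1 : 1 ≤ y := Real.one_le_rpow hKTV (by norm_num)
    have hy3 : y ^ 3 = K * T / V := by
      rw [hy, ← Real.rpow_natCast, ← Real.rpow_mul (by linarith)]
      norm_num
    have hy3V : y ^ 3 * V = K * T := by rw [hy3]; field_simp
    have hyT : y ^ 2 < (T : ℝ) := by
      have h1 : y ^ 3 < √(T : ℝ) ^ 3 := by
        rw [hy3, div_lt_iff₀ hV0]
        calc (K : ℝ) * T < V * √(T : ℝ) * T := by gcongr
          _ = √(T : ℝ) ^ 3 * V := by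
            rw [pow_succ, sq, hsTT]; ring
      have h2 : y < √(T : ℝ) := lt_of_pow_lt_pow_left₀ 3 hsT.le h1
      calc y ^ 2 < √(T : ℝ) ^ 2 := by gcongr
        _ = (T : ℝ) := by rw [sq, hsTT]
    have hRy : V ^ (1 / 3 : ℝ) * ((K : ℝ) * T) ^ (2 / 3 : ℝ) = y ^ 2 * V := by
      rw [← hy3V, Real.mul_rpow (by positivity) hV0.le, ← Real.rpow_natCast y 3,
        ← Real.rpow_mul (by linarith), mul_comm, mul_assoc, ← Real.rpow_add hV0]
      norm_num
    have hx1 : y ^ 2 ≤ (⌈y ^ 2⌉₊ : ℝ) := Nat.le_ceil _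
    have hx2 : (⌈y ^ 2⌉₊ : ℝ) < y ^ 2 + 1 := Nat.ceil_lt_add_one (by positivity)
    refine ⟨⌈y ^ 2⌉₊, Nat.ceil_pos.2 (by positivity), Nat.ceil_le.2 hyT.le, ?_⟩
    set x : ℝ := (⌈y ^ 2⌉₊ : ℝ)
    have hsx : y ≤ √x := Real.le_sqrt_of_sq_le hx1
    have h1 : K * (T / √x) ≤ y ^ 2 * V := by
      rw [← mul_div_assoc, div_le_iff₀ (by linarith), ← hy3V]
      calc y ^ 3 * V = y ^ 2 * V * y := by ring
        _ ≤ y ^ 2 * V * √x := by gcongr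
    have h2 : x * (2 * V) ≤ 4 * (y ^ 2 * V) := by
      have hx : x ≤ 2 * y ^ 2 := by nlinarith
      calc x * (2 * V) ≤ 2 * y ^ 2 * (2 * V) := by gcongr
        _ = 4 * (y ^ 2 * V) := by ring
    rw [hRy]
    have : 0 ≤ K * √(T : ℝ) := by positivity
    linarith

end DuelingBandit

open DuelingBandit in
/-- There are universal constants `C`, `c`, `p` such that ANACONDA with threshold constant `C` has
expected dynamic regret at most `c (log T)^p (K √T + V^{1/3} (K T)^{2/3})`, with `V` the Condorcet
Winner Variation, on every preference sequence with Condorcet winners that satisfies SST and STI. -/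
theorem corollary2 :
    ∃ C : ℝ, 0 < C ∧ ∃ c : ℝ, 0 < c ∧ ∃ p : ℕ,
      ∀ (K : ℕ) [NeZero K] (T : ℕ) (P : ℕ → PrefMatrix K) (w : ℕ → Fin K),
        2 ≤ T →
        (∀ t ∈ Finset.Icc 1 T, (P t).IsCondorcetWinner (w t)) →
        (∀ t ∈ Finset.Icc 1 T, (P t).SST) →
        (∀ t ∈ Finset.Icc 1 T, (P t).STI) →
        expectedRegret C T P w ≤
          c * Real.log T ^ p *
            (K * √(T : ℝ) + cwVariation T P w ^ (1 / 3 : ℝ) * ((K : ℝ) * T) ^ (2 / 3 : ℝ)) := by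
  refine ⟨18, by norm_num, 200000, by norm_num, 3, ?_⟩
  intro K _ T P w hT hw hs ht
  have hlog := two_le_three_mul_log hT
  have hL3 : 8 / 27 ≤ Real.log T ^ 3 := by
    have : (2 / 3 : ℝ) ^ 3 ≤ Real.log T ^ 3 := by gcongr; linarith
    linarith
  have hK : (1 : ℝ) ≤ K := by exact_mod_cast NeZero.one_le
  have hT0 : (2 : ℝ) ≤ T := by exact_mod_cast hT
  have hsT : 1 ≤ √(T : ℝ) := Real.one_le_sqrt.2 (by linarith)
  have hsTT : √(T : ℝ) * √(T : ℝ) = T := Real.mul_self_sqrt (by linarith)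
  have hV0 := cwVariation_nonneg T P w
  have hVT := cwVariation_le T P w
  set V := cwVariation T P w
  set R := V ^ (1 / 3 : ℝ) * ((K : ℝ) * T) ^ (2 / 3 : ℝ) with hR
  have hR0 : 0 ≤ R := by positivity
  set X := K * √(T : ℝ) + R with hX
  have hX1 : 1 ≤ X := by nlinarith
  have hmeas : ∀ s : Set (State K), MeasurableSet s := fun _ => trivial
  have hint := integrable_dynRegret 18 T T P w
  unfold expectedRegret
  -- For K² > T the trivial bound T ≤ K √T on the regret suffices.
  rcases le_or_gt (K ^ 2) T with hKT | hKT
  · have henv := isEnv_gap hw hs ht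
    obtain ⟨len, hlen, hlenT, hbound⟩ := exists_blockLength (K := K) (T := T) (V := V)
      NeZero.one_le (by omega) hV0 hVT
    have hprob := prob_regret_gt_le henv hT hlen hlenT hKT
    rw [sum_regretVariation] at hprob
    have hexp : Real.exp (-(6 * Real.log T)) = 1 / (T : ℝ) ^ 6 := by
      rw [Real.exp_neg, show 6 * Real.log T = ((6 : ℕ) : ℝ) * Real.log T by norm_num,
        Real.exp_nat_mul, Real.exp_log (by linarith), one_div]
    rw [hexp, ← ENNReal.ofReal_natCast, ← ENNReal.ofReal_mul (by positivity)] at hprob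
    have hle := integral_le_add_of_prob_le hmeas (anaconda 18 T P T) hint
      (mul_nonneg (by positivity) (by positivity)) (by linarith : (0 : ℝ) ≤ T)
      (fun S => dynRegret_le T P w S.hist) (by positivity) hprob
    refine hle.trans ?_
    have h1 : 32000 * Real.log T ^ 3 * (K * √(T : ℝ) + K * (T / √(len : ℝ)) + len * (2 * V))
        ≤ 32000 * Real.log T ^ 3 * (5 * X) := by gcongr
    -- On the bad event the regret is at most T, which contributes at most T · 10 T³ · T⁻⁶.
    have h2 : (T : ℝ) * ((10 * T ^ 3 : ℕ) * (1 / (T : ℝ) ^ 6)) ≤ 10 := by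
      have : (T : ℝ) * ((10 * T ^ 3 : ℕ) * (1 / (T : ℝ) ^ 6)) = 10 / (T : ℝ) ^ 2 := by
        push_cast; field_simp
      rw [this, div_le_iff₀ (by positivity)]
      nlinarith
    have h3 : 8 / 27 * 1 ≤ Real.log T ^ 3 * X := mul_le_mul hL3 hX1 zero_le_one (by positivity)
    linarith
  · have hKT' : √(T : ℝ) ≤ K := by
      rw [Real.sqrt_le_left (by linarith)]
      exact_mod_cast hKT.le
    have h1 : ∫ S, dynRegret T P w S.hist ∂(anaconda 18 T P T).toMeasure ≤ T := by
      refine (MeasureTheory.integral_mono hint (MeasureTheory.integrable_const (T : ℝ))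
        fun S => dynRegret_le T P w S.hist).trans_eq ?_
      simp
    have h2 : (T : ℝ) ≤ X := by nlinarith
    have h3 : 8 / 27 * X ≤ Real.log T ^ 3 * X := mul_le_mul_of_nonneg_right hL3 (by linarith)
    linarith
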